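/- Let $\rho>0$ and let $(E_i)_{i\ge 1}$ be i.i.d. exponential random variables with parameter $1$. Put $t_0=0$ and $t_n=\sum_{i=1}^n E_i/i$ for $n\ge 1$. For $n\ge 1$ let $$P_n=e^{-\rho t_{n-1}}-e^{-\rho t_n},$$ which is the conditional probability, given $(t_n)$, that an independent exponential random variable with parameter $\rho$ falls into the $n$th bin $(t_{n-1},t_n]$. Then $t_n-\log n$ converges almost surely to a finite random variable $M_\infty$; put $W_\infty=e^{-M_\infty}$. For $n\ge 1$, let ${\mathcal P}_n$ be the point process on ${\mathbb R}_+^2=[0,\infty)^2$ $$\mathcal P_n=\left\{\left(\frac{i}{n^{1/(\rho+2)}},\,nP_i\right),\ i\ge 1\right\},$$ identified with the sum of the Dirac masses at its points, and write $\mathcal P_n(f)=\sum_{i\ge 1}f\big(i/n^{1/(\rho+2)},nP_i\big)$. Theorem. As $n\to\infty$, the sequence $(\mathcal P_n)$ converges in distribution, in the space of locally finite measures on $\mathbb R_+^2$ endowed with the vague topology, to a mixed Poisson point process: the limit is the second component $\mathcal P$ of a pair $(W,\mathcal P)$ such that $W$ has the law of $W_\infty$ and, conditionally on $W$, $\mathcal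 P$ is a Poisson point process on $\mathbb R_+^2$ with intensity measure $$\frac{W^{-\rho}}{\rho}\,x^{\rho+1}\,dx\,dy.$$ Moreover, for every non-negative continuous function $f$ with compact support on $\mathbb R_+^2$, $$\lim_{n\to+\infty}\mathbb E\left(e^{-\mathcal P_n(f)}\right)=\mathbb E\left[\exp\left(-\frac{W_\infty^{-\rho}}{\rho}\int_{\mathbb R_+^2}\left(1-e^{-f(x,y)}\right)x^{\rho+1}\,dx\,dy\right)\right].$$ -/

import Mathlib

open MeasureTheory ProbabilityTheory Filter Topology
open scoped NNReal ENNReal CompactlySupported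

noncomputable section

namespace YuleBins

/-! ### Random measures, vague topology, Poisson processes -/

/-- Locally finite Borel measures on `X`. -/
structure RadonMeasure (X : Type*) [TopologicalSpace X] [MeasurableSpace X] where
  /-- the underlying measure -/
  toMeasure : Measure X
  /-- it is locally finite -/
  locallyFinite : IsLocallyFiniteMeasure toMeasure

/-- The vague topology: the coarsest topology for which `ν ↦ ∫ f dν` is continuous for every
real continuous function `f` with compact support. -/
instance RadonMeasure.instTopologicalSpace {X : Type*} [TopologicalSpace X] [MeasurableSpace X] :
    TopologicalSpace (RadonMeasure X) :=
  TopologicalSpace.induced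
    (fun (ν : RadonMeasure X) (f : C_c(X, ℝ)) => ∫ x, f x ∂ν.toMeasure) inferInstance

/-- The Borel σ-algebra of the vague topology. -/
instance RadonMeasure.instMeasurableSpace {X : Type*} [TopologicalSpace X] [MeasurableSpace X] :
    MeasurableSpace (RadonMeasure X) :=
  borel (RadonMeasure X)

instance RadonMeasure.instBorelSpace {X : Type*} [TopologicalSpace X] [MeasurableSpace X] :
    BorelSpace (RadonMeasure X) :=
  ⟨rfl⟩

/-- `Q` is the law of a Poisson point process on `X` with intensity measure `Λ`: the number of
points in a measurable set `A` with `Λ A < ∞` is Poisson distributed with parameter `Λ A`, and the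
numbers of points in finitely many pairwise disjoint measurable sets are independent. -/
structure IsPoissonLaw {X : Type*} [TopologicalSpace X] [MeasurableSpace X]
    (Λ : Measure X) (Q : Measure (RadonMeasure X)) : Prop where
  count_law : ∀ A : Set X, MeasurableSet A → Λ A ≠ ∞ →
    HasLaw (fun ν : RadonMeasure X => ν.toMeasure A)
      ((poissonMeasure (Λ A).toNNReal).map (fun k : ℕ => (k : ℝ≥0∞))) Q
  indep : ∀ (k : ℕ) (A : Fin k → Set X), (∀ j, MeasurableSet (A j)) →
    Pairwise (fun i j => Disjoint (A i) (A j)) →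
    iIndepFun (fun (j : Fin k) (ν : RadonMeasure X) => ν.toMeasure (A j)) Q

/-! ### The bins

The exponential variables are indexed from `0`: `E i` stands for `E_{i+1}`. -/

variable {Ω : Type*}

/-- `t_n = ∑_{i=1}^n E_i / i`, with `t_0 = 0`. -/
def binEnd (E : ℕ → Ω → ℝ) (n : ℕ) (ω : Ω) : ℝ :=
  ∑ i ∈ Finset.range n, E i ω / ((i : ℝ) + 1)

/-- `binProb ρ E i` is `P_{i+1}`, the probability, given the sequence `(t_n)`, that an independent
exponential variable with parameter `ρ` falls into the bin `(t_i, t_{i+1}]`. -/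
def binProb (ρ : ℝ) (E : ℕ → Ω → ℝ) (i : ℕ) (ω : Ω) : ℝ≥0 :=
  (expMeasure ρ (Set.Ioc (binEnd E i ω) (binEnd E (i + 1) ω))).toNNReal

/-- The explicit form of the bin probabilities. -/
theorem coe_binProb {ρ : ℝ} (hρ : 0 < ρ) (E : ℕ → Ω → ℝ) (i : ℕ) (ω : Ω)
    (h0 : 0 ≤ binEnd E i ω) (h1 : binEnd E i ω ≤ binEnd E (i + 1) ω) :
    (binProb ρ E i ω : ℝ) =
      Real.exp (-(ρ * binEnd E i ω)) - Real.exp (-(ρ * binEnd E (i + 1) ω)) := by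
  have := isProbabilityMeasure_expMeasure hρ
  have key : (binProb ρ E i ω : ℝ) =
      (expMeasure ρ).real (Set.Ioc (binEnd E i ω) (binEnd E (i + 1) ω)) := rfl
  have h2 := measureReal_sdiff (μ := expMeasure ρ) (Set.Iic_subset_Iic.2 h1)
    (measurableSet_Iic (a := binEnd E i ω))
  rw [Set.Iic_sdiff_Iic, ← cdf_eq_real, ← cdf_eq_real, cdf_expMeasure_eq hρ, cdf_expMeasure_eq hρ,
    if_pos h0, if_pos (h0.trans h1)] at h2
  rw [key, h2]
  ring

/-- `M_∞`, the limit of `t_n - log n`. -/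
def limM (E : ℕ → Ω → ℝ) (ω : Ω) : ℝ :=
  limUnder atTop (fun n : ℕ => binEnd E n ω - Real.log n)

/-- `W_∞ = exp (- M_∞)`. -/
def limW (E : ℕ → Ω → ℝ) (ω : Ω) : ℝ :=
  Real.exp (-limM E ω)

/-! ### The point processes on the quadrant -/

/-- The `(i+1)`-st point `((i+1) / n^{1/(ρ+2)}, n P_{i+1})`. -/
def binPoint (ρ : ℝ) (E : ℕ → Ω → ℝ) (n : ℕ+) (ω : Ω) (i : ℕ) : ℝ≥0 × ℝ≥0 :=
  (((i : ℝ≥0) + 1) / ((n : ℕ) : ℝ≥0) ^ (1 / (ρ + 2)), ((n : ℕ) : ℝ≥0) * binProb ρ E i ω)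

theorem isLocallyFinite_binPoint (ρ : ℝ) (E : ℕ → Ω → ℝ) (n : ℕ+) (ω : Ω) :
    IsLocallyFiniteMeasure (Measure.sum fun i : ℕ => Measure.dirac (binPoint ρ E n ω i)) := by
  refine ⟨fun p => ⟨{q | q.1 < p.1 + 1}, ?_, ?_⟩⟩
  · exact (isOpen_lt continuous_fst continuous_const).mem_nhds (by simp)
  · have hm : MeasurableSet {q : ℝ≥0 × ℝ≥0 | q.1 < p.1 + 1} :=
      measurableSet_lt measurable_fst measurable_const
    have hc : 0 < ((n : ℕ) : ℝ≥0) ^ (1 / (ρ + 2)) :=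
      NNReal.rpow_pos (by exact_mod_cast n.pos)
    obtain ⟨N, hN⟩ := exists_nat_gt ((p.1 + 1) * ((n : ℕ) : ℝ≥0) ^ (1 / (ρ + 2)))
    rw [Measure.sum_apply _ hm, tsum_eq_sum (s := Finset.range N)]
    · exact ENNReal.sum_lt_top.2 fun i _ => measure_lt_top _ _
    · intro i hi
      have hi' : (N : ℝ≥0) ≤ i := by
        exact_mod_cast not_lt.1 fun h => hi (Finset.mem_range.2 h)
      rw [Measure.dirac_apply' _ hm, Set.indicator_of_notMem]
      simp only [binPoint, Set.mem_ofPred_eq, not_lt]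
      rw [le_div_iff₀ hc]
      exact hN.le.trans (hi'.trans (le_add_of_nonneg_right zero_le_one))

/-- The point process `𝒫_n = {(i / n^{1/(ρ+2)}, n P_i), i ≥ 1}`, as the sum of the Dirac masses at
its points. -/
def binProcess (ρ : ℝ) (E : ℕ → Ω → ℝ) (n : ℕ+) (ω : Ω) : RadonMeasure (ℝ≥0 × ℝ≥0) where
  toMeasure := Measure.sum fun i : ℕ => Measure.dirac (binPoint ρ E n ω i)
  locallyFinite := isLocallyFinite_binPoint ρ E n ω

/-- Lebesgue measure `dx dy` on the quadrant. -/
def quadrantVolume : Measure (ℝ≥0 × ℝ≥0) :=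
  (volume : Measure (ℝ × ℝ)).comap fun p => ((p.1 : ℝ), (p.2 : ℝ))

/-- The measure `(w^{-ρ} / ρ) x^{ρ+1} dx dy` on the quadrant. -/
def limitIntensity (ρ w : ℝ) : Measure (ℝ≥0 × ℝ≥0) :=
  quadrantVolume.withDensity
    fun p => ENNReal.ofReal (w ^ (-ρ) / ρ * (p.1 : ℝ) ^ (ρ + 1))

end YuleBins

end

/-! Put `a = n ^ (1 / (ρ + 2))` and count from `0` as in the code. Then `P_{k+1} = exp (-ρ t_k) (1 -
exp (-ρ E_k / (k + 1)))`. With `θ_k = exp (ρ (t_k - log (k + 1))) / ρ` (`binLevel`) and `x = (k + 1)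
/ a`, the ordinate `n P_{k+1}` is close to `E_k / c`, where `c = θ_k x ^ (ρ + 1) / a` is small. An
exponential variable has density `1` at `0`, so given the past the mean of `g` at this point is
about `c ∫ g(x, y) dy` (`abs_integral_test_ordinate_sub_le`). About `R a` bins matter, each
contributing `O(1 / a)`, and the sum is a Riemann sum for `θ ∫∫ g x ^ (ρ + 1) dx dy`.

The level `θ_k` is random, but it converges almost surely to `W_∞ ^ (-ρ) / ρ`: the centred part of
`t_k` is an L²-bounded martingale, and harmonic numbers minus `log` converge
(`ae_tendsto_binEnd_sub_log`). With `g = 1 - exp (-f)` the Laplace functional is `E ∏ (1 -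
g(point))`. A fixed number `m` of initial bins leaves the support of `g`. In the remaining factors
`g` may be replaced by a conditional mean in which `θ_k` is frozen at `θ_m`
(`abs_integral_mul_prod_sub_le`). Given `θ_m`, the frozen product tends to an exponential as `a →
∞`, and `θ_m` is close to its limit when `m` is large. A truncation at a level `L` makes all errors
uniform (`tendsto_integral_prod_one_sub_binTest`).

It remains to turn Laplace functionals into laws. Countably many of them embed the vague topology
into a cube, where Stone–Weierstrass reduces weak convergence to monomials, which are again Laplace
functionals (`RadonMeasure.tendsto_of_tendsto_laplace`). Poisson processes are built by superposing
Poisson numbers of independent points. Their laws depend weakly continuously on a scalar factor of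
the intensity, hence form a kernel (`RadonMeasure.exists_kernel_poisson`), and mixing it by the law
of `W_∞` gives the limit. -/

noncomputable section

namespace YuleBins

/-! ### Weak convergence on cubes -/

/-- The coordinate functions of a cube, as real continuous functions. -/
def cubeCoord {ι : Type*} (i : ι) : C(ι → unitInterval, ℝ) :=
  ⟨fun x => x i, by fun_prop⟩

/-- Stone–Weierstrass: distinct points of a cube differ in some coordinate. -/
theorem dense_adjoin_cubeCoord (ι : Type*) :
    (Algebra.adjoin ℝ (Set.range (cubeCoord (ι := ι)))).topologicalClosure = ⊤ := by
  apply ContinuousMap.subalgebra_topologicalClosure_eq_top_of_separatesPoints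
  intro x y hxy
  obtain ⟨i, hi⟩ := Function.ne_iff.1 hxy
  exact ⟨cubeCoord i, ⟨cubeCoord i, Algebra.subset_adjoin ⟨i, rfl⟩, rfl⟩,
    fun h => hi (Subtype.ext h)⟩

theorem integrable_of_continuousMap {K : Type*} [TopologicalSpace K] [CompactSpace K]
    [MeasurableSpace K] [OpensMeasurableSpace K] (μ : Measure K) [IsFiniteMeasure μ]
    (F : C(K, ℝ)) : Integrable F μ :=
  (BoundedContinuousFunction.mkOfCompact F).integrable μ

/-- On a cube, weak convergence follows from the convergence of the integrals of monomials. -/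
theorem tendsto_of_tendsto_integral_monomial {ι γ : Type*} [Countable ι] {L : Filter γ}
    {μs : γ → ProbabilityMeasure (ι → unitInterval)} {μ : ProbabilityMeasure (ι → unitInterval)}
    (h : ∀ s : Multiset ι, Tendsto
      (fun c => ∫ x, (s.map fun i => (x i : ℝ)).prod ∂(μs c : Measure (ι → unitInterval))) L
      (𝓝 (∫ x, (s.map fun i => (x i : ℝ)).prod ∂(μ : Measure (ι → unitInterval))))) :
    Tendsto μs L (𝓝 μ) := by
  have key : ∀ F ∈ Algebra.adjoin ℝ (Set.range (cubeCoord (ι := ι))), Tendsto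
      (fun c => ∫ x, F x ∂(μs c : Measure (ι → unitInterval))) L
      (𝓝 (∫ x, F x ∂(μ : Measure (ι → unitInterval)))) := by
    intro F hF
    -- The subalgebra is the linear span of the monomials, so the hypothesis extends to it by
    -- linearity.
    rw [← Subalgebra.mem_toSubmodule, Algebra.adjoin_eq_span] at hF
    induction hF using Submodule.span_induction with
    | mem F hF =>
      obtain ⟨l, hl, rfl⟩ := Submonoid.exists_multiset_of_mem_closure hF
      obtain ⟨s, rfl⟩ : ∃ s : Multiset ι, s.map cubeCoord = l := by
        clear hF
        induction l using Multiset.induction_on with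
        | empty => exact ⟨0, rfl⟩
        | cons G l ih =>
          obtain ⟨i, hi⟩ := hl G (Multiset.mem_cons_self _ _)
          obtain ⟨s, hs⟩ := ih fun y hy => hl y (Multiset.mem_cons_of_mem hy)
          exact ⟨i ::ₘ s, by rw [Multiset.map_cons, hi, hs]⟩
      have hprod : ∀ x : ι → unitInterval,
          (s.map cubeCoord).prod x = (s.map fun i => (x i : ℝ)).prod := by
        intro x
        clear hl hF
        induction s using Multiset.induction_on with
        | empty => simp
        | cons a s ih =>
          rw [Multiset.map_cons, Multiset.prod_cons, Multiset.map_cons, Multiset.prod_cons,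
            ContinuousMap.mul_apply, ih]
          rfl
      simpa only [hprod] using h s
    | zero => simpa using tendsto_const_nhds
    | add F G _ _ hF hG =>
      have e : ∀ m : ProbabilityMeasure (ι → unitInterval),
          ∫ x, (F + G) x ∂(m : Measure (ι → unitInterval)) =
            ∫ x, F x ∂(m : Measure (ι → unitInterval)) +
              ∫ x, G x ∂(m : Measure (ι → unitInterval)) := fun m =>
        integral_add (integrable_of_continuousMap _ F) (integrable_of_continuousMap _ G)
      simp only [e]
      exact hF.add hG
    | smul a F _ hF =>
      simp only [ContinuousMap.smul_apply, integral_smul]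
      exact hF.const_smul a
  rw [ProbabilityMeasure.tendsto_iff_forall_integral_tendsto]
  intro F
  rw [Metric.tendsto_nhds]
  intro ε hε
  have hF : F.toContinuousMap ∈
      (Algebra.adjoin ℝ (Set.range (cubeCoord (ι := ι)))).topologicalClosure := by
    rw [dense_adjoin_cubeCoord]; trivial
  obtain ⟨G, hG, hFG⟩ := Metric.mem_closure_iff.1 hF (ε / 3) (by positivity)
  have hclose : ∀ m : ProbabilityMeasure (ι → unitInterval),
      dist (∫ x, F x ∂(m : Measure (ι → unitInterval)))
        (∫ x, G x ∂(m : Measure (ι → unitInterval))) ≤ ε / 3 := by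
    intro m
    rw [dist_eq_norm, ← integral_sub (F.integrable _) (integrable_of_continuousMap _ G)]
    refine (norm_integral_le_of_norm_le_const (C := ε / 3) (ae_of_all _ fun x => ?_)).trans
      (by simp)
    rw [← dist_eq_norm]
    exact (ContinuousMap.dist_apply_le_dist (f := F.toContinuousMap) x).trans hFG.le
  filter_upwards [Metric.tendsto_nhds.1 (key G hG) (ε / 3) (by positivity)] with c hc
  have h1 := hclose (μs c)
  have h2 := hclose μ
  rw [dist_comm] at h2
  calc _ ≤ _ := dist_triangle4 _ (∫ x, G x ∂(μs c : Measure (ι → unitInterval)))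
                  (∫ x, G x ∂(μ : Measure (ι → unitInterval))) _
    _ < ε := by linarith

/-- A probability measure on a cube is determined by the integrals of monomials. -/
theorem ext_of_integral_monomial {ι : Type*} [Countable ι]
    {μ μ' : Measure (ι → unitInterval)} [IsProbabilityMeasure μ] [IsProbabilityMeasure μ']
    (h : ∀ s : Multiset ι, ∫ x, (s.map fun i => (x i : ℝ)).prod ∂μ =
      ∫ x, (s.map fun i => (x i : ℝ)).prod ∂μ') : μ = μ' := by
  let p : ProbabilityMeasure (ι → unitInterval) := ⟨μ, inferInstance⟩
  let p' : ProbabilityMeasure (ι → unitInterval) := ⟨μ', inferInstance⟩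
  -- The constant sequence `p` converges to `p'`, and weak limits are unique.
  have h1 : Tendsto (fun _ : ℕ => p) atTop (𝓝 p') := by
    refine tendsto_of_tendsto_integral_monomial fun s => ?_
    simp only [p, p', ProbabilityMeasure.coe_mk, h s]
    exact tendsto_const_nhds
  have h2 : p = p' := tendsto_nhds_unique tendsto_const_nhds h1
  exact congrArg Subtype.val h2

end YuleBins

end

noncomputable section

namespace YuleBins

/-! ### The vague topology -/

namespace RadonMeasure

theorem exists_bump {X : Type*} [TopologicalSpace X] [T2Space X] [LocallyCompactSpace X]
    {K : Set X} (hK : IsCompact K) :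
    ∃ b : C_c(X, ℝ≥0), (∀ x ∈ K, b x = 1) ∧ ∀ x, b x ≤ 1 := by
  obtain ⟨f, hf, -, hc, h01⟩ := exists_continuous_one_zero_of_isCompact hK isClosed_empty
    (Set.disjoint_empty K)
  refine ⟨CompactlySupportedContinuousMap.nnrealPart ⟨f, hc⟩, fun x hx => ?_, fun x => ?_⟩
  · rw [CompactlySupportedContinuousMap.nnrealPart_apply]
    have : f x = 1 := hf hx
    simp [this]
  · rw [CompactlySupportedContinuousMap.nnrealPart_apply, Real.toNNReal_le_one]
    exact (h01 x).2

variable {X : Type*} [TopologicalSpace X] [MeasurableSpace X]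

instance instIsLocallyFiniteMeasure (ν : RadonMeasure X) : IsLocallyFiniteMeasure ν.toMeasure :=
  ν.locallyFinite

theorem integrable_coe [OpensMeasurableSpace X] (ν : RadonMeasure X) (f : C_c(X, ℝ≥0)) :
    Integrable (fun x => (f x : ℝ)) ν.toMeasure := by
  have h := f.toReal.continuous.integrable_of_hasCompactSupport
    (μ := ν.toMeasure) f.toReal.hasCompactSupport
  exact h.congr (ae_of_all _ fun x => by simp)

/-- The exponential of minus the integral of a test function. -/
def laplace (f : C_c(X, ℝ≥0)) (ν : RadonMeasure X) : unitInterval :=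
  ⟨Real.exp (-∫ x, (f x : ℝ) ∂ν.toMeasure), (Real.exp_pos _).le, by
    rw [Real.exp_le_one_iff, neg_nonpos]
    exact integral_nonneg fun x => (f x).2⟩

theorem coe_laplace (f : C_c(X, ℝ≥0)) (ν : RadonMeasure X) :
    (laplace f ν : ℝ) = Real.exp (-∫ x, (f x : ℝ) ∂ν.toMeasure) :=
  rfl

/-- This is why monomials on the cube suffice: a product of Laplace functionals is the Laplace
functional of the sum of the test functions. -/
theorem prod_laplace [OpensMeasurableSpace X] (ν : RadonMeasure X) (s : Multiset C_c(X, ℝ≥0)) :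
    (s.map fun f => (laplace f ν : ℝ)).prod = laplace s.sum ν := by
  induction s using Multiset.induction_on with
  | empty => simp [coe_laplace]
  | cons f s ih =>
    rw [Multiset.map_cons, Multiset.prod_cons, ih, Multiset.sum_cons]
    simp only [coe_laplace, ← Real.exp_add, CompactlySupportedContinuousMap.add_apply,
      NNReal.coe_add]
    rw [integral_add (ν.integrable_coe f) (ν.integrable_coe s.sum)]
    ring_nf

theorem continuous_integral (f : C_c(X, ℝ)) :
    Continuous fun ν : RadonMeasure X => ∫ x, f x ∂ν.toMeasure := by
  have h : Continuous fun (ν : RadonMeasure X) (f : C_c(X, ℝ)) => ∫ x, f x ∂ν.toMeasure :=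
    continuous_induced_dom
  exact continuous_pi_iff.1 h f

theorem continuous_integral_coe (f : C_c(X, ℝ≥0)) :
    Continuous fun ν : RadonMeasure X => ∫ x, (f x : ℝ) ∂ν.toMeasure := by
  simpa using continuous_integral f.toReal

theorem continuous_laplace (f : C_c(X, ℝ≥0)) : Continuous (laplace (X := X) f) :=
  (Real.continuous_exp.comp (continuous_integral_coe f).neg).subtype_mk _

-- Cut-offs along a compact exhaustion times a dense sequence of `C(X, ℝ≥0)`. The error is measured
-- against `D j`, a member of the same family chosen before `ε`, so that the integrals of the `D i`
-- alone control those of every test function.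
omit [MeasurableSpace X] in
theorem exists_seq_approx [T2Space X] [LocallyCompactSpace X] [SecondCountableTopology X] :
    ∃ D : ℕ → C_c(X, ℝ≥0), ∀ f : C_c(X, ℝ≥0), ∃ j, ∀ ε : ℝ, 0 < ε → ∃ i, ∀ x,
      |(f x : ℝ) - D i x| ≤ ε * D j x := by
  let K : CompactExhaustion X := default
  choose b hb1 hb2 using fun n => exists_bump (K.isCompact n)
  let H := TopologicalSpace.denseSeq C(X, ℝ≥0)
  let D : ℕ → ℕ → C_c(X, ℝ≥0) := fun m n =>
    ⟨⟨fun x => b m x * H n x, by fun_prop⟩, (b m).hasCompactSupport.mul_right⟩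
  have hD : ∀ m n x, D m n x = b m x * H n x := fun _ _ _ => rfl
  have hdense : ∀ (g : C(X, ℝ≥0)) (T : Set X), IsCompact T → ∀ ε : ℝ, 0 < ε →
      ∃ n, ∀ x ∈ T, dist (g x) (H n x) < ε := by
    intro g T hT ε hε
    have h1 : Tendsto id (𝓝 g) (𝓝 g) := tendsto_id
    rw [ContinuousMap.tendsto_iff_forall_isCompact_tendstoUniformlyOn] at h1
    have h2 := Metric.tendstoUniformlyOn_iff.1 (h1 T hT) ε hε
    obtain ⟨_, ⟨n, rfl⟩, hx⟩ :=
      (TopologicalSpace.denseRange_denseSeq C(X, ℝ≥0)).inter_nhds_nonempty h2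
    exact ⟨n, hx⟩
  refine ⟨fun k => D k.unpair.1 k.unpair.2, fun f => ?_⟩
  obtain ⟨m, hm⟩ := K.exists_superset_of_isCompact f.hasCompactSupport
  -- Approximating the constant `2` within `1` makes `H j ≥ 1` on the support of the cut-off, so `D
  -- j ≥ b m`.
  obtain ⟨j, hj⟩ := hdense (ContinuousMap.const X 2) _ (b m).hasCompactSupport 1 one_pos
  refine ⟨Nat.pair m j, fun ε hε => ?_⟩
  obtain ⟨i, hi⟩ := hdense f.toContinuousMap _ (b m).hasCompactSupport ε hε
  refine ⟨Nat.pair m i, fun x => ?_⟩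
  simp only [Nat.unpair_pair, hD, NNReal.coe_mul]
  by_cases hx : x ∈ tsupport (b m)
  · have h1 := hi x hx
    have h2 := hj x hx
    rw [NNReal.dist_eq] at h1 h2
    have h3 : (f x : ℝ) = b m x * f x := by
      by_cases hx' : x ∈ tsupport f
      · simp [hb1 m x (hm hx')]
      · simp [image_eq_zero_of_notMem_tsupport hx']
    have h4 : (1 : ℝ) ≤ H j x := by
      have := (abs_lt.1 h2).2
      simp only [ContinuousMap.const_apply, NNReal.coe_ofNat] at this
      linarith
    rw [h3, ← mul_sub, abs_mul, NNReal.abs_eq]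
    calc (b m x : ℝ) * |(f x : ℝ) - H i x| ≤ b m x * ε := by gcongr; exact h1.le
      _ ≤ b m x * (ε * H j x) := by
        gcongr
        exact le_mul_of_one_le_right hε.le h4
      _ = _ := by ring
  · have h0 : b m x = 0 := image_eq_zero_of_notMem_tsupport hx
    have h1 : f x = 0 := by
      refine image_eq_zero_of_notMem_tsupport fun hx' => ?_
      simpa [h0] using hb1 m x (hm hx')
    simp [h0, h1]

variable [BorelSpace X]

/-- Near `y₀` the integral of `D j` stays below `C + 1` by continuity, so the approximation of `f`
is uniform there and an `ε / 3` argument applies. The space `Y` is arbitrary so that the Radon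
measures may carry another topology. -/
theorem continuous_integral_of_seq {D : ℕ → C_c(X, ℝ≥0)} {Y : Type*} [TopologicalSpace Y]
    {N : Y → RadonMeasure X}
    (hN : ∀ i, Continuous fun y => ∫ x, (D i x : ℝ) ∂(N y).toMeasure) {f : C_c(X, ℝ≥0)} {j : ℕ}
    (hf : ∀ ε : ℝ, 0 < ε → ∃ i, ∀ x, |(f x : ℝ) - D i x| ≤ ε * D j x) :
    Continuous fun y => ∫ x, (f x : ℝ) ∂(N y).toMeasure := by
  rw [continuous_iff_continuousAt]
  intro y₀
  rw [ContinuousAt, Metric.tendsto_nhds]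
  intro ε hε
  set C : ℝ := ∫ x, (D j x : ℝ) ∂(N y₀).toMeasure with hC
  have hC0 : 0 ≤ C := integral_nonneg fun x => (D j x).2
  obtain ⟨i, hi⟩ := hf (ε / (3 * (C + 1))) (by positivity)
  have hclose : ∀ y, dist (∫ x, (f x : ℝ) ∂(N y).toMeasure) (∫ x, (D i x : ℝ) ∂(N y).toMeasure) ≤
      ε / (3 * (C + 1)) * ∫ x, (D j x : ℝ) ∂(N y).toMeasure := by
    intro y
    rw [Real.dist_eq, ← integral_sub ((N y).integrable_coe f) ((N y).integrable_coe (D i)),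
      ← integral_const_mul]
    refine (abs_integral_le_integral_abs).trans (integral_mono ?_ ?_ hi)
    · exact (((N y).integrable_coe f).sub ((N y).integrable_coe (D i))).abs
    · exact ((N y).integrable_coe (D j)).const_mul _
  have e1 : ∀ᶠ y in 𝓝 y₀, ∫ x, (D j x : ℝ) ∂(N y).toMeasure < C + 1 :=
    (hN j).continuousAt.eventually_lt_const (lt_add_one _)
  filter_upwards [e1, Metric.tendsto_nhds.1 (hN i).continuousAt (ε / 3) (by positivity)]
    with y h1 h2
  have hb : ∀ c, c ≤ C + 1 → ε / (3 * (C + 1)) * c ≤ ε / 3 := by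
    intro c hc
    calc ε / (3 * (C + 1)) * c ≤ ε / (3 * (C + 1)) * (C + 1) := by gcongr
      _ = ε / 3 := by field_simp
  have h3 := (hclose y).trans (hb _ h1.le)
  have h4 := (hclose y₀).trans (hb _ (by linarith))
  rw [dist_comm] at h4
  calc _ ≤ _ := dist_triangle4 _ (∫ x, (D i x : ℝ) ∂(N y).toMeasure)
                  (∫ x, (D i x : ℝ) ∂(N y₀).toMeasure) _
    _ < ε := by linarith

variable [T2Space X] [LocallyCompactSpace X] [SecondCountableTopology X]

/-- The vague topology is induced by countably many Laplace functionals. -/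
theorem exists_isInducing_laplace : ∃ D : ℕ → C_c(X, ℝ≥0),
    IsInducing fun (ν : RadonMeasure X) (i : ℕ) => laplace (D i) ν := by
  obtain ⟨D, hD⟩ := exists_seq_approx (X := X)
  refine ⟨D, ⟨le_antisymm
    (continuous_iff_le_induced.1 (continuous_pi fun i => continuous_laplace (D i))) ?_⟩⟩
  refine continuous_iff_le_induced.1 ?_
  -- `t'` is the topology of the Laplace functionals of the family. To see that it is fine enough,
  -- integrals of the `D i` are recovered by `-log`, then those of all non-negative test functions,
  -- then those of real ones by positive and negative parts.
  let t' : TopologicalSpace (RadonMeasure X) :=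
    TopologicalSpace.induced (fun ν (i : ℕ) => laplace (D i) ν) inferInstance
  have h1 : ∀ i, @Continuous _ _ t' _ (fun ν : RadonMeasure X => laplace (D i) ν) := by
    have h : @Continuous _ _ t' _ (fun (ν : RadonMeasure X) (i : ℕ) => laplace (D i) ν) :=
      continuous_induced_dom
    exact continuous_pi_iff.1 h
  have h2 : ∀ i, @Continuous _ _ t' _
      (fun ν : RadonMeasure X => ∫ x, (D i x : ℝ) ∂ν.toMeasure) := by
    intro i
    have : @Continuous _ _ t' _ (fun ν : RadonMeasure X => -Real.log (laplace (D i) ν)) :=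
      (Continuous.log (continuous_subtype_val.comp (h1 i)) fun ν => (Real.exp_pos _).ne').neg
    simpa [coe_laplace] using this
  refine continuous_pi fun f => ?_
  have h3 : ∀ f : C_c(X, ℝ≥0), @Continuous _ _ t' _
      (fun ν : RadonMeasure X => ∫ x, (f x : ℝ) ∂ν.toMeasure) := fun f =>
    continuous_integral_of_seq (N := id) h2 (hD f).choose_spec
  have h4 : ∀ ν : RadonMeasure X, ∫ x, f x ∂ν.toMeasure =
      ∫ x, (f.nnrealPart x : ℝ) ∂ν.toMeasure - ∫ x, ((-f).nnrealPart x : ℝ) ∂ν.toMeasure := by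
    intro ν
    rw [← integral_sub (ν.integrable_coe _) (ν.integrable_coe _)]
    congr with x
    conv_lhs => rw [← CompactlySupportedContinuousMap.nnrealPart_sub_nnrealPart_neg f]
    simp
  simp only [h4]
  exact (h3 _).sub (h3 _)

/-- A map into the space of Radon measures is measurable as soon as the integrals of test functions
are measurable. -/
theorem measurable_of_integral {Y : Type*} [MeasurableSpace Y] {N : Y → RadonMeasure X}
    (hN : ∀ f : C_c(X, ℝ≥0), Measurable fun y => ∫ x, (f x : ℝ) ∂(N y).toMeasure) :
    Measurable N := by
  obtain ⟨D, hD⟩ := exists_isInducing_laplace (X := X)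
  intro s hs
  -- The Borel σ-algebra is pulled back from the countable cube, so countably many coordinates
  -- decide measurability.
  have h1 : (instMeasurableSpace : MeasurableSpace (RadonMeasure X)) =
      MeasurableSpace.comap (fun ν (i : ℕ) => laplace (D i) ν) inferInstance := by
    change borel (RadonMeasure X) = _
    rw [hD.eq_induced, borel_comap, ← BorelSpace.measurable_eq]
  rw [h1] at hs
  obtain ⟨t, ht, rfl⟩ := hs
  have h2 : Measurable fun y (i : ℕ) => laplace (D i) (N y) :=
    measurable_pi_lambda _ fun i => ((hN (D i)).neg.exp).subtype_mk
  exact h2 ht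

/-- Convergence of Laplace functionals implies weak convergence of the laws. -/
theorem tendsto_of_tendsto_laplace {γ : Type*} {L : Filter γ} [L.IsCountablyGenerated]
    {Qs : γ → ProbabilityMeasure (RadonMeasure X)} {Q : ProbabilityMeasure (RadonMeasure X)}
    (h : ∀ f : C_c(X, ℝ≥0), Tendsto
      (fun c => ∫ ν, Real.exp (-∫ x, (f x : ℝ) ∂ν.toMeasure) ∂(Qs c : Measure (RadonMeasure X))) L
      (𝓝 (∫ ν, Real.exp (-∫ x, (f x : ℝ) ∂ν.toMeasure) ∂(Q : Measure (RadonMeasure X))))) :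
    Tendsto Qs L (𝓝 Q) := by
  obtain ⟨D, hD⟩ := exists_isInducing_laplace (X := X)
  set Ψ := fun (ν : RadonMeasure X) (i : ℕ) => laplace (D i) ν with hΨ
  have hm : Measurable Ψ := hD.continuous.measurable
  have h1 : Tendsto (fun c => (Qs c).map hm.aemeasurable) L (𝓝 (Q.map hm.aemeasurable)) := by
    refine tendsto_of_tendsto_integral_monomial fun s => ?_
    have e : ∀ q : ProbabilityMeasure (RadonMeasure X),
        ∫ x, (s.map fun i => (x i : ℝ)).prod ∂(q.map hm.aemeasurable : Measure (ℕ → unitInterval)) =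
          ∫ ν, Real.exp (-∫ x, ((s.map D).sum x : ℝ) ∂ν.toMeasure)
            ∂(q : Measure (RadonMeasure X)) := by
      intro q
      rw [ProbabilityMeasure.toMeasure_map, integral_map hm.aemeasurable]
      · congr with ν
        rw [← coe_laplace, ← prod_laplace, Multiset.map_map]
        rfl
      · refine Measurable.aestronglyMeasurable ?_
        induction s using Multiset.induction_on with
        | empty => simp
        | cons a s ih =>
          simp only [Multiset.map_cons, Multiset.prod_cons]
          exact (measurable_subtype_coe.comp (measurable_pi_apply a)).mul ih
    simp only [e]
    exact h _
  -- Portmanteau: every vaguely open set is the preimage under `Ψ` of an open set of the cube, so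
  -- the lower bound pulls back. Nothing is needed about the range of `Ψ`.
  refine tendsto_of_forall_isOpen_le_liminf' fun U hU => ?_
  obtain ⟨V, hV, rfl⟩ := hD.isOpen_iff.1 hU
  have h2 := ProbabilityMeasure.le_liminf_measure_open_of_tendsto h1 hV
  simpa only [ProbabilityMeasure.toMeasure_map, Measure.map_apply hm hV.measurableSet] using h2

end RadonMeasure

end YuleBins

end

/-! ### Measurability of evaluations, and Laplace transforms on powers of `[0, ∞]` -/

noncomputable section

namespace YuleBins

namespace RadonMeasure

variable {X : Type*} [TopologicalSpace X] [MeasurableSpace X] [BorelSpace X]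
  [T2Space X] [LocallyCompactSpace X] [SecondCountableTopology X]

/-- In a metrizable space a compact `K` is a `Gδ`, hence is exactly the set where some compactly
supported `f` with values in `[0, 1]` equals `1`. The powers of `f` decrease to the indicator of
`K`. -/
theorem measurable_apply_of_isCompact {K : Set X} (hK : IsCompact K) :
    Measurable fun ν : RadonMeasure X => ν.toMeasure K := by
  let := TopologicalSpace.metrizableSpaceMetric X
  obtain ⟨f, hf1, -, hfc, hf⟩ := exists_continuous_one_zero_of_isCompact_of_isGδ hK
    hK.isClosed.isGδ isClosed_empty (Set.disjoint_empty K)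
  -- The exponent `n + 1` excludes the power `0`, which need not have compact support.
  let F : ℕ → C_c(X, ℝ) := fun n => ⟨⟨fun x => f x ^ (n + 1), by fun_prop⟩, by
    have h : HasCompactSupport (⇑f * fun x => f x ^ n) := hfc.mul_right
    convert! h using 1
    exact funext fun x => pow_succ' (f x) n⟩
  have hF : ∀ n x, F n x = f x ^ (n + 1) := fun _ _ => rfl
  have hlim : ∀ ν : RadonMeasure X,
      Tendsto (fun n => ∫ x, F n x ∂ν.toMeasure) atTop (𝓝 (ν.toMeasure.real K)) := by
    intro ν
    rw [← integral_indicator_one hK.measurableSet]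
    refine tendsto_integral_of_dominated_convergence f
      (fun n => (F n).continuous.aestronglyMeasurable)
      (f.continuous.integrable_of_hasCompactSupport hfc) (fun n => ae_of_all _ fun x => ?_)
      (ae_of_all _ fun x => ?_)
    · rw [hF, Real.norm_of_nonneg (pow_nonneg (hf x).1 _), pow_succ]
      exact mul_le_of_le_one_left (hf x).1 (pow_le_one₀ (hf x).1 (hf x).2)
    · simp only [hF]
      by_cases hx : x ∈ K
      · have h1 : f x = 1 := by rw [hf1] at hx; exact hx
        simp [h1, hx]
      · have h1 : f x ≠ 1 := fun h => hx (by rw [hf1]; exact h)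
        rw [Set.indicator_of_notMem hx]
        exact (tendsto_pow_atTop_nhds_zero_of_lt_one (hf x).1
          (lt_of_le_of_ne (hf x).2 h1)).comp (tendsto_add_atTop_nat 1)
  have hm : Measurable fun ν : RadonMeasure X => ν.toMeasure.real K :=
    measurable_of_tendsto_metrizable (fun n => (continuous_integral (F n)).measurable)
      (tendsto_pi_nhds.2 hlim)
  have he : (fun ν : RadonMeasure X => ν.toMeasure K) =
      fun ν => ENNReal.ofReal (ν.toMeasure.real K) := by
    ext ν
    rw [ofReal_measureReal hK.measure_lt_top.ne]
  rw [he]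
  exact hm.ennreal_ofReal

theorem borel_eq_generateFrom_isCompact :
    ‹MeasurableSpace X› = MeasurableSpace.generateFrom {K : Set X | IsCompact K} := by
  refine le_antisymm ?_ (MeasurableSpace.generateFrom_le fun K hK => IsCompact.measurableSet hK)
  rw [BorelSpace.measurable_eq (α := X), borel_eq_generateFrom_isClosed]
  refine MeasurableSpace.generateFrom_le fun F hF => ?_
  have h : F = ⋃ n, F ∩ compactCovering X n := by
    rw [← Set.inter_iUnion, iUnion_compactCovering, Set.inter_univ]
  rw [h]
  exact MeasurableSet.iUnion fun n => MeasurableSpace.measurableSet_generateFrom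
    ((isCompact_compactCovering X n).inter_left hF)

/-- The inclusion of the Radon measures into all measures is measurable. -/
theorem measurable_toMeasure : Measurable (toMeasure : RadonMeasure X → Measure X) := by
  -- Restriction to a compact set gives finite measures, for which the π-system of compact sets
  -- decides measurability. The restriction is removed by a supremum over a compact covering.
  have h : ∀ n, Measurable fun ν : RadonMeasure X =>
      ν.toMeasure.restrict (compactCovering X n) := by
    intro n
    have : ∀ ν : RadonMeasure X, IsFiniteMeasure (ν.toMeasure.restrict (compactCovering X n)) :=
      fun ν => ⟨by simpa using (isCompact_compactCovering X n).measure_lt_top⟩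
    refine Measurable.measure_of_isPiSystem borel_eq_generateFrom_isCompact
      (fun K hK K' hK' _ => IsCompact.inter hK hK') (fun K hK => ?_) ?_
    · simp only [Measure.restrict_apply (IsCompact.measurableSet hK)]
      exact measurable_apply_of_isCompact (IsCompact.inter hK (isCompact_compactCovering X n))
    · simpa using measurable_apply_of_isCompact (isCompact_compactCovering X n)
  refine Measure.measurable_of_measurable_coe _ fun A hA => ?_
  have e : (fun ν : RadonMeasure X => ν.toMeasure A) =
      fun ν => ⨆ n, ν.toMeasure.restrict (compactCovering X n) A := by
    ext ν
    simp only [Measure.restrict_apply hA]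
    rw [← Monotone.measure_iUnion, ← Set.inter_iUnion, iUnion_compactCovering, Set.inter_univ]
    exact fun m n hmn => Set.inter_subset_inter_right _ (compactCovering_subset X hmn)
  rw [e]
  exact Measurable.iSup fun n => (Measure.measurable_coe hA).comp (h n)

open Classical in
/-- A measure as a Radon measure; the value is `0` if it is not locally finite. -/
def ofMeasure (ν : Measure X) : RadonMeasure X :=
  if h : IsLocallyFiniteMeasure ν then ⟨ν, h⟩ else ⟨0, inferInstance⟩

omit [BorelSpace X] [T2Space X] [SecondCountableTopology X] in
theorem toMeasure_ofMeasure (ν : Measure X) [h : IsLocallyFiniteMeasure ν] :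
    (ofMeasure ν).toMeasure = ν := by
  rw [ofMeasure, dif_pos h]

/-- Makes local finiteness a countable condition, hence a measurable one. -/
theorem isLocallyFiniteMeasure_iff (K : CompactExhaustion X) (ν : Measure X) :
    IsLocallyFiniteMeasure ν ↔ ∀ n, ν (K n) < ∞ := by
  refine ⟨fun h n => (K.isCompact n).measure_lt_top, fun h => ⟨fun x => ?_⟩⟩
  obtain ⟨n, hn⟩ := K.exists_mem x
  exact ⟨K (n + 1), mem_interior_iff_mem_nhds.1 (K.subset_interior_succ n hn), h (n + 1)⟩

omit [T2Space X] [LocallyCompactSpace X] [SecondCountableTopology X] in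
theorem integral_coe_eq_toReal_lintegral (f : C_c(X, ℝ≥0)) (ν : Measure X) :
    ∫ x, (f x : ℝ) ∂ν = (∫⁻ x, (f x : ℝ≥0∞) ∂ν).toReal := by
  refine (integral_eq_lintegral_of_nonneg_ae (ae_of_all _ fun x => NNReal.coe_nonneg _)
    (NNReal.continuous_coe.comp f.continuous).aestronglyMeasurable).trans ?_
  simp

theorem measurable_ofMeasure : Measurable (ofMeasure : Measure X → RadonMeasure X) := by
  have hs : MeasurableSet {ν : Measure X | IsLocallyFiniteMeasure ν} := by
    let K : CompactExhaustion X := default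
    simp only [isLocallyFiniteMeasure_iff K, Set.ofPred_forall]
    exact MeasurableSet.iInter fun n => measurableSet_lt (Measure.measurable_coe
      (K.isCompact n).measurableSet) measurable_const
  refine measurable_of_integral fun f => ?_
  have e : ∀ ν : Measure X, ∫ x, (f x : ℝ) ∂(ofMeasure ν).toMeasure =
      ({ν : Measure X | IsLocallyFiniteMeasure ν}.indicator
        (fun ν => ∫⁻ x, (f x : ℝ≥0∞) ∂ν) ν).toReal := by
    intro ν
    by_cases h : IsLocallyFiniteMeasure ν
    · rw [toMeasure_ofMeasure, Set.indicator_of_mem (by exact h), integral_coe_eq_toReal_lintegral]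
    · rw [Set.indicator_of_notMem (by exact h), ofMeasure, dif_neg h]
      simp
  simp only [e]
  refine ((Measure.measurable_lintegral ?_).indicator hs).ennreal_toReal
  fun_prop

end RadonMeasure

/-! ### The exponential of minus an extended non-negative number -/

/-- `exp (-x)` for `x ∈ [0, ∞]`. -/
def expNeg (x : ℝ≥0∞) : ℝ≥0∞ := EReal.exp (-(x : EReal))

theorem expNeg_zero : expNeg 0 = 1 := by simp [expNeg]

theorem expNeg_top : expNeg ∞ = 0 := by simp [expNeg]

theorem expNeg_add (x y : ℝ≥0∞) : expNeg (x + y) = expNeg x * expNeg y := by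
  rw [expNeg, expNeg, expNeg, ← EReal.exp_add, EReal.coe_ennreal_add, EReal.neg_add]
  · rfl
  · simp
  · simp

theorem expNeg_le_one (x : ℝ≥0∞) : expNeg x ≤ 1 := by
  simp [expNeg, EReal.coe_ennreal_nonneg]

theorem expNeg_ne_top (x : ℝ≥0∞) : expNeg x ≠ ∞ :=
  ne_top_of_le_ne_top ENNReal.one_ne_top (expNeg_le_one x)

theorem continuous_expNeg : Continuous expNeg :=
  ENNReal.continuous_exp.comp (continuous_neg.comp continuous_coe_ennreal_ereal)

theorem measurable_expNeg : Measurable expNeg := continuous_expNeg.measurable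

theorem expNeg_ofReal {r : ℝ} (hr : 0 ≤ r) :
    expNeg (ENNReal.ofReal r) = ENNReal.ofReal (Real.exp (-r)) := by
  rw [expNeg, EReal.coe_ennreal_ofReal, max_eq_left hr, ← EReal.coe_neg, EReal.exp_coe]

theorem expNeg_finsetSum {ι : Type*} (s : Finset ι) (x : ι → ℝ≥0∞) :
    expNeg (∑ i ∈ s, x i) = ∏ i ∈ s, expNeg (x i) := by
  classical
  induction s using Finset.induction_on with
  | empty => simp [expNeg_zero]
  | insert a s ha ih => rw [Finset.sum_insert ha, Finset.prod_insert ha, expNeg_add, ih]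

theorem expNeg_multisetSum {ι : Type*} (s : Multiset ι) (x : ι → ℝ≥0∞) :
    expNeg (s.map x).sum = (s.map fun i => expNeg (x i)).prod := by
  induction s using Multiset.induction_on with
  | empty => simp [expNeg_zero]
  | cons a s ih => simp [expNeg_add, ih]

theorem tendsto_prod_expNeg (x : ℕ → ℝ≥0∞) :
    Tendsto (fun n => ∏ i ∈ Finset.range n, expNeg (x i)) atTop (𝓝 (expNeg (∑' i, x i))) := by
  simp only [← expNeg_finsetSum]
  exact (continuous_expNeg.tendsto _).comp (ENNReal.tendsto_nat_tsum x)

/-- `expNeg` with values in the unit interval. -/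
def expNegUnit (x : ℝ≥0∞) : unitInterval :=
  ⟨(expNeg x).toReal, ENNReal.toReal_nonneg,
    ENNReal.toReal_le_of_le_ofReal zero_le_one (by simpa using expNeg_le_one x)⟩

theorem measurable_expNegUnit : Measurable expNegUnit :=
  measurable_expNeg.ennreal_toReal.subtype_mk

/-- A law on powers of `[0, ∞]` can be transported to a cube and back: `-log`, with value `∞` at
`0`, undoes `expNegUnit`. -/
theorem exists_leftInverse_expNegUnit :
    ∃ l : unitInterval → ℝ≥0∞, Measurable l ∧ Function.LeftInverse l expNegUnit := by
  refine ⟨fun r => (-(ENNReal.log (ENNReal.ofReal r))).toENNReal, ?_, fun x => ?_⟩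
  · exact (measurable_neg.comp (ENNReal.measurable_log.comp
      measurable_subtype_coe.ennreal_ofReal)).ereal_toENNReal
  · simp only [expNegUnit]
    rw [ENNReal.ofReal_toReal (expNeg_ne_top x), expNeg]
    simp

/-- A probability measure on a countable power of `[0, ∞]` is determined by its Laplace
transform. -/
theorem ext_of_lintegral_expNeg {ι : Type*} [Countable ι] {μ μ' : Measure (ι → ℝ≥0∞)}
    [IsProbabilityMeasure μ] [IsProbabilityMeasure μ']
    (h : ∀ s : Multiset ι, ∫⁻ x, expNeg (s.map x).sum ∂μ = ∫⁻ x, expNeg (s.map x).sum ∂μ') :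
    μ = μ' := by
  obtain ⟨l, hl, hlT⟩ := exists_leftInverse_expNegUnit
  let T : (ι → ℝ≥0∞) → ι → unitInterval := fun x i => expNegUnit (x i)
  have hT : Measurable T :=
    measurable_pi_lambda _ fun i => measurable_expNegUnit.comp (measurable_pi_apply i)
  have hmul : ∀ s : Multiset ι, Measurable fun x : ι → ℝ≥0∞ => expNeg (s.map x).sum := by
    intro s
    refine measurable_expNeg.comp ?_
    induction s using Multiset.induction_on with
    | empty => simp
    | cons a s ih =>
      simp only [Multiset.map_cons, Multiset.sum_cons]
      exact (measurable_pi_apply a).add ih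
  have e : ∀ m : Measure (ι → ℝ≥0∞), ∀ s : Multiset ι,
      ∫ x, (s.map fun i => (x i : ℝ)).prod ∂(m.map T) =
        (∫⁻ x, expNeg (s.map x).sum ∂m).toReal := by
    intro m s
    rw [integral_map hT.aemeasurable, ← integral_toReal (hmul s).aemeasurable
      (ae_of_all _ fun x => (expNeg_ne_top _).lt_top)]
    · congr with x
      rw [expNeg_multisetSum]
      simp only [T, expNegUnit]
      induction s using Multiset.induction_on with
      | empty => simp
      | cons a s ih => simp [ih]
    · refine Measurable.aestronglyMeasurable ?_
      induction s using Multiset.induction_on with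
      | empty => simp
      | cons a s ih =>
        simp only [Multiset.map_cons, Multiset.prod_cons]
        exact (measurable_subtype_coe.comp (measurable_pi_apply a)).mul ih
  have := Measure.isProbabilityMeasure_map (μ := μ) hT.aemeasurable
  have := Measure.isProbabilityMeasure_map (μ := μ') hT.aemeasurable
  have h1 : μ.map T = μ'.map T := ext_of_integral_monomial fun s => by rw [e, e, h]
  have hL : Measurable fun (x : ι → unitInterval) i => l (x i) :=
    measurable_pi_lambda _ fun i => hl.comp (measurable_pi_apply i)
  have h2 := congrArg (Measure.map fun (x : ι → unitInterval) i => l (x i)) h1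
  rw [Measure.map_map hL hT, Measure.map_map hL hT] at h2
  have h3 : (fun (x : ι → unitInterval) i => l (x i)) ∘ T = id := by
    ext x i
    exact hlT (x i)
  simpa [h3] using h2

end YuleBins

end

noncomputable section

namespace YuleBins

/-! ### Existence of Poisson processes -/

/-- The generating function of the Poisson law, by the exponential series. -/
theorem lintegral_pow_poissonMeasure (r : ℝ≥0) {a : ℝ≥0∞} (ha : a ≤ 1) :
    ∫⁻ n, a ^ n ∂(poissonMeasure r) = expNeg (r * (1 - a)) := by
  lift a to ℝ≥0 using ne_top_of_le_ne_top ENNReal.one_ne_top ha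
  have ha' : (a : ℝ) ≤ 1 := by exact_mod_cast ha
  have e1 : ∀ n : ℕ, (a : ℝ≥0∞) ^ n * poissonMeasure r {n} =
      ENNReal.ofReal (Real.exp (-r) * ((r * a : ℝ) ^ n / n.factorial)) := by
    intro n
    rw [poissonMeasure_singleton, ← ENNReal.ofReal_coe_nnreal, ← ENNReal.ofReal_pow a.coe_nonneg,
      ← ENNReal.ofReal_mul (by positivity)]
    congr 1
    ring
  have h : HasSum (fun n : ℕ => Real.exp (-r) * ((r * a : ℝ) ^ n / n.factorial))
      (Real.exp (-r) * Real.exp (r * a)) := by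
    have := NormedSpace.expSeries_div_hasSum_exp ((r : ℝ) * a)
    rw [← Real.exp_eq_exp_ℝ] at this
    exact this.mul_left _
  rw [lintegral_countable']
  simp only [e1]
  rw [← ENNReal.ofReal_tsum_of_nonneg (fun n => by positivity) h.summable, h.tsum_eq,
    ← Real.exp_add]
  have e2 : (r : ℝ≥0∞) * (1 - a) = ENNReal.ofReal (r * (1 - a)) := by
    rw [ENNReal.ofReal_mul r.coe_nonneg, ENNReal.ofReal_sub _ a.coe_nonneg]
    simp
  rw [e2, expNeg_ofReal (mul_nonneg r.coe_nonneg (by linarith))]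
  ring_nf

theorem measurable_expNeg_lintegral {X : Type*} [MeasurableSpace X] {g : X → ℝ≥0∞}
    (hg : Measurable g) : Measurable fun ν : Measure X => expNeg (∫⁻ x, g x ∂ν) :=
  measurable_expNeg.comp (Measure.measurable_lintegral hg)

/-- A Poisson number, of parameter the total mass, of independent points with the normalized law
`P`. Given that there are `n` points the functional is `a ^ n` with `a = ∫ exp (-g) dP`, and the
Poisson generating function concludes. The zero measure cannot be normalized and is treated apart.
-/
theorem exists_poissonLaplace_of_isFiniteMeasure {X : Type*} [MeasurableSpace X] (m : Measure X)
    [IsFiniteMeasure m] : ∃ Q : Measure (Measure X), IsProbabilityMeasure Q ∧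
      ∀ g : X → ℝ≥0∞, Measurable g →
        ∫⁻ ν, expNeg (∫⁻ x, g x ∂ν) ∂Q = expNeg (∫⁻ x, (1 - expNeg (g x)) ∂m) := by
  rcases eq_zero_or_neZero m with rfl | hm
  · refine ⟨Measure.dirac 0, inferInstance, fun g hg => ?_⟩
    rw [lintegral_dirac' _ (measurable_expNeg_lintegral hg)]
    simp
  set P : Measure X := (m Set.univ)⁻¹ • m with hP
  have : IsProbabilityMeasure P := inferInstance
  set r : ℝ≥0 := (m Set.univ).toNNReal with hr
  have hr' : (r : ℝ≥0∞) = m Set.univ := ENNReal.coe_toNNReal (measure_ne_top m _)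
  let N : ℕ × (ℕ → X) → Measure X := fun p => ∑ l ∈ Finset.range p.1, Measure.dirac (p.2 l)
  have hN : Measurable N := measurable_from_prod_countable_right fun n =>
    Finset.measurable_fun_sum (Finset.range n) fun l _ => Measure.measurable_dirac.comp (measurable_pi_apply l)
  refine ⟨((poissonMeasure r).prod (Measure.infinitePi fun _ => P)).map N,
    Measure.isProbabilityMeasure_map hN.aemeasurable, fun g hg => ?_⟩
  have hF := measurable_expNeg_lintegral hg
  have hFN : Measurable fun p => expNeg (∫⁻ x, g x ∂(N p)) := hF.comp hN
  rw [lintegral_map hF hN, lintegral_prod _ hFN.aemeasurable]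
  have e1 : ∀ (n : ℕ) (x : ℕ → X), expNeg (∫⁻ y, g y ∂(N (n, x))) =
      ∏ l ∈ Finset.range n, expNeg (g (x l)) := by
    intro n x
    simp only [N]
    rw [lintegral_finsetSum_measure, expNeg_finsetSum]
    simp only [lintegral_dirac' _ hg]
  set a : ℝ≥0∞ := ∫⁻ x, expNeg (g x) ∂P with ha
  have e2 : ∀ n : ℕ, ∫⁻ x, expNeg (∫⁻ y, g y ∂(N (n, x))) ∂(Measure.infinitePi fun _ => P) =
      a ^ n := by
    intro n
    simp only [e1]
    rw [lintegral_prod_eq_prod_lintegral_of_indepFun (Finset.range n)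
      (fun l (x : ℕ → X) => expNeg (g (x l)))
      (iIndepFun_infinitePi (P := fun _ => P) fun _ => measurable_expNeg.comp hg)
      fun l => (measurable_expNeg.comp hg).comp (measurable_pi_apply l)]
    have e3 : ∀ l : ℕ, ∫⁻ x, expNeg (g (x l)) ∂(Measure.infinitePi fun _ : ℕ => P) = a := by
      intro l
      exact (measurePreserving_eval_infinitePi (fun _ : ℕ => P) l).lintegral_comp
        (f := fun y => expNeg (g y)) (measurable_expNeg.comp hg)
    simp [e3]
  simp only [e2]
  have ha1 : a ≤ 1 := by
    calc a ≤ ∫⁻ _, 1 ∂P := lintegral_mono fun x => expNeg_le_one _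
      _ = 1 := by simp
  rw [lintegral_pow_poissonMeasure r ha1, hr']
  congr 1
  have hfin : ∫⁻ x, expNeg (g x) ∂m ≠ ∞ := by
    refine ne_top_of_le_ne_top (measure_ne_top m Set.univ) ?_
    calc ∫⁻ x, expNeg (g x) ∂m ≤ ∫⁻ _, 1 ∂m := lintegral_mono fun x => expNeg_le_one _
      _ = m Set.univ := by simp
  have hgm : Measurable fun x => expNeg (g x) := measurable_expNeg.comp hg
  rw [lintegral_sub hgm hfin (ae_of_all _ fun x => expNeg_le_one _),
    lintegral_one, ENNReal.mul_sub fun _ _ => measure_ne_top m _, mul_one, ha, hP,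
    lintegral_smul_measure, smul_eq_mul, ← mul_assoc,
    ENNReal.mul_inv_cancel (NeZero.ne _) (measure_ne_top m _), one_mul]

/-- Existence of Poisson processes with an s-finite intensity, as random measures. -/
theorem exists_poissonLaplace {X : Type*} [MeasurableSpace X] (Λ : Measure X) [SFinite Λ] :
    ∃ Q : Measure (Measure X), IsProbabilityMeasure Q ∧
      ∀ g : X → ℝ≥0∞, Measurable g →
        ∫⁻ ν, expNeg (∫⁻ x, g x ∂ν) ∂Q = expNeg (∫⁻ x, (1 - expNeg (g x)) ∂Λ) := by
  choose Q hQ1 hQ2 using fun j => exists_poissonLaplace_of_isFiniteMeasure (sfiniteSeq Λ j)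
  have hS : Measurable (Measure.sum : (ℕ → Measure X) → Measure X) := by
    refine Measure.measurable_of_measurable_coe _ fun A hA => ?_
    simp only [Measure.sum_apply _ hA]
    exact Measurable.tsum fun j => (Measure.measurable_coe hA).comp (measurable_pi_apply j)
  -- Superposition: independent Poisson processes for the finite pieces of `Λ` are added, and the
  -- Laplace functional of the sum is the limit of finite products.
  refine ⟨(Measure.infinitePi Q).map Measure.sum,
    Measure.isProbabilityMeasure_map hS.aemeasurable, fun g hg => ?_⟩
  have hF := measurable_expNeg_lintegral hg
  rw [lintegral_map hF hS]
  simp only [lintegral_sum_measure]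
  have hFj : ∀ j, Measurable fun ν : ℕ → Measure X => expNeg (∫⁻ x, g x ∂(ν j)) := fun j =>
    hF.comp (measurable_pi_apply j)
  have h1 : Tendsto (fun n => ∫⁻ ν, ∏ j ∈ Finset.range n, expNeg (∫⁻ x, g x ∂(ν j))
      ∂(Measure.infinitePi Q)) atTop
      (𝓝 (∫⁻ ν, expNeg (∑' j, ∫⁻ x, g x ∂(ν j)) ∂(Measure.infinitePi Q))) := by
    refine tendsto_lintegral_of_dominated_convergence (fun _ => 1)
      (fun n => Finset.measurable_fun_prod _ fun j _ => hFj j)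
      (fun n => ae_of_all _ fun ν => Finset.prod_le_one' fun j _ => expNeg_le_one _)
      (by simp) (ae_of_all _ fun ν => tendsto_prod_expNeg _)
  have h2 : ∀ n, ∫⁻ ν, ∏ j ∈ Finset.range n, expNeg (∫⁻ x, g x ∂(ν j)) ∂(Measure.infinitePi Q) =
      ∏ j ∈ Finset.range n, expNeg (∫⁻ x, (1 - expNeg (g x)) ∂(sfiniteSeq Λ j)) := by
    intro n
    rw [lintegral_prod_eq_prod_lintegral_of_indepFun (Finset.range n)
      (fun j (ν : ℕ → Measure X) => expNeg (∫⁻ x, g x ∂(ν j)))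
      (iIndepFun_infinitePi (P := Q) (X := fun _ ν => expNeg (∫⁻ x, g x ∂ν)) fun _ => hF) hFj]
    refine Finset.prod_congr rfl fun j _ => ?_
    rw [← hQ2 j g hg, ← Measure.infinitePi_map_eval Q j, lintegral_map hF (measurable_pi_apply j)]
  simp only [h2] at h1
  rw [tendsto_nhds_unique h1 (tendsto_prod_expNeg _), ← lintegral_sum_measure, sum_sfiniteSeq]

namespace RadonMeasure

variable {X : Type*} [TopologicalSpace X] [MeasurableSpace X] [BorelSpace X]
  [T2Space X] [LocallyCompactSpace X] [SecondCountableTopology X]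

/-- For compact `K`, `E exp (-c ν(K)) = exp (-(1 - exp (-c)) Λ(K))`. As `c → 0` the left side tends
to the probability of `ν(K) < ∞` and the right side to `1`. -/
theorem ae_isLocallyFiniteMeasure_of_poissonLaplace {Λ : Measure X} [IsLocallyFiniteMeasure Λ]
    {Q : Measure (Measure X)} [IsProbabilityMeasure Q]
    (hQ : ∀ g : X → ℝ≥0∞, Measurable g →
      ∫⁻ ν, expNeg (∫⁻ x, g x ∂ν) ∂Q = expNeg (∫⁻ x, (1 - expNeg (g x)) ∂Λ)) :
    ∀ᵐ ν ∂Q, IsLocallyFiniteMeasure ν := by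
  let K : CompactExhaustion X := default
  simp only [isLocallyFiniteMeasure_iff K, ae_all_iff]
  intro n
  have hK := (K.isCompact n).measurableSet
  have hs : MeasurableSet {ν : Measure X | ν (K n) < ∞} :=
    measurableSet_lt (Measure.measurable_coe hK) measurable_const
  have hc : Tendsto (fun k : ℕ => ((k : ℝ≥0∞))⁻¹) atTop (𝓝 0) := ENNReal.tendsto_inv_nat_nhds_zero
  have e1 : ∀ c : ℝ≥0∞, ∫⁻ ν, expNeg (c * ν (K n)) ∂Q = expNeg ((1 - expNeg c) * Λ (K n)) := by
    intro c
    have h := hQ ((K n).indicator fun _ => c) (measurable_const.indicator hK)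
    simp only [lintegral_indicator_const hK] at h
    rw [h, ← lintegral_indicator_const hK]
    congr with x
    by_cases hx : x ∈ K n <;> simp [hx, expNeg_zero]
  have h1 : Tendsto (fun k : ℕ => ∫⁻ ν, expNeg (((k : ℝ≥0∞))⁻¹ * ν (K n)) ∂Q) atTop
      (𝓝 (∫⁻ ν, {ν : Measure X | ν (K n) < ∞}.indicator 1 ν ∂Q)) := by
    refine tendsto_lintegral_of_dominated_convergence (fun _ => 1)
      (fun k => measurable_expNeg.comp ((Measure.measurable_coe hK).const_mul _))
      (fun k => ae_of_all _ fun ν => expNeg_le_one _) (by simp) (ae_of_all _ fun ν => ?_)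
    by_cases hν : ν (K n) < ∞
    · rw [Set.indicator_of_mem (by exact hν), Pi.one_apply, ← expNeg_zero]
      refine (continuous_expNeg.tendsto _).comp ?_
      simpa using ENNReal.Tendsto.mul_const hc (Or.inr hν.ne)
    · rw [Set.indicator_of_notMem (by exact hν), not_lt_top_iff.1 hν]
      refine tendsto_const_nhds.congr fun k => ?_
      rw [ENNReal.mul_top (by simp), expNeg_top]
  have h2 : Tendsto (fun k : ℕ => expNeg ((1 - expNeg ((k : ℝ≥0∞))⁻¹) * Λ (K n))) atTop (𝓝 1) := by
    nth_rw 2 [← expNeg_zero]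
    refine (continuous_expNeg.tendsto _).comp ?_
    have h3 : Tendsto (fun k : ℕ => 1 - expNeg ((k : ℝ≥0∞))⁻¹) atTop (𝓝 (1 - 1)) := by
      refine ENNReal.Tendsto.sub tendsto_const_nhds ?_ (Or.inl ENNReal.one_ne_top)
      rw [← expNeg_zero]
      exact (continuous_expNeg.tendsto _).comp hc
    simpa using ENNReal.Tendsto.mul_const h3 (Or.inr ((K.isCompact n).measure_lt_top (μ := Λ)).ne)
  simp only [e1] at h1
  have h4 := tendsto_nhds_unique h1 h2
  rw [lintegral_indicator_one hs] at h4
  exact (prob_compl_eq_zero_iff hs).2 h4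

theorem exists_poissonLaplace (Λ : Measure X) [SFinite Λ] [IsLocallyFiniteMeasure Λ] :
    ∃ Q : Measure (RadonMeasure X), IsProbabilityMeasure Q ∧
      ∀ g : X → ℝ≥0∞, Measurable g →
        ∫⁻ ν, expNeg (∫⁻ x, g x ∂ν.toMeasure) ∂Q = expNeg (∫⁻ x, (1 - expNeg (g x)) ∂Λ) := by
  obtain ⟨Q, hQ1, hQ2⟩ := YuleBins.exists_poissonLaplace Λ
  refine ⟨Q.map ofMeasure, Measure.isProbabilityMeasure_map measurable_ofMeasure.aemeasurable,
    fun g hg => ?_⟩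
  have hF : Measurable fun ν : RadonMeasure X => expNeg (∫⁻ x, g x ∂ν.toMeasure) :=
    (measurable_expNeg_lintegral hg).comp measurable_toMeasure
  rw [lintegral_map hF measurable_ofMeasure, ← hQ2 g hg]
  refine lintegral_congr_ae ?_
  filter_upwards [ae_isLocallyFiniteMeasure_of_poissonLaplace hQ2] with ν hν
  rw [toMeasure_ofMeasure]

end RadonMeasure

end YuleBins

end

/-! ### Laplace functionals characterize Poisson laws; the Poisson kernel -/

noncomputable section

namespace YuleBins

/-- The case of a one-point index set, where a multiset is just its cardinality. -/
theorem ext_of_lintegral_expNeg_natCast_mul {μ μ' : Measure ℝ≥0∞} [IsProbabilityMeasure μ]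
    [IsProbabilityMeasure μ']
    (h : ∀ n : ℕ, ∫⁻ x, expNeg (n * x) ∂μ = ∫⁻ x, expNeg (n * x) ∂μ') : μ = μ' := by
  have hT : Measurable fun (x : ℝ≥0∞) (_ : Unit) => x := measurable_pi_lambda _ fun _ => measurable_id
  have hU : Measurable fun x : Unit → ℝ≥0∞ => x () := measurable_pi_apply ()
  have := Measure.isProbabilityMeasure_map (μ := μ) hT.aemeasurable
  have := Measure.isProbabilityMeasure_map (μ := μ') hT.aemeasurable
  have h1 : μ.map (fun x (_ : Unit) => x) = μ'.map fun x (_ : Unit) => x := by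
    refine ext_of_lintegral_expNeg fun s => ?_
    have e : ∀ x : Unit → ℝ≥0∞, (s.map x).sum = Multiset.card s * x () := by
      intro x
      have : s.map x = s.map fun _ => x () := rfl
      rw [this, Multiset.map_const', Multiset.sum_replicate, nsmul_eq_mul]
    simp only [e]
    have hm : Measurable fun x : Unit → ℝ≥0∞ => expNeg (Multiset.card s * x ()) :=
      measurable_expNeg.comp (hU.const_mul _)
    rw [lintegral_map hm hT, lintegral_map hm hT, h]
  have h2 := congrArg (Measure.map fun x : Unit → ℝ≥0∞ => x ()) h1
  rw [Measure.map_map hU hT, Measure.map_map hU hT] at h2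
  simpa [Function.comp_def] using h2

theorem one_sub_expNeg_indicator {X : Type*} (A : Set X) (c : ℝ≥0∞) (x : X) :
    1 - expNeg (A.indicator (fun _ => c) x) = A.indicator (fun _ => 1 - expNeg c) x := by
  by_cases hx : x ∈ A <;> simp [hx, expNeg_zero]

/-- At most one indicator is nonzero at `x`, so the nonlinear map passes through the sum. This turns
disjointness into independence of the counts. -/
theorem one_sub_expNeg_sum_indicator {X ι : Type*} [Fintype ι] {A : ι → Set X}
    (hA : Pairwise fun i j => Disjoint (A i) (A j)) (c : ι → ℝ≥0∞) (x : X) :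
    1 - expNeg (∑ j, (A j).indicator (fun _ => c j) x) =
      ∑ j, (A j).indicator (fun _ => 1 - expNeg (c j)) x := by
  by_cases hx : ∃ i, x ∈ A i
  · obtain ⟨i, hi⟩ := hx
    have hn : ∀ j, j ≠ i → x ∉ A j := fun j hj hxj => (hA hj).le_bot ⟨hxj, hi⟩
    rw [Finset.sum_eq_single i (fun j _ hj => by simp [hn j hj]) (by simp),
      Finset.sum_eq_single i (fun j _ hj => by simp [hn j hj]) (by simp), one_sub_expNeg_indicator]
  · push Not at hx
    simp [hx, expNeg_zero]

namespace RadonMeasure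

variable {X : Type*} [TopologicalSpace X] [MeasurableSpace X] [BorelSpace X]
  [T2Space X] [LocallyCompactSpace X] [SecondCountableTopology X]

theorem measurable_apply {A : Set X} (hA : MeasurableSet A) :
    Measurable fun ν : RadonMeasure X => ν.toMeasure A :=
  (Measure.measurable_coe hA).comp measurable_toMeasure

/-- The Laplace functional characterises Poisson processes. -/
theorem isPoissonLaw_of_laplace {Λ : Measure X} {Q : Measure (RadonMeasure X)}
    [IsProbabilityMeasure Q]
    (hQ : ∀ g : X → ℝ≥0∞, Measurable g →
      ∫⁻ ν, expNeg (∫⁻ x, g x ∂ν.toMeasure) ∂Q = expNeg (∫⁻ x, (1 - expNeg (g x)) ∂Λ)) :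
    IsPoissonLaw Λ Q := by
  have hone : ∀ A : Set X, MeasurableSet A → ∀ c : ℝ≥0∞,
      ∫⁻ ν, expNeg (c * ν.toMeasure A) ∂Q = expNeg ((1 - expNeg c) * Λ A) := by
    intro A hA c
    have h := hQ (A.indicator fun _ => c) (measurable_const.indicator hA)
    simp only [one_sub_expNeg_indicator, lintegral_indicator_const hA] at h
    exact h
  have hmul : ∀ c : ℝ≥0∞, Measurable fun x : ℝ≥0∞ => expNeg (c * x) := fun c =>
    measurable_expNeg.comp (measurable_id.const_mul c)
  refine ⟨fun A hA hΛ => ⟨(measurable_apply hA).aemeasurable, ?_⟩, fun k A hA hdisj => ?_⟩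
  · have := Measure.isProbabilityMeasure_map (μ := Q) (measurable_apply hA).aemeasurable
    have hcast : Measurable fun k : ℕ => (k : ℝ≥0∞) := measurable_from_top
    have := Measure.isProbabilityMeasure_map (μ := poissonMeasure (Λ A).toNNReal)
      hcast.aemeasurable
    refine ext_of_lintegral_expNeg_natCast_mul fun n => ?_
    rw [lintegral_map (hmul n) (measurable_apply hA), lintegral_map (hmul n) hcast, hone A hA]
    have e : ∀ k : ℕ, expNeg (n * k) = expNeg n ^ k := by
      intro k
      induction k with
      | zero => simp [expNeg_zero]
      | succ k ih => rw [Nat.cast_succ, mul_add, mul_one, expNeg_add, ih, pow_succ]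
    simp only [e]
    rw [lintegral_pow_poissonMeasure _ (expNeg_le_one _), ENNReal.coe_toNNReal hΛ, mul_comm]
  · have hAm : ∀ j, Measurable fun ν : RadonMeasure X => ν.toMeasure (A j) := fun j =>
      measurable_apply (hA j)
    -- Independence says that the joint law is the product law. Both have the Laplace transform `∏
    -- exp (-(1 - exp (-n_j)) Λ(A_j))`, where `n_j` is the multiplicity of `j` in the multiset.
    rw [iIndepFun_iff_map_fun_eq_pi_map fun j => (hAm j).aemeasurable]
    have hvec : Measurable fun (ν : RadonMeasure X) (j : Fin k) => ν.toMeasure (A j) :=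
      measurable_pi_lambda _ hAm
    have := Measure.isProbabilityMeasure_map (μ := Q) hvec.aemeasurable
    have hp : ∀ j, IsProbabilityMeasure (Q.map fun ν : RadonMeasure X => ν.toMeasure (A j)) :=
      fun j => Measure.isProbabilityMeasure_map (hAm j).aemeasurable
    refine ext_of_lintegral_expNeg fun s => ?_
    have e1 : ∀ x : Fin k → ℝ≥0∞, (s.map x).sum = ∑ j, s.count j * x j := by
      intro x
      rw [Finset.sum_multiset_map_count]
      simp only [nsmul_eq_mul]
      refine Finset.sum_subset (Finset.subset_univ _) fun j _ hj => ?_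
      rw [Multiset.mem_toFinset, ← Multiset.count_eq_zero] at hj
      simp [hj]
    simp only [e1]
    have hm : Measurable fun x : Fin k → ℝ≥0∞ => expNeg (∑ j, s.count j * x j) :=
      measurable_expNeg.comp
        (Finset.measurable_fun_sum _ fun j _ => (measurable_pi_apply j).const_mul _)
    rw [lintegral_map hm hvec]
    have e2 : ∫⁻ ν, expNeg (∑ j, s.count j * ν.toMeasure (A j)) ∂Q =
        ∏ j, expNeg ((1 - expNeg (s.count j)) * Λ (A j)) := by
      have h := hQ (fun x => ∑ j, (A j).indicator (fun _ => (s.count j : ℝ≥0∞)) x)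
        (Finset.measurable_fun_sum _ fun j _ => measurable_const.indicator (hA j))
      simp only [one_sub_expNeg_sum_indicator hdisj] at h
      rw [lintegral_finsetSum _ fun j _ => measurable_const.indicator (hA j),
        expNeg_finsetSum] at h
      simp only [lintegral_indicator_const (hA _)] at h
      rw [← h]
      congr with ν
      rw [lintegral_finsetSum _ fun j _ => measurable_const.indicator (hA j)]
      simp only [lintegral_indicator_const (hA _)]
    rw [e2]
    simp only [expNeg_finsetSum]
    rw [lintegral_prod_eq_prod_lintegral_of_indepFun Finset.univ
      (fun j (x : Fin k → ℝ≥0∞) => expNeg (s.count j * x j))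
      (iIndepFun_pi (X := fun j x => expNeg (s.count j * x)) fun j => (hmul _).aemeasurable)
      fun j => (hmul _).comp (measurable_pi_apply j)]
    refine Finset.prod_congr rfl fun j _ => ?_
    rw [(measurePreserving_eval
      (fun j => Q.map fun ν : RadonMeasure X => ν.toMeasure (A j)) j).lintegral_comp
      (f := fun x => expNeg (s.count j * x)) (hmul _), lintegral_map (hmul _) (hAm j), hone _ (hA j)]

theorem integral_exp_neg_of_laplace {Λ : Measure X} {Q : Measure (RadonMeasure X)}
    (hQ : ∀ g : X → ℝ≥0∞, Measurable g →
      ∫⁻ ν, expNeg (∫⁻ x, g x ∂ν.toMeasure) ∂Q = expNeg (∫⁻ x, (1 - expNeg (g x)) ∂Λ))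
    (f : C_c(X, ℝ≥0)) :
    ∫ ν, Real.exp (-∫ x, (f x : ℝ) ∂ν.toMeasure) ∂Q =
      (expNeg (∫⁻ x, (1 - expNeg (f x)) ∂Λ)).toReal := by
  have hf : Measurable fun x => (f x : ℝ≥0∞) := by fun_prop
  have hm : Measurable fun ν : RadonMeasure X => expNeg (∫⁻ x, f x ∂ν.toMeasure) :=
    (measurable_expNeg_lintegral hf).comp measurable_toMeasure
  rw [← hQ _ hf, ← integral_toReal hm.aemeasurable
    (ae_of_all _ fun ν => (expNeg_ne_top _).lt_top)]
  congr with ν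
  have hfin : ∫⁻ x, (f x : ℝ≥0∞) ∂ν.toMeasure ≠ ∞ := by
    have := (ν.integrable_coe f).lintegral_lt_top
    simpa using this.ne
  rw [integral_coe_eq_toReal_lintegral, ← ENNReal.ofReal_toReal hfin,
    expNeg_ofReal ENNReal.toReal_nonneg, ENNReal.toReal_ofReal (Real.exp_pos _).le,
    ENNReal.toReal_ofReal ENNReal.toReal_nonneg]

theorem lintegral_one_sub_expNeg_ne_top (Λ : Measure X) [IsLocallyFiniteMeasure Λ]
    (f : C_c(X, ℝ≥0)) : ∫⁻ x, (1 - expNeg (f x)) ∂Λ ≠ ∞ := by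
  have h : ∫⁻ x, (1 - expNeg (f x)) ∂Λ ≤ Λ (tsupport f) := by
    rw [← lintegral_indicator_one f.hasCompactSupport.measurableSet]
    refine lintegral_mono fun x => ?_
    by_cases hx : x ∈ tsupport f
    · simp [hx]
    · simp [image_eq_zero_of_notMem_tsupport hx, expNeg_zero]
  exact (h.trans_lt f.hasCompactSupport.measure_lt_top).ne

/-- Poisson laws with intensities proportional to a fixed measure form a kernel. -/
theorem exists_kernel_poisson (Λ : Measure X) [SFinite Λ] [IsLocallyFiniteMeasure Λ] :
    ∃ κ : Kernel ℝ≥0 (RadonMeasure X), IsMarkovKernel κ ∧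
      (∀ c, IsPoissonLaw (c • Λ) (κ c)) ∧
      ∀ c (f : C_c(X, ℝ≥0)), ∫ ν, Real.exp (-∫ x, (f x : ℝ) ∂ν.toMeasure) ∂(κ c) =
        Real.exp (-(c * (∫⁻ x, (1 - expNeg (f x)) ∂Λ).toReal)) := by
  choose Q hQ1 hQ2 using fun c : ℝ≥0 => exists_poissonLaplace (c • Λ)
  have hL : ∀ c (f : C_c(X, ℝ≥0)), ∫ ν, Real.exp (-∫ x, (f x : ℝ) ∂ν.toMeasure) ∂(Q c) =
      Real.exp (-(c * (∫⁻ x, (1 - expNeg (f x)) ∂Λ).toReal)) := by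
    intro c f
    rw [integral_exp_neg_of_laplace (hQ2 c) f, lintegral_smul_measure, ENNReal.smul_def, smul_eq_mul]
    have hI := lintegral_one_sub_expNeg_ne_top Λ f
    conv_lhs => rw [← ENNReal.ofReal_toReal hI, ← ENNReal.ofReal_coe_nnreal,
      ← ENNReal.ofReal_mul c.coe_nonneg, expNeg_ofReal (by positivity)]
    rw [ENNReal.toReal_ofReal (Real.exp_pos _).le]
  let Qp : ℝ≥0 → ProbabilityMeasure (RadonMeasure X) := fun c => ⟨Q c, hQ1 c⟩
  have hcont : Continuous Qp := by
    rw [continuous_iff_continuousAt]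
    intro c
    refine tendsto_of_tendsto_laplace fun f => ?_
    simp only [Qp, ProbabilityMeasure.coe_mk, hL]
    exact Continuous.tendsto (by fun_prop) c
  -- For open `U`, portmanteau makes `c ↦ Q c U` lower semicontinuous, hence measurable, and the
  -- open sets form a generating π-system. The embedding in the cube provides the pseudometric.
  have hmeas : Measurable Q := by
    obtain ⟨D, hD⟩ := exists_isInducing_laplace (X := X)
    have := hD.pseudoMetrizableSpace
    let := TopologicalSpace.pseudoMetrizableSpacePseudoMetric (RadonMeasure X)
    refine Measurable.measure_of_isPiSystem_of_isProbabilityMeasure (BorelSpace.measurable_eq)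
      isPiSystem_isOpen fun U hU => ?_
    refine LowerSemicontinuous.measurable fun c => ?_
    refine lowerSemicontinuousAt_iff_le_liminf.2 ?_
    exact ProbabilityMeasure.le_liminf_measure_open_of_tendsto (hcont.tendsto c) hU
  exact ⟨⟨Q, hmeas⟩, ⟨hQ1⟩, fun c => isPoissonLaw_of_laplace (hQ2 c), hL⟩

end RadonMeasure

end YuleBins

end

noncomputable section

namespace YuleBins

/-! ### The exponential distribution -/

theorem expMeasure_one_eq : expMeasure 1 =
    (volume.restrict (Set.Ioi 0)).withDensity fun x => ENNReal.ofReal (Real.exp (-x)) := by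
  rw [expMeasure, gammaMeasure, ← withDensity_indicator measurableSet_Ioi]
  refine withDensity_congr_ae ?_
  filter_upwards [Measure.ae_ne volume (0 : ℝ)] with x hx
  by_cases h : 0 < x
  · simp [gammaPDF_of_nonneg h.le, h]
  · rw [gammaPDF_of_neg (lt_of_le_of_ne (not_lt.1 h) hx), Set.indicator_of_notMem (by simpa using h)]

theorem ae_pos_expMeasure_one : ∀ᵐ x ∂(expMeasure 1), 0 < x := by
  rw [expMeasure_one_eq]
  exact (withDensity_absolutelyContinuous _ _).ae_le (ae_restrict_mem measurableSet_Ioi)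

theorem integral_expMeasure_one (h : ℝ → ℝ) :
    ∫ x, h x ∂(expMeasure 1) = ∫ x in Set.Ioi 0, Real.exp (-x) * h x := by
  rw [expMeasure_one_eq, integral_withDensity_eq_integral_toReal_smul (by fun_prop)
    (ae_of_all _ fun x => ENNReal.ofReal_lt_top)]
  simp [ENNReal.toReal_ofReal (Real.exp_pos _).le]

theorem integrable_expMeasure_one_iff (h : ℝ → ℝ) :
    Integrable h (expMeasure 1) ↔ IntegrableOn (fun x => Real.exp (-x) * h x) (Set.Ioi 0) := by
  rw [expMeasure_one_eq, integrable_withDensity_iff_integrable_smul' (by fun_prop)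
    (ae_of_all _ fun x => ENNReal.ofReal_lt_top)]
  simp [ENNReal.toReal_ofReal (Real.exp_pos _).le, IntegrableOn]

theorem integral_id_expMeasure_one : ∫ x, x ∂(expMeasure 1) = 1 := by
  rw [integral_expMeasure_one]
  have h := Real.Gamma_eq_integral (s := 2) (by norm_num)
  rw [Real.Gamma_two] at h
  rw [h]
  norm_num

theorem memLp_id_expMeasure_one : MemLp (id : ℝ → ℝ) 2 (expMeasure 1) := by
  rw [memLp_two_iff_integrable_sq measurable_id.aestronglyMeasurable,
    integrable_expMeasure_one_iff]
  have h := Real.GammaIntegral_convergent (s := 3) (by norm_num)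
  refine h.congr_fun (fun x _ => ?_) measurableSet_Ioi
  norm_num

/-! ### Convergence of `t_n - log n` -/

/-- A series of independent centred random variables with summable variances converges almost
surely. -/
theorem ae_exists_tendsto_sum_of_summable_variance {Ω : Type*} [MeasurableSpace Ω] {μ : Measure Ω}
    [IsProbabilityMeasure μ] {Y : ℕ → Ω → ℝ} (hY : ∀ i, Measurable (Y i))
    (hindep : iIndepFun Y μ) (hL2 : ∀ i, MemLp (Y i) 2 μ) (h0 : ∀ i, ∫ ω, Y i ω ∂μ = 0)
    (hV : Summable fun i => Var[Y i; μ]) :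
    ∀ᵐ ω ∂μ, ∃ c, Tendsto (fun n => ∑ i ∈ Finset.range n, Y i ω) atTop (𝓝 c) := by
  have hYs : ∀ i, StronglyMeasurable (Y i) := fun i => (hY i).stronglyMeasurable
  -- The sum includes the index `n`, in line with the natural filtration, which contains `Y n` at
  -- time `n`. The shift is undone at the end.
  let S : ℕ → Ω → ℝ := fun n => ∑ i ∈ Finset.range (n + 1), Y i
  let ℱ := Filtration.natural Y hYs
  have hSL2 : ∀ n, MemLp (S n) 2 μ := fun n => memLp_finsetSum' _ fun i _ => hL2 i
  have hSint : ∀ n, Integrable (S n) μ := fun n => (hSL2 n).integrable one_le_two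
  have hmart : Martingale S ℱ μ := by
    refine martingale_of_condExp_sub_eq_zero_nat (fun n => ?_) hSint fun n => ?_
    · refine Finset.stronglyMeasurable_sum _ fun i hi => ?_
      exact ((Filtration.stronglyAdapted_natural hYs) i).mono
        (ℱ.mono (Nat.lt_succ_iff.1 (Finset.mem_range.1 hi)))
    · have h1 : S (n + 1) - S n = Y (n + 1) := by
        simp only [S]
        rw [Finset.sum_range_succ _ (n + 1), add_sub_cancel_left]
      rw [h1]
      refine (hindep.condExp_natural_ae_eq_of_lt hYs (Nat.lt_succ_self n)).trans ?_
      rw [h0]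
      rfl
  have hS0 : ∀ n, ∫ ω, S n ω ∂μ = 0 := by
    intro n
    simp only [S, Finset.sum_apply]
    rw [integral_finsetSum _ fun i _ => (hL2 i).integrable one_le_two]
    simp [h0]
  have hS2 : ∀ n, ∫ ω, S n ω ^ 2 ∂μ ≤ ∑' i, Var[Y i; μ] := by
    intro n
    rw [← variance_of_integral_eq_zero (hSint n).aemeasurable (hS0 n),
      IndepFun.variance_sum (fun i _ => hL2 i) fun i _ j _ hij => hindep.indepFun hij]
    exact hV.sum_le_tsum _ fun i _ => variance_nonneg _ _
  have hbdd : ∀ n, eLpNorm (S n) 1 μ ≤ ((1 + ∑' i, Var[Y i; μ]).toNNReal : ℝ≥0) := by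
    intro n
    rw [eLpNorm_one_eq_lintegral_enorm, ← ofReal_integral_norm_eq_lintegral_enorm (hSint n)]
    refine ENNReal.ofReal_le_ofReal ?_
    -- The inequality `|x| ≤ 1 + x ^ 2` turns the variance bound into the L¹ bound required by
    -- martingale convergence.
    calc ∫ ω, ‖S n ω‖ ∂μ ≤ ∫ ω, (1 + S n ω ^ 2) ∂μ := by
          refine integral_mono (hSint n).norm ((integrable_const 1).add (hSL2 n).integrable_sq)
            fun ω => ?_
          simp only [Real.norm_eq_abs]
          nlinarith [sq_abs (S n ω), sq_nonneg (|S n ω| - 1), abs_nonneg (S n ω)]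
      _ = 1 + ∫ ω, S n ω ^ 2 ∂μ := by
          rw [integral_add (integrable_const 1) (hSL2 n).integrable_sq]
          simp
      _ ≤ _ := by linarith [hS2 n]
  filter_upwards [hmart.submartingale.exists_ae_tendsto_of_bdd hbdd] with ω ⟨c, hc⟩
  refine ⟨c, (tendsto_add_atTop_iff_nat 1).1 ?_⟩
  simpa [S] using hc

variable {Ω : Type*}

/-- Centring: the martingale part has variances of order `1 / i ^ 2`, and the mean is a harmonic
number, which follows `log n` up to Euler's constant. -/
theorem binEnd_eq (E : ℕ → Ω → ℝ) (n : ℕ) (ω : Ω) :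
    binEnd E n ω = ∑ i ∈ Finset.range n, (E i ω - 1) / ((i : ℝ) + 1) + harmonic n := by
  rw [binEnd, harmonic, Rat.cast_sum, ← Finset.sum_add_distrib]
  refine Finset.sum_congr rfl fun i _ => ?_
  push_cast
  ring

theorem ae_tendsto_binEnd_sub_log [MeasurableSpace Ω] {μ : Measure Ω} [IsProbabilityMeasure μ]
    {E : ℕ → Ω → ℝ} (hE : ∀ i, Measurable (E i)) (hlaw : ∀ i, HasLaw (E i) (expMeasure 1) μ)
    (hindep : iIndepFun E μ) :
    ∀ᵐ ω ∂μ, Tendsto (fun n : ℕ => binEnd E n ω - Real.log n) atTop (𝓝 (limM E ω)) := by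
  have hL2 : ∀ i, MemLp (E i) 2 μ := by
    intro i
    have h := memLp_id_expMeasure_one
    rw [← (hlaw i).map_eq, memLp_map_measure_iff measurable_id.aestronglyMeasurable
      (hE i).aemeasurable] at h
    exact h
  have hmean : ∀ i, ∫ ω, E i ω ∂μ = 1 := by
    intro i
    rw [← integral_id_expMeasure_one, ← (hlaw i).map_eq]
    exact (integral_map (hE i).aemeasurable measurable_id.aestronglyMeasurable).symm
  have hvar : ∀ i, Var[E i; μ] = Var[id; expMeasure 1] := by
    intro i
    rw [← (hlaw i).map_eq, variance_id_map (hE i).aemeasurable]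
  have hφ : ∀ i : ℕ, Measurable fun x : ℝ => (x - 1) / ((i : ℝ) + 1) := fun i => by fun_prop
  have h := ae_exists_tendsto_sum_of_summable_variance
    (Y := fun i ω => (E i ω - 1) / ((i : ℝ) + 1)) (fun i => (hφ i).comp (hE i))
    (hindep.comp _ hφ)
    (fun i => by
      simp only [div_eq_inv_mul]
      exact ((hL2 i).sub (memLp_const (1 : ℝ))).const_mul _)
    (fun i => by
      rw [integral_div, integral_sub ((hL2 i).integrable one_le_two) (integrable_const _), hmean]
      simp)
    (by
      have e : ∀ i : ℕ, Var[fun ω => (E i ω - 1) / ((i : ℝ) + 1); μ] =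
          (1 / ((i : ℝ) + 1) ^ 2) * Var[id; expMeasure 1] := by
        intro i
        simp only [div_eq_inv_mul]
        rw [variance_const_mul, variance_sub_const (hE i).aestronglyMeasurable, hvar, inv_pow, mul_one]
      simp only [e]
      refine Summable.mul_right _ ?_
      have := (summable_nat_add_iff 1).2 (Real.summable_one_div_nat_pow.2 one_lt_two)
      simpa using this)
  filter_upwards [h] with ω ⟨c, hc⟩
  refine tendsto_nhds_limUnder ⟨c + Real.eulerMascheroniConstant, ?_⟩
  refine (hc.add Real.tendsto_harmonic_sub_log).congr fun n => ?_
  rw [binEnd_eq]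
  ring

end YuleBins

end

noncomputable section

namespace YuleBins

/-! ### Deterministic estimates -/

/-- Follows from `exp u ≥ 1 + u + u ^ 2 / 2` and `(1 + u + u ^ 2 / 2) (1 - u + u ^ 2 / 2) = 1 + u ^
4 / 4 ≥ 1`. -/
theorem sub_sq_div_two_le_one_sub_exp_neg {u : ℝ} (hu : 0 ≤ u) :
    u - u ^ 2 / 2 ≤ 1 - Real.exp (-u) := by
  have h := Real.quadratic_le_exp_of_nonneg hu
  have h1 : Real.exp (-u) * (1 + u + u ^ 2 / 2) ≤ 1 := by
    rw [Real.exp_neg]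
    exact (inv_mul_le_one₀ (Real.exp_pos u)).2 h
  have h2 : 0 < 1 + u + u ^ 2 / 2 := by positivity
  have h3 : Real.exp (-u) ≤ 1 / (1 + u + u ^ 2 / 2) := (le_div_iff₀ h2).2 h1
  have h4 : 1 / (1 + u + u ^ 2 / 2) ≤ 1 - u + u ^ 2 / 2 := by
    rw [div_le_iff₀ h2]
    nlinarith [pow_nonneg hu 4]
  linarith

theorem one_sub_exp_neg_le (u : ℝ) : 1 - Real.exp (-u) ≤ u := by
  linarith [Real.add_one_le_exp (-u)]

/-- The functions used as test functions: continuous, with values in `[0, 1]`, vanishing outside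
a bounded set of the quadrant, and equicontinuous in the second variable. -/
structure IsTestFun (g : ℝ → ℝ → ℝ) (R : ℝ) : Prop where
  continuous : Continuous (Function.uncurry g)
  nonneg : ∀ x y, 0 ≤ g x y
  le_one : ∀ x y, g x y ≤ 1
  one_le : 1 ≤ R
  eq_zero_left : ∀ x y, R < x → g x y = 0
  eq_zero_right : ∀ x y, R < y → g x y = 0
  equicontinuous : ∀ ε : ℝ, 0 < ε → ∃ δ : ℝ, 0 < δ ∧
    ∀ x y y', |y - y'| ≤ δ → |g x y - g x y'| ≤ ε

/-- The ordinate of a point of the process, as a function of the exponential variable. -/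
def ordinate (b c e : ℝ) : ℝ := (1 - Real.exp (-(b * e))) / (b * c)

theorem measurable_ordinate : Measurable fun p : ℝ × ℝ × ℝ => ordinate p.1 p.2.1 p.2.2 := by
  unfold ordinate
  fun_prop

theorem ordinate_le {b c e : ℝ} (hb : 0 < b) (hc : 0 < c) : ordinate b c e ≤ e / c := by
  rw [ordinate, div_le_div_iff₀ (by positivity) hc]
  have := one_sub_exp_neg_le (b * e)
  nlinarith

/-- With `ordinate_le`, this shows that the ordinate is `e / c` up to a quadratic correction
carrying the small factor `b * c`. -/
theorem le_ordinate {b c e : ℝ} (hb : 0 < b) (hc : 0 < c) (he : 0 ≤ e) :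
    e / c - b * c * (e / c) ^ 2 / 2 ≤ ordinate b c e := by
  have h := sub_sq_div_two_le_one_sub_exp_neg (mul_nonneg hb.le he)
  rw [ordinate, le_div_iff₀ (by positivity)]
  calc (e / c - b * c * (e / c) ^ 2 / 2) * (b * c) = b * e - (b * e) ^ 2 / 2 := by field_simp
    _ ≤ _ := h

theorem ordinate_mono {b c e e' : ℝ} (hb : 0 < b) (hc : 0 < c) (h : e ≤ e') :
    ordinate b c e ≤ ordinate b c e' := by
  rw [ordinate, ordinate]
  have : 0 ≤ b * c := by positivity
  gcongr

/-- For `e ≤ c (R + 1)` the ordinate is within `δ` of `e / c`, which costs `ε`, and replacing `exp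
(-e)` by `1` costs at most `e`. Beyond that point both arguments of `h` exceed `R` and both terms
vanish; the margin between `R` and `R + 1` absorbs the quadratic correction. -/
theorem abs_test_ordinate_le {h : ℝ → ℝ} {R ε δ b c e : ℝ} (h0 : ∀ y, 0 ≤ h y) (h1 : ∀ y, h y ≤ 1)
    (hR1 : 0 ≤ R) (hR : ∀ y, R < y → h y = 0) (hδ : ∀ y y', |y - y'| ≤ δ → |h y - h y'| ≤ ε)
    (hb : 0 < b) (hc : 0 < c) (he : 0 ≤ e) (hbc1 : b * c * (R + 1) ^ 2 ≤ δ)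
    (hbc2 : b * c * (R + 1) ^ 2 ≤ 1) :
    |Real.exp (-e) * h (ordinate b c e) - h (e / c)| ≤
      (Set.Icc 0 (c * (R + 1))).indicator (fun _ => ε + c * (R + 1)) e := by
  have hbc : 0 < b * c := by positivity
  by_cases hce : e ≤ c * (R + 1)
  · rw [Set.indicator_of_mem (show e ∈ Set.Icc 0 (c * (R + 1)) from ⟨he, hce⟩)]
    have hec : e / c ≤ R + 1 := by rw [div_le_iff₀ hc]; linarith
    have hec0 : 0 ≤ e / c := by positivity
    have e1 : |ordinate b c e - e / c| ≤ δ := by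
      have h2 := ordinate_le (e := e) hb hc
      have h3 := le_ordinate hb hc he
      have h4 : b * c * (e / c) ^ 2 / 2 ≤ b * c * (R + 1) ^ 2 := by
        have : (e / c) ^ 2 ≤ (R + 1) ^ 2 := by gcongr
        nlinarith [sq_nonneg (e / c)]
      rw [abs_le]
      constructor
      · linarith
      · have : 0 ≤ b * c * (R + 1) ^ 2 := by positivity
        linarith
    have e2 := hδ _ _ e1
    have e3 : Real.exp (-e) ≤ 1 := Real.exp_le_one_iff.2 (by linarith)
    have e4 := one_sub_exp_neg_le e
    have e5 : Real.exp (-e) * h (ordinate b c e) - h (e / c) =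
        Real.exp (-e) * (h (ordinate b c e) - h (e / c)) - (1 - Real.exp (-e)) * h (e / c) := by
      ring
    rw [e5]
    refine (abs_sub _ _).trans (add_le_add ?_ ?_)
    · rw [abs_mul, abs_of_pos (Real.exp_pos _)]
      calc _ ≤ 1 * ε := mul_le_mul e3 e2 (abs_nonneg _) zero_le_one
        _ = ε := one_mul _
    · rw [abs_of_nonneg (mul_nonneg (by linarith) (h0 _))]
      calc _ ≤ e * 1 := mul_le_mul e4 (h1 _) (h0 _) he
        _ ≤ _ := by linarith
  · rw [Set.indicator_of_notMem fun h => hce h.2]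
    push Not at hce
    have e1 : R + 1 < e / c := by rw [lt_div_iff₀ hc]; linarith
    have e2 : R < ordinate b c e := by
      have h2 := le_ordinate (e := c * (R + 1)) hb hc (by positivity)
      rw [mul_div_cancel_left₀ _ hc.ne'] at h2
      have h3 := ordinate_mono hb hc hce.le
      linarith
    rw [hR _ e2, hR _ (by linarith)]
    simp

/-- On the scale `c` only the value `1` of the exponential density at `0` is seen. The pointwise
bound is integrated over an interval of length `c (R + 1)`, so the error is of smaller order than
`c`. -/
theorem abs_integral_test_ordinate_sub_le {h : ℝ → ℝ} {R ε δ b c : ℝ} (hcont : Continuous h)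
    (h0 : ∀ y, 0 ≤ h y) (h1 : ∀ y, h y ≤ 1)
    (hR1 : 0 ≤ R) (hR : ∀ y, R < y → h y = 0) (hε : 0 ≤ ε)
    (hδ : ∀ y y', |y - y'| ≤ δ → |h y - h y'| ≤ ε)
    (hb : 0 < b) (hc : 0 < c) (hbc1 : b * c * (R + 1) ^ 2 ≤ δ)
    (hbc2 : b * c * (R + 1) ^ 2 ≤ 1) :
    |∫ e, h (ordinate b c e) ∂(expMeasure 1) - c * ∫ y in Set.Ioi 0, h y| ≤
      c * (R + 1) * (ε + c * (R + 1)) := by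
  have e1 : c * ∫ y in Set.Ioi 0, h y = ∫ e in Set.Ioi 0, h (e / c) := by
    have := integral_comp_mul_right_Ioi h 0 (inv_pos.2 hc)
    simp only [zero_mul, inv_inv, smul_eq_mul] at this
    simp only [div_eq_mul_inv]
    rw [this]
  have hord : Continuous (ordinate b c) := by
    unfold ordinate
    fun_prop
  have i1 : IntegrableOn (fun e => Real.exp (-e) * h (ordinate b c e)) (Set.Ioi 0) := by
    have hexp : IntegrableOn (fun e : ℝ => Real.exp (-e)) (Set.Ioi 0) := by
      simpa using integrableOn_exp_neg_Ioi 0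
    refine Integrable.mono' hexp (by fun_prop) (ae_of_all _ fun e => ?_)
    rw [Real.norm_of_nonneg (mul_nonneg (Real.exp_pos _).le (h0 _))]
    exact mul_le_of_le_one_right (Real.exp_pos _).le (h1 _)
  have i2 : IntegrableOn (fun e => h (e / c)) (Set.Ioi 0) := by
    have : IntegrableOn (fun e => h (e / c)) (Set.Icc 0 (c * R)) :=
      (hcont.comp (continuous_id.div_const c)).integrableOn_Icc
    refine IntegrableOn.of_forall_sdiff_eq_zero this measurableSet_Ioi fun e he => ?_
    refine hR _ ?_
    rw [lt_div_iff₀ hc, mul_comm]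
    by_contra hcon
    exact he.2 ⟨le_of_lt he.1, not_lt.1 hcon⟩
  rw [e1, integral_expMeasure_one, ← integral_sub i1 i2]
  have e2 : ∫ e in Set.Ioi (0 : ℝ),
      (Set.Icc 0 (c * (R + 1))).indicator (fun _ => ε + c * (R + 1)) e ≤
      c * (R + 1) * (ε + c * (R + 1)) := by
    rw [integral_indicator_const _ measurableSet_Icc, smul_eq_mul]
    gcongr
    refine (ENNReal.toReal_mono ?_ (Measure.restrict_apply_le _ _)).trans ?_
    · simp
    · simp [Real.volume_Icc, ENNReal.toReal_ofReal (by positivity : 0 ≤ c * (R + 1))]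
  refine le_trans ?_ e2
  rw [← Real.norm_eq_abs]
  refine norm_integral_le_of_norm_le ?_ ?_
  · exact ((integrable_indicator_iff measurableSet_Icc).2
      (integrableOn_const (by simp))).integrableOn
  · filter_upwards [ae_restrict_mem measurableSet_Ioi] with e he
    exact abs_test_ordinate_le h0 h1 hR1 hR hδ hb hc (le_of_lt he) hbc1 hbc2

/-! ### Products -/

theorem abs_prod_sub_prod_le {ι : Type*} (s : Finset ι) {u v : ι → ℝ}
    (hu : ∀ i ∈ s, |u i| ≤ 1) (hv : ∀ i ∈ s, |v i| ≤ 1) :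
    |∏ i ∈ s, u i - ∏ i ∈ s, v i| ≤ ∑ i ∈ s, |u i - v i| := by
  classical
  induction s using Finset.induction_on with
  | empty => simp
  | insert a s ha ih =>
    rw [Finset.prod_insert ha, Finset.prod_insert ha, Finset.sum_insert ha]
    have h1 := ih (fun i hi => hu i (Finset.mem_insert_of_mem hi))
      (fun i hi => hv i (Finset.mem_insert_of_mem hi))
    have h2 : |∏ i ∈ s, u i| ≤ 1 := by
      rw [Finset.abs_prod]
      exact Finset.prod_le_one (fun i _ => abs_nonneg _)
        fun i hi => hu i (Finset.mem_insert_of_mem hi)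
    have h3 := hv a (Finset.mem_insert_self a s)
    have e : u a * ∏ i ∈ s, u i - v a * ∏ i ∈ s, v i =
        (u a - v a) * ∏ i ∈ s, u i + v a * (∏ i ∈ s, u i - ∏ i ∈ s, v i) := by ring
    rw [e]
    refine (abs_add_le _ _).trans (add_le_add ?_ ?_)
    · rw [abs_mul]
      exact mul_le_of_le_one_right (abs_nonneg _) h2
    · rw [abs_mul]
      exact (mul_le_of_le_one_left (abs_nonneg _) h3).trans h1

/-- Each factor `1 - p` differs from `exp (-p)` by at most `p ^ 2 ≤ C * p`. -/
theorem abs_prod_one_sub_sub_exp_le {ι : Type*} (s : Finset ι) {p : ι → ℝ} {C : ℝ}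
    (h0 : ∀ i ∈ s, 0 ≤ p i) (h1 : ∀ i ∈ s, p i ≤ 1) (hC : ∀ i ∈ s, p i ≤ C) :
    |∏ i ∈ s, (1 - p i) - Real.exp (-∑ i ∈ s, p i)| ≤ C * ∑ i ∈ s, p i := by
  rw [← Finset.sum_neg_distrib, Real.exp_sum, Finset.mul_sum]
  refine (abs_prod_sub_prod_le s (fun i hi => ?_) (fun i hi => ?_)).trans
    (Finset.sum_le_sum fun i hi => ?_)
  · rw [abs_le]
    constructor <;> linarith [h0 i hi, h1 i hi]
  · rw [abs_of_pos (Real.exp_pos _), Real.exp_le_one_iff]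
    linarith [h0 i hi]
  · have e1 := one_sub_exp_neg_le (p i)
    have e2 := sub_sq_div_two_le_one_sub_exp_neg (h0 i hi)
    have e3 : p i ^ 2 ≤ C * p i := by
      rw [sq]
      exact mul_le_mul_of_nonneg_right (hC i hi) (h0 i hi)
    have e4 := sq_nonneg (p i)
    rw [abs_le]
    constructor <;> linarith

end YuleBins

end

noncomputable section

namespace YuleBins

/-! ### Riemann sums -/

theorem le_of_lt_floor {R a : ℝ} (ha : 0 < a) (hR : 0 ≤ R) {k : ℕ} (hk : k < ⌊R * a⌋₊) :
    ((k : ℝ) + 1) / a ≤ R := by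
  rw [div_le_iff₀ ha]
  have h1 : ((k + 1 : ℕ) : ℝ) ≤ ⌊R * a⌋₊ := by exact_mod_cast hk
  have h2 := Nat.floor_le (mul_nonneg hR ha.le)
  push_cast at h1
  linarith

theorem lt_of_floor_le {R a : ℝ} (ha : 0 < a) {k : ℕ} (hk : ⌊R * a⌋₊ ≤ k) :
    R < ((k : ℝ) + 1) / a := by
  rw [lt_div_iff₀ ha]
  have h1 : (⌊R * a⌋₊ : ℝ) ≤ k := by exact_mod_cast hk
  have h2 := Nat.lt_floor_add_one (R * a)
  linarith

/-- Writing the sum as the integral of a step function opens it to dominated convergence. Rounding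
up sends every `x` past the last node to a point beyond `R`, where `H` vanishes. -/
theorem sum_div_eq_integral {H : ℝ → ℝ} {R a : ℝ} (hHR : ∀ x, R < x → H x = 0) (ha : 0 < a) :
    ∑ k ∈ Finset.range ⌊R * a⌋₊, H (((k : ℝ) + 1) / a) / a =
      ∫ x in Set.Ioi 0, H (⌈x * a⌉₊ / a) := by
  set N := ⌊R * a⌋₊
  have hceil : ∀ (k : ℕ) (x : ℝ), x ∈ Set.Ioc ((k : ℝ) / a) (((k + 1 : ℕ) : ℝ) / a) →
      H (⌈x * a⌉₊ / a) = H (((k : ℝ) + 1) / a) := by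
    intro k x hx
    have h1 : ⌈x * a⌉₊ = k + 1 := by
      rw [Nat.ceil_eq_iff (by simp)]
      refine ⟨?_, (le_div_iff₀ ha).1 hx.2⟩
      simpa using (div_lt_iff₀ ha).1 hx.1
    rw [h1]
    push_cast
    rfl
  have hle : ∀ k : ℕ, (k : ℝ) / a ≤ ((k + 1 : ℕ) : ℝ) / a := fun k => by
    gcongr
    exact Nat.le_succ k
  have hpiece : ∀ k : ℕ, ∫ x in ((k : ℝ) / a)..(((k + 1 : ℕ) : ℝ) / a), H (⌈x * a⌉₊ / a) =
      H (((k : ℝ) + 1) / a) / a := by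
    intro k
    rw [intervalIntegral.integral_congr_ae (g := fun _ => H (((k : ℝ) + 1) / a))
      (ae_of_all _ fun x hx => hceil k x (by rwa [Set.uIoc_of_le (hle k)] at hx)),
      intervalIntegral.integral_const, smul_eq_mul]
    push_cast
    ring
  have hint : ∀ k < N, IntervalIntegrable (fun x => H (⌈x * a⌉₊ / a)) volume
      ((k : ℝ) / a) (((k + 1 : ℕ) : ℝ) / a) := by
    intro k _
    refine (intervalIntegrable_const (c := H (((k : ℝ) + 1) / a))).congr fun x hx => ?_
    rw [Set.uIoc_of_le (hle k)] at hx
    exact (hceil k x hx).symm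
  have h0 : (0 : ℝ) ≤ (N : ℝ) / a := by positivity
  have hsum := intervalIntegral.sum_integral_adjacent_intervals (a := fun k : ℕ => (k : ℝ) / a) hint
  simp only [hpiece, Nat.cast_zero, zero_div] at hsum
  rw [hsum, intervalIntegral.integral_of_le h0]
  refine (setIntegral_eq_of_subset_of_forall_sdiff_eq_zero measurableSet_Ioi
    Set.Ioc_subset_Ioi_self fun x hx => hHR _ ?_).symm
  have hx1 : (N : ℝ) / a < x := not_le.1 fun h => hx.2 ⟨hx.1, h⟩
  rw [lt_div_iff₀ ha]
  have h2 : N < ⌈x * a⌉₊ := Nat.lt_ceil.2 ((div_lt_iff₀ ha).1 hx1)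
  exact (Nat.floor_lt' (by omega)).1 h2

theorem tendsto_riemann_sum {H : ℝ → ℝ} {R : ℝ} (hH : Continuous H)
    (hHR : ∀ x, R < x → H x = 0) :
    Tendsto (fun a : ℝ => ∑ k ∈ Finset.range ⌊R * a⌋₊, H (((k : ℝ) + 1) / a) / a) atTop
      (𝓝 (∫ x in Set.Ioi 0, H x)) := by
  obtain ⟨C, hC⟩ := isCompact_Icc.exists_bound_of_continuousOn (s := Set.Icc (0 : ℝ) R)
    hH.continuousOn
  have h1 : Tendsto (fun a : ℝ => ∫ x in Set.Ioi 0, H (⌈x * a⌉₊ / a)) atTop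
      (𝓝 (∫ x in Set.Ioi 0, H x)) := by
    refine tendsto_integral_filter_of_dominated_convergence
      ((Set.Icc 0 R).indicator fun _ => C) ?_ ?_ ?_ ?_
    · filter_upwards with a
      have h2 : Measurable fun x : ℝ => ⌈x * a⌉₊ :=
        Nat.measurable_ceil.comp (measurable_id.mul_const a)
      have h3 : Measurable fun x : ℝ => (⌈x * a⌉₊ : ℝ) := measurable_from_nat.comp h2
      exact (hH.measurable.comp (h3.div_const a)).aestronglyMeasurable
    · filter_upwards [eventually_gt_atTop 0] with a ha
      filter_upwards [ae_restrict_mem measurableSet_Ioi] with x hx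
      by_cases hc : (⌈x * a⌉₊ : ℝ) / a ≤ R
      · have h2 : x ≤ ⌈x * a⌉₊ / a := by
          rw [le_div_iff₀ ha]
          exact Nat.le_ceil _
        rw [Set.indicator_of_mem (show x ∈ Set.Icc 0 R from ⟨le_of_lt hx, h2.trans hc⟩)]
        exact hC _ ⟨by positivity, hc⟩
      · rw [hHR _ (not_le.1 hc), norm_zero]
        refine Set.indicator_nonneg (fun y hy => ?_) x
        exact (norm_nonneg _).trans (hC y hy)
    · exact ((integrable_indicator_iff measurableSet_Icc).2
        (integrableOn_const (by simp))).integrableOn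
    · filter_upwards [ae_restrict_mem measurableSet_Ioi] with x hx
      exact (hH.tendsto x).comp (tendsto_nat_ceil_mul_div_atTop (le_of_lt hx))
  refine h1.congr' ?_
  filter_upwards [eventually_gt_atTop 0] with a ha
  exact (sum_div_eq_integral hHR ha).symm

/-! ### The intensity of a test function -/

/-- The integral of `g` over a vertical half-line. -/
def vertInt (g : ℝ → ℝ → ℝ) (x : ℝ) : ℝ := ∫ y in Set.Ioi 0, g x y

/-- The density with respect to `dx` of the integral of `g` against `x ^ (ρ + 1) dx dy`. -/
def vertDensity (ρ : ℝ) (g : ℝ → ℝ → ℝ) (x : ℝ) : ℝ := x ^ (ρ + 1) * vertInt g x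

namespace IsTestFun

variable {g : ℝ → ℝ → ℝ} {R : ℝ}

theorem continuous_right (hg : IsTestFun g R) (x : ℝ) : Continuous (g x) :=
  hg.continuous.comp (Continuous.prodMk_right x)

theorem norm_le_indicator (hg : IsTestFun g R) (x : ℝ) {y : ℝ} (hy : 0 ≤ y) :
    ‖g x y‖ ≤ (Set.Icc 0 R).indicator (fun _ => 1) y := by
  rw [Real.norm_of_nonneg (hg.nonneg x y)]
  by_cases h : y ≤ R
  · rw [Set.indicator_of_mem (show y ∈ Set.Icc 0 R from ⟨hy, h⟩)]
    exact hg.le_one x y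
  · rw [hg.eq_zero_right x y (not_le.1 h)]
    exact Set.indicator_nonneg (fun _ _ => zero_le_one) y

theorem integrableOn_bound (R : ℝ) :
    IntegrableOn ((Set.Icc 0 R).indicator fun _ => (1 : ℝ)) (Set.Ioi 0) :=
  ((integrable_indicator_iff measurableSet_Icc).2 (integrableOn_const (by simp))).integrableOn

theorem continuous_vertInt (hg : IsTestFun g R) : Continuous (vertInt g) := by
  refine continuous_of_dominated (fun x => (hg.continuous_right x).aestronglyMeasurable)
    (fun x => ?_) (integrableOn_bound R) (ae_of_all _ fun y => ?_)
  · filter_upwards [ae_restrict_mem measurableSet_Ioi] with y hy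
    exact hg.norm_le_indicator x (le_of_lt hy)
  · exact hg.continuous.comp (Continuous.prodMk_left y)

theorem vertInt_nonneg (hg : IsTestFun g R) (x : ℝ) : 0 ≤ vertInt g x :=
  integral_nonneg fun y => hg.nonneg x y

theorem vertInt_le (hg : IsTestFun g R) (x : ℝ) : vertInt g x ≤ R := by
  have h0 : 0 ≤ R := zero_le_one.trans hg.one_le
  calc vertInt g x ≤ ∫ y in Set.Ioi (0 : ℝ), (Set.Icc 0 R).indicator (fun _ => 1) y := by
        refine setIntegral_mono_on ?_ (integrableOn_bound R) measurableSet_Ioi fun y hy => ?_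
        · refine (integrableOn_bound R).mono' (hg.continuous_right x).aestronglyMeasurable ?_
          filter_upwards [ae_restrict_mem measurableSet_Ioi] with y hy
          exact hg.norm_le_indicator x (le_of_lt hy)
        · exact (Real.norm_of_nonneg (hg.nonneg x y)).symm.le.trans
            (hg.norm_le_indicator x (le_of_lt hy))
    _ ≤ R := by
        rw [integral_indicator_const _ measurableSet_Icc, smul_eq_mul, mul_one]
        refine (ENNReal.toReal_mono ?_ (Measure.restrict_apply_le _ _)).trans ?_
        · simp
        · simp [Real.volume_Icc, ENNReal.toReal_ofReal h0]

theorem vertInt_eq_zero (hg : IsTestFun g R) {x : ℝ} (hx : R < x) : vertInt g x = 0 := by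
  simp [vertInt, hg.eq_zero_left x _ hx]

theorem continuous_vertDensity (hg : IsTestFun g R) {ρ : ℝ} (hρ : 0 < ρ) :
    Continuous (vertDensity ρ g) :=
  (continuous_id.rpow_const fun _ => Or.inr (by linarith)).mul hg.continuous_vertInt

theorem vertDensity_nonneg (hg : IsTestFun g R) {ρ x : ℝ} (hx : 0 ≤ x) :
    0 ≤ vertDensity ρ g x :=
  mul_nonneg (Real.rpow_nonneg hx _) (hg.vertInt_nonneg x)

theorem vertDensity_le (hg : IsTestFun g R) {ρ x : ℝ} (hρ : 0 < ρ) (hx : 0 ≤ x) :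
    vertDensity ρ g x ≤ R ^ (ρ + 1) * R := by
  have h0 : 0 ≤ R := zero_le_one.trans hg.one_le
  by_cases h : x ≤ R
  · exact mul_le_mul (Real.rpow_le_rpow hx h (by linarith)) (hg.vertInt_le x)
      (hg.vertInt_nonneg x) (Real.rpow_nonneg h0 _)
  · rw [vertDensity, hg.vertInt_eq_zero (not_le.1 h), mul_zero]
    positivity

theorem vertDensity_eq_zero (hg : IsTestFun g R) {ρ x : ℝ} (hx : R < x) :
    vertDensity ρ g x = 0 := by
  rw [vertDensity, hg.vertInt_eq_zero hx, mul_zero]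

end IsTestFun

end YuleBins

end

noncomputable section

namespace YuleBins

/-! ### Conditioning on the past -/

section Past

variable {Ω : Type*}

/-- The σ-algebra generated by the variables of index `< k`. -/
@[reducible] def past (E : ℕ → Ω → ℝ) (k : ℕ) : MeasurableSpace Ω :=
  ⨆ j ∈ Set.Iio k, MeasurableSpace.comap (E j) inferInstance

theorem past_mono (E : ℕ → Ω → ℝ) : Monotone (past E) := fun _ _ h =>
  biSup_mono fun _ hj => lt_of_lt_of_le hj h

theorem measurable_past (E : ℕ → Ω → ℝ) {j k : ℕ} (h : j < k) : Measurable[past E k] (E j) := by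
  refine Measurable.mono (comap_measurable (E j)) ?_ le_rfl
  exact le_iSup₂_of_le (f := fun j (_ : j ∈ Set.Iio k) =>
    MeasurableSpace.comap (E j) inferInstance) j h le_rfl

variable [mΩ : MeasurableSpace Ω] {μ : Measure Ω}

theorem past_le {E : ℕ → Ω → ℝ} (hE : ∀ i, Measurable (E i)) (k : ℕ) : past E k ≤ mΩ :=
  iSup₂_le fun j _ => (hE j).comap_le

theorem indepFun_of_measurable_past {E : ℕ → Ω → ℝ} (hE : ∀ i, Measurable (E i))
    (hindep : iIndepFun E μ) {β : Type*} [MeasurableSpace β] {k : ℕ} {X : Ω → β}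
    (hX : Measurable[past E k] X) : IndepFun X (E k) μ := by
  have h := indep_iSup_of_disjoint (fun i => (hE i).comap_le) hindep
    (S := Set.Iio k) (T := {k}) (by simp)
  rw [IndepFun_iff_Indep]
  refine indep_of_indep_of_le_left (indep_of_indep_of_le_right h ?_) hX.comap_le
  exact le_iSup₂_of_le (f := fun j (_ : j ∈ ({k} : Set ℕ)) =>
    MeasurableSpace.comap (E j) inferInstance) k rfl le_rfl

/-- The pair `(A, θ)` is independent of `E k`, so Fubini integrates out `E k` with `θ` held fixed: a
conditional expectation without the formalism. -/
theorem integral_mul_comp_past [IsProbabilityMeasure μ] {E : ℕ → Ω → ℝ} (hE : ∀ i, Measurable (E i))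
    (hindep : iIndepFun E μ) {k : ℕ} {A θ : Ω → ℝ} (hA : Measurable[past E k] A)
    (hA1 : ∀ ω, |A ω| ≤ 1) (hθ : Measurable[past E k] θ) {ψ : ℝ → ℝ → ℝ}
    (hψ : Measurable (Function.uncurry ψ)) (hψ1 : ∀ x y, |ψ x y| ≤ 1) :
    ∫ ω, A ω * ψ (θ ω) (E k ω) ∂μ = ∫ ω, A ω * ∫ e, ψ (θ ω) e ∂(μ.map (E k)) ∂μ := by
  have hA' : Measurable A := hA.mono (past_le hE k) le_rfl
  have hθ' : Measurable θ := hθ.mono (past_le hE k) le_rfl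
  have hX : Measurable fun ω => (A ω, θ ω) := hA'.prodMk hθ'
  have hind : IndepFun (fun ω => (A ω, θ ω)) (E k) μ :=
    indepFun_of_measurable_past hE hindep (Measurable.prodMk hA hθ)
  have hmap := (indepFun_iff_map_prod_eq_prod_map_map hX.aemeasurable (hE k).aemeasurable).1 hind
  have : IsProbabilityMeasure (μ.map (E k)) := Measure.isProbabilityMeasure_map (hE k).aemeasurable
  have : IsProbabilityMeasure (μ.map fun ω => (A ω, θ ω)) :=
    Measure.isProbabilityMeasure_map hX.aemeasurable
  have hF : Measurable fun z : (ℝ × ℝ) × ℝ => z.1.1 * ψ z.1.2 z.2 :=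
    (measurable_fst.comp measurable_fst).mul
      (hψ.comp ((measurable_snd.comp measurable_fst).prodMk measurable_snd))
  have e1 : ∫ ω, A ω * ψ (θ ω) (E k ω) ∂μ =
      ∫ z, z.1.1 * ψ z.1.2 z.2 ∂((μ.map fun ω => (A ω, θ ω)).prod (μ.map (E k))) := by
    rw [← hmap, integral_map (hX.prodMk (hE k)).aemeasurable hF.aestronglyMeasurable]
  have hb : ∀ᵐ z ∂((μ.map fun ω => (A ω, θ ω)).prod (μ.map (E k))),
      ‖z.1.1 * ψ z.1.2 z.2‖ ≤ 1 := by
    rw [← hmap]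
    refine (ae_map_iff (hX.prodMk (hE k)).aemeasurable
      (measurableSet_le hF.norm measurable_const)).2 (ae_of_all _ fun ω => ?_)
    rw [Real.norm_eq_abs, abs_mul]
    exact mul_le_one₀ (hA1 ω) (abs_nonneg _) (hψ1 _ _)
  rw [e1, integral_prod _ (Integrable.of_bound hF.aestronglyMeasurable 1 hb)]
  have e2 : StronglyMeasurable fun z : ℝ × ℝ => ∫ e, z.1 * ψ z.2 e ∂(μ.map (E k)) :=
    StronglyMeasurable.integral_prod_right hF.stronglyMeasurable
  rw [integral_map hX.aemeasurable e2.aestronglyMeasurable]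
  simp only [integral_const_mul]

end Past

/-! ### Replacing the factors of a product by their conditional expectations -/

/-- Here `r k` plays the conditional mean of `X k` given `𝓖 k`, and `p k` is an approximation of it
already known at time `m`. The last factor is peeled off: `X N` becomes `r N` by conditioning, then
`p N` at the cost `E |r N - p N|`. All other factors are bounded by `1`. -/
theorem abs_integral_mul_prod_sub_le {Ω : Type*} [mΩ : MeasurableSpace Ω] {μ : Measure Ω}
    [IsProbabilityMeasure μ] {𝓖 : ℕ → MeasurableSpace Ω} (hmono : Monotone 𝓖)
    (hle : ∀ k, 𝓖 k ≤ mΩ) {m : ℕ} {X r p : ℕ → Ω → ℝ}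
    (hX : ∀ k, Measurable[𝓖 (k + 1)] (X k)) (hX0 : ∀ k ω, 0 ≤ X k ω) (hX1 : ∀ k ω, X k ω ≤ 1)
    (hp : ∀ k, Measurable[𝓖 m] (p k)) (hp0 : ∀ k ω, 0 ≤ p k ω) (hp1 : ∀ k ω, p k ω ≤ 1)
    (hr : ∀ k, Measurable (r k)) (hr1 : ∀ k ω, |r k ω| ≤ 1)
    (hXr : ∀ k, ∀ A : Ω → ℝ, Measurable[𝓖 k] A → (∀ ω, |A ω| ≤ 1) →
      ∫ ω, A ω * X k ω ∂μ = ∫ ω, A ω * r k ω ∂μ) {N : ℕ} (hN : m ≤ N) :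
    ∀ B : Ω → ℝ, Measurable[𝓖 m] B → (∀ ω, 0 ≤ B ω) → (∀ ω, B ω ≤ 1) →
    |∫ ω, B ω * ∏ k ∈ Finset.Ico m N, (1 - X k ω) ∂μ -
      ∫ ω, B ω * ∏ k ∈ Finset.Ico m N, (1 - p k ω) ∂μ| ≤
      ∑ k ∈ Finset.Ico m N, ∫ ω, |r k ω - p k ω| ∂μ := by
  induction N, hN using Nat.le_induction with
  | base => intro B _ _ _; simp
  | succ N hN ih =>
    intro B hB hB0 hB1
    set Q : Ω → ℝ := fun ω => ∏ k ∈ Finset.Ico m N, (1 - X k ω) with hQ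
    have hQm : Measurable[𝓖 N] Q := by
      refine Finset.measurable_prod _ fun k hk => ?_
      exact measurable_const.sub ((hX k).mono (hmono (Finset.mem_Ico.1 hk).2) le_rfl)
    have hQ0 : ∀ ω, 0 ≤ Q ω := fun ω => Finset.prod_nonneg fun k _ => by linarith [hX1 k ω]
    have hQ1 : ∀ ω, Q ω ≤ 1 := fun ω => Finset.prod_le_one (fun k _ => by linarith [hX1 k ω])
      fun k _ => by linarith [hX0 k ω]
    set A : Ω → ℝ := fun ω => B ω * Q ω with hAdef
    have hA : Measurable[𝓖 N] A := (hB.mono (hmono hN) le_rfl).mul hQm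
    have hA0 : ∀ ω, 0 ≤ A ω := fun ω => mul_nonneg (hB0 ω) (hQ0 ω)
    have hA1 : ∀ ω, |A ω| ≤ 1 := fun ω => by
      rw [abs_of_nonneg (hA0 ω)]
      exact mul_le_one₀ (hB1 ω) (hQ0 ω) (hQ1 ω)
    have hAm : Measurable A := hA.mono (hle N) le_rfl
    have hXm : Measurable (X N) := (hX N).mono (hle _) le_rfl
    have hpm : Measurable (p N) := (hp N).mono (hle _) le_rfl
    have int : ∀ {f : Ω → ℝ}, Measurable f → (∀ ω, |f ω| ≤ 1) → Integrable f μ :=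
      fun hf h => Integrable.of_bound hf.aestronglyMeasurable 1 (ae_of_all _ h)
    have mul1 : ∀ {x y : ℝ}, |x| ≤ 1 → |y| ≤ 1 → |x * y| ≤ 1 := fun hx hy => by
      rw [abs_mul]
      exact mul_le_one₀ hx (abs_nonneg _) hy
    have iA := int hAm hA1
    have iX : Integrable (fun ω => A ω * X N ω) μ := int (hAm.mul hXm) fun ω =>
      mul1 (hA1 ω) (abs_le.2 ⟨by linarith [hX0 N ω], hX1 N ω⟩)
    have iP : Integrable (fun ω => A ω * p N ω) μ := int (hAm.mul hpm) fun ω =>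
      mul1 (hA1 ω) (abs_le.2 ⟨by linarith [hp0 N ω], hp1 N ω⟩)
    have iR : Integrable (fun ω => A ω * r N ω) μ := int (hAm.mul (hr N)) fun ω =>
      mul1 (hA1 ω) (hr1 N ω)
    have iD : Integrable (fun ω => |r N ω - p N ω|) μ :=
      ((int (hr N) (hr1 N)).sub (int hpm fun ω =>
        abs_le.2 ⟨by linarith [hp0 N ω], hp1 N ω⟩)).abs
    have e1 : ∫ ω, B ω * ∏ k ∈ Finset.Ico m (N + 1), (1 - X k ω) ∂μ =
        ∫ ω, A ω ∂μ - ∫ ω, A ω * r N ω ∂μ := by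
      rw [← hXr N A hA hA1, ← integral_sub iA iX]
      refine integral_congr_ae (ae_of_all _ fun ω => ?_)
      simp only [Finset.prod_Ico_succ_top hN, hAdef, hQ]
      ring
    have e2 : ∫ ω, B ω * (1 - p N ω) * Q ω ∂μ = ∫ ω, A ω ∂μ - ∫ ω, A ω * p N ω ∂μ := by
      rw [← integral_sub iA iP]
      refine integral_congr_ae (ae_of_all _ fun ω => ?_)
      simp only [hAdef]
      ring
    have e3 : ∫ ω, B ω * ∏ k ∈ Finset.Ico m (N + 1), (1 - p k ω) ∂μ =
        ∫ ω, B ω * (1 - p N ω) * ∏ k ∈ Finset.Ico m N, (1 - p k ω) ∂μ := by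
      refine integral_congr_ae (ae_of_all _ fun ω => ?_)
      simp only [Finset.prod_Ico_succ_top hN]
      ring
    -- The new factor is `𝓖 m`-measurable and joins the weight; this is why the induction runs over
    -- all `B`.
    have h1 := ih (fun ω => B ω * (1 - p N ω)) (hB.mul (measurable_const.sub (hp N)))
      (fun ω => mul_nonneg (hB0 ω) (by linarith [hp1 N ω]))
      (fun ω => mul_le_one₀ (hB1 ω) (by linarith [hp1 N ω]) (by linarith [hp0 N ω]))
    have h2 : |∫ ω, A ω * p N ω ∂μ - ∫ ω, A ω * r N ω ∂μ| ≤ ∫ ω, |r N ω - p N ω| ∂μ := by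
      rw [← integral_sub iP iR, ← Real.norm_eq_abs]
      refine norm_integral_le_of_norm_le iD (ae_of_all _ fun ω => ?_)
      rw [← mul_sub, Real.norm_eq_abs, abs_mul, abs_sub_comm]
      exact mul_le_of_le_one_left (abs_nonneg _) (hA1 ω)
    rw [Finset.sum_Ico_succ_top hN, e3, e1]
    rw [e2] at h1
    rw [abs_le] at h1 h2 ⊢
    constructor <;> linarith [h1.1, h1.2, h2.1, h2.2]

end YuleBins

end

noncomputable section

namespace YuleBins

/-! ### The value of a test function at a point of the process -/

/-- The value of `g` at the `(k+1)`-st point, as a function of the normalized position `t` of the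
bin and of the exponential variable `e`; the scale is `a = n ^ (1 / (ρ + 2))`. -/
def binTest (ρ : ℝ) (g : ℝ → ℝ → ℝ) (a : ℝ) (k : ℕ) (t e : ℝ) : ℝ :=
  g (((k : ℝ) + 1) / a) (ordinate (ρ / ((k : ℝ) + 1)) (t * ((((k : ℝ) + 1) / a) ^ (ρ + 1) / a)) e)

/-- The limiting mean value of `g` at the `(k+1)`-st point is this weight times the normalized
position of the bin. -/
def binWeight (ρ : ℝ) (g : ℝ → ℝ → ℝ) (a : ℝ) (k : ℕ) : ℝ :=
  vertDensity ρ g (((k : ℝ) + 1) / a) / a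

namespace IsTestFun

variable {g : ℝ → ℝ → ℝ} {R ρ : ℝ}

theorem measurable_binTest (hg : IsTestFun g R) (ρ a : ℝ) (k : ℕ) :
    Measurable (Function.uncurry (binTest ρ g a k)) := by
  have h1 : Measurable fun p : ℝ × ℝ =>
      ordinate (ρ / ((k : ℝ) + 1)) (p.1 * ((((k : ℝ) + 1) / a) ^ (ρ + 1) / a)) p.2 :=
    measurable_ordinate.comp (measurable_const.prodMk
      ((measurable_fst.mul_const _).prodMk measurable_snd))
  exact (hg.continuous_right _).measurable.comp h1

theorem binTest_nonneg (hg : IsTestFun g R) (a : ℝ) (k : ℕ) (t e : ℝ) : 0 ≤ binTest ρ g a k t e :=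
  hg.nonneg _ _

theorem binTest_le_one (hg : IsTestFun g R) (a : ℝ) (k : ℕ) (t e : ℝ) : binTest ρ g a k t e ≤ 1 :=
  hg.le_one _ _

theorem abs_binTest_le_one (hg : IsTestFun g R) (a : ℝ) (k : ℕ) (t e : ℝ) :
    |binTest ρ g a k t e| ≤ 1 := by
  rw [abs_of_nonneg (hg.binTest_nonneg a k t e)]
  exact hg.binTest_le_one a k t e

theorem binWeight_nonneg (hg : IsTestFun g R) {a : ℝ} (ha : 0 < a) (k : ℕ) :
    0 ≤ binWeight ρ g a k :=
  div_nonneg (hg.vertDensity_nonneg (by positivity)) ha.le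

theorem binWeight_le (hg : IsTestFun g R) (hρ : 0 < ρ) {a : ℝ} (ha : 0 < a) (k : ℕ) :
    binWeight ρ g a k ≤ R ^ (ρ + 1) * R / a :=
  div_le_div_of_nonneg_right (hg.vertDensity_le hρ (by positivity)) ha.le

/-- A Riemann sum, from which the `m` first terms, each `O(1 / a)`, may be dropped. -/
theorem tendsto_sum_binWeight (hg : IsTestFun g R) (hρ : 0 < ρ) (m : ℕ) :
    Tendsto (fun a : ℝ => ∑ k ∈ Finset.Ico m ⌊R * a⌋₊, binWeight ρ g a k) atTop
      (𝓝 (∫ x in Set.Ioi 0, vertDensity ρ g x)) := by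
  have hR : 0 < R := zero_lt_one.trans_le hg.one_le
  have h1 := tendsto_riemann_sum (hg.continuous_vertDensity hρ)
    (fun x hx => hg.vertDensity_eq_zero (ρ := ρ) hx)
  have h2 : Tendsto (fun a : ℝ => ∑ k ∈ Finset.range m, binWeight ρ g a k) atTop (𝓝 0) := by
    rw [← Finset.sum_const_zero (s := Finset.range m) (ι := ℕ)]
    refine tendsto_finsetSum _ fun k _ => ?_
    refine squeeze_zero' ?_ ?_ ((tendsto_const_nhds (x := R ^ (ρ + 1) * R)).div_atTop tendsto_id)
    · filter_upwards [eventually_gt_atTop 0] with a ha using hg.binWeight_nonneg ha k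
    · filter_upwards [eventually_gt_atTop 0] with a ha using hg.binWeight_le hρ ha k
  have h3 := h1.sub h2
  rw [sub_zero] at h3
  refine h3.congr' ?_
  have h4 : Tendsto (fun a : ℝ => ⌊R * a⌋₊) atTop atTop :=
    tendsto_nat_floor_atTop.comp (tendsto_id.const_mul_atTop hR)
  filter_upwards [h4.eventually_ge_atTop m] with a ha
  rw [Finset.sum_Ico_eq_sub _ ha]
  rfl

/-- For fixed `k` the denominator of the ordinate is `O(1 / a)` while its numerator is a fixed
positive number, so the point rises above height `R`. -/
theorem eventually_binTest_eq_zero (hg : IsTestFun g R) (hρ : 0 < ρ) (k : ℕ) {t e : ℝ}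
    (ht : 0 < t) (he : 0 < e) : ∀ᶠ a : ℝ in atTop, binTest ρ g a k t e = 0 := by
  have hR : 0 < R := zero_lt_one.trans_le hg.one_le
  have hk : (0 : ℝ) < k + 1 := by positivity
  have hu : 0 < 1 - Real.exp (-(ρ / ((k : ℝ) + 1) * e)) := by
    have : Real.exp (-(ρ / ((k : ℝ) + 1) * e)) < 1 := Real.exp_lt_one_iff.2 (by
      have : 0 < ρ / ((k : ℝ) + 1) * e := by positivity
      linarith)
    linarith
  have h1 : Tendsto (fun a : ℝ => ρ / ((k : ℝ) + 1) * (t * (((k : ℝ) + 1) ^ (ρ + 1) / a)) * R)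
      atTop (𝓝 (ρ / ((k : ℝ) + 1) * (t * 0) * R)) :=
    (((tendsto_const_nhds.div_atTop tendsto_id).const_mul t).const_mul _).mul_const _
  rw [mul_zero, mul_zero, zero_mul] at h1
  filter_upwards [h1.eventually_lt_const hu, eventually_ge_atTop 1] with a ha ha1
  have ha0 : 0 < a := zero_lt_one.trans_le ha1
  refine hg.eq_zero_right _ _ ?_
  rw [ordinate, lt_div_iff₀ (by positivity)]
  refine lt_of_le_of_lt ?_ ha
  rw [mul_comm R]
  have : ((k : ℝ) + 1) / a ≤ k + 1 := div_le_self hk.le ha1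
  gcongr

/-- The estimate is uniform in `k` because `(k + 1) / a ≤ R` and `ρ / (k + 1) ≤ ρ`. -/
theorem abs_integral_binTest_sub_le (hg : IsTestFun g R) (hρ : 0 < ρ) {ε δ L a t : ℝ} (hε : 0 ≤ ε)
    (hδ : ∀ x y y', |y - y'| ≤ δ → |g x y - g x y'| ≤ ε) (ha : 0 < a) (ht : 0 < t) (htL : t ≤ L)
    (h1 : ρ * (L * (R ^ (ρ + 1) / a)) * (R + 1) ^ 2 ≤ δ)
    (h2 : ρ * (L * (R ^ (ρ + 1) / a)) * (R + 1) ^ 2 ≤ 1) {k : ℕ} (hk : k < ⌊R * a⌋₊) :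
    |∫ e, binTest ρ g a k t e ∂(expMeasure 1) - t * binWeight ρ g a k| ≤
      L * (R ^ (ρ + 1) / a) * (R + 1) * (ε + L * (R ^ (ρ + 1) / a) * (R + 1)) := by
  have hR : 0 < R := zero_lt_one.trans_le hg.one_le
  have hk0 : (0 : ℝ) < k + 1 := by positivity
  have hL : 0 < L := ht.trans_le htL
  set c := t * ((((k : ℝ) + 1) / a) ^ (ρ + 1) / a) with hc
  have hc0 : 0 < c := by positivity
  have hx : ((k : ℝ) + 1) / a ≤ R := le_of_lt_floor ha hR.le hk
  have hcL : c ≤ L * (R ^ (ρ + 1) / a) := by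
    rw [hc]
    gcongr
  have hb : ρ / ((k : ℝ) + 1) ≤ ρ := div_le_self hρ.le (by linarith [(Nat.cast_nonneg k : (0:ℝ) ≤ k)])
  have hbc : ρ / ((k : ℝ) + 1) * c * (R + 1) ^ 2 ≤
      ρ * (L * (R ^ (ρ + 1) / a)) * (R + 1) ^ 2 := by gcongr
  have h := abs_integral_test_ordinate_sub_le (hg.continuous_right (((k : ℝ) + 1) / a))
    (hg.nonneg _) (hg.le_one _) hR.le (hg.eq_zero_right _) hε (hδ _)
    (b := ρ / ((k : ℝ) + 1)) (by positivity) hc0 (hbc.trans h1) (hbc.trans h2)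
  have e1 : c * ∫ y in Set.Ioi 0, g (((k : ℝ) + 1) / a) y = t * binWeight ρ g a k := by
    rw [hc, binWeight, vertDensity, vertInt]
    ring
  rw [e1] at h
  refine h.trans ?_
  gcongr

end IsTestFun

/-! ### Estimates for expectations -/

section Expectation

variable {Ω : Type*} [MeasurableSpace Ω] {μ : Measure Ω} [IsProbabilityMeasure μ]

theorem abs_integral_sub_le_measureReal {f g : Ω → ℝ} {S : Set Ω} (hS : MeasurableSet S)
    (hf : AEStronglyMeasurable f μ) (hg : AEStronglyMeasurable g μ)
    (hf0 : ∀ᵐ ω ∂μ, 0 ≤ f ω) (hf1 : ∀ᵐ ω ∂μ, f ω ≤ 1) (hg0 : ∀ᵐ ω ∂μ, 0 ≤ g ω)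
    (hg1 : ∀ᵐ ω ∂μ, g ω ≤ 1)
    (h : ∀ᵐ ω ∂μ, ω ∉ S → f ω = g ω) : |∫ ω, f ω ∂μ - ∫ ω, g ω ∂μ| ≤ μ.real S := by
  have i1 : Integrable f μ := Integrable.of_bound hf 1 (by
    filter_upwards [hf0, hf1] with ω h0 h1
    rwa [Real.norm_of_nonneg h0])
  have i2 : Integrable g μ := Integrable.of_bound hg 1 (by
    filter_upwards [hg0, hg1] with ω h0 h1
    rwa [Real.norm_of_nonneg h0])
  rw [← integral_sub i1 i2, ← Real.norm_eq_abs, ← integral_indicator_one hS]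
  refine norm_integral_le_of_norm_le ((integrable_const (1 : ℝ)).indicator hS) ?_
  filter_upwards [h, hf0, hf1, hg0, hg1] with ω hω h0 h1 h2 h3
  by_cases hs : ω ∈ S
  · rw [Set.indicator_of_mem hs, Real.norm_eq_abs, abs_le, Pi.one_apply]
    constructor <;> linarith
  · rw [Set.indicator_of_notMem hs, hω hs, sub_self, norm_zero]

/-- Supplies the truncation level: off an event of small probability, all `θ k` are at most `L`
simultaneously. -/
theorem exists_measureReal_exceed_le {θ : ℕ → Ω → ℝ} (hθ : ∀ k, Measurable (θ k))
    (hbdd : ∀ᵐ ω ∂μ, BddAbove (Set.range fun k => θ k ω)) {η : ℝ} (hη : 0 < η) :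
    ∃ L : ℝ, 1 ≤ L ∧ μ.real {ω | ∃ k, L < θ k ω} ≤ η := by
  have hm : ∀ L : ℝ, MeasurableSet {ω | ∃ k, L < θ k ω} := fun L => by
    have : {ω | ∃ k, L < θ k ω} = ⋃ k, {ω | L < θ k ω} := by
      ext ω
      simp
    rw [this]
    exact MeasurableSet.iUnion fun k => measurableSet_lt measurable_const (hθ k)
  have h1 : Tendsto (fun L : ℝ => μ.real {ω | ∃ k, L < θ k ω}) atTop (𝓝 0) := by
    have h2 : Tendsto (fun L : ℝ => ∫ ω, {ω | ∃ k, L < θ k ω}.indicator (1 : Ω → ℝ) ω ∂μ) atTop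
        (𝓝 (∫ _, 0 ∂μ)) := by
      refine tendsto_integral_filter_of_dominated_convergence (fun _ => (1 : ℝ)) ?_ ?_
        (integrable_const _) ?_
      · filter_upwards with L
        exact (measurable_one.indicator (hm L)).aestronglyMeasurable
      · filter_upwards with L
        filter_upwards with ω
        refine (norm_indicator_le_norm_self _ _).trans ?_
        simp
      · filter_upwards [hbdd] with ω hω
        obtain ⟨C, hC⟩ := hω
        refine tendsto_const_nhds.congr' ?_
        filter_upwards [eventually_ge_atTop C] with L hL
        rw [Set.indicator_of_notMem]
        rintro ⟨k, hk⟩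
        exact absurd (hC ⟨k, rfl⟩) (not_le.2 (hL.trans_lt hk))
    simpa [integral_indicator_one (hm _)] using h2
  obtain ⟨L, hL1, hL2⟩ := ((eventually_ge_atTop 1).and (h1.eventually_lt_const hη)).exists
  exact ⟨L, hL1, hL2.le⟩

end Expectation

end YuleBins

end

noncomputable section

namespace YuleBins

/-! ### Limits of the Laplace functionals -/

section Limit

variable {Ω : Type*} [mΩ : MeasurableSpace Ω] {μ : Measure Ω} [IsProbabilityMeasure μ]
  {g : ℝ → ℝ → ℝ} {R ρ : ℝ} {E θ : ℕ → Ω → ℝ} {θlim : Ω → ℝ}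

theorem measurable_binTest_comp (hg : IsTestFun g R) (a : ℝ) (k : ℕ) {s t : Ω → ℝ}
    (hs : Measurable s) (ht : Measurable t) : Measurable fun ω => binTest ρ g a k (s ω) (t ω) :=
  (hg.measurable_binTest ρ a k).comp (hs.prodMk ht)

/-- The first points do not contribute. -/
theorem tendsto_integral_prod_sub (hg : IsTestFun g R) (hρ : 0 < ρ) (hE : ∀ i, Measurable (E i))
    (hpos : ∀ i ω, 0 < E i ω) (hθ : ∀ k, Measurable (θ k)) (hθ0 : ∀ k ω, 0 < θ k ω) (m : ℕ) :
    Tendsto (fun a : ℝ =>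
      ∫ ω, ∏ k ∈ Finset.range ⌊R * a⌋₊, (1 - binTest ρ g a k (θ k ω) (E k ω)) ∂μ -
      ∫ ω, ∏ k ∈ Finset.Ico m ⌊R * a⌋₊, (1 - binTest ρ g a k (θ k ω) (E k ω)) ∂μ)
      atTop (𝓝 0) := by
  have hR : 0 < R := zero_lt_one.trans_le hg.one_le
  set F : ℝ → ℕ → Ω → ℝ := fun a k ω => 1 - binTest ρ g a k (θ k ω) (E k ω) with hF
  have hFm : ∀ a k, Measurable (F a k) := fun a k =>
    measurable_const.sub (measurable_binTest_comp hg a k (hθ k) (hE k))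
  have hF0 : ∀ a k ω, 0 ≤ F a k ω := fun a k ω => by
    have := hg.binTest_le_one (ρ := ρ) a k (θ k ω) (E k ω)
    simp only [hF]
    linarith
  have hF1 : ∀ a k ω, F a k ω ≤ 1 := fun a k ω => by
    have := hg.binTest_nonneg (ρ := ρ) a k (θ k ω) (E k ω)
    simp only [hF]
    linarith
  have hPm : ∀ a (s : Finset ℕ), Measurable fun ω => ∏ k ∈ s, F a k ω := fun a s =>
    Finset.measurable_prod _ fun k _ => hFm a k
  have hP0 : ∀ a (s : Finset ℕ) ω, 0 ≤ ∏ k ∈ s, F a k ω := fun a s ω =>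
    Finset.prod_nonneg fun k _ => hF0 a k ω
  have hP1 : ∀ a (s : Finset ℕ) ω, ∏ k ∈ s, F a k ω ≤ 1 := fun a s ω =>
    Finset.prod_le_one (fun k _ => hF0 a k ω) fun k _ => hF1 a k ω
  have hint : ∀ a (s : Finset ℕ), Integrable (fun ω => ∏ k ∈ s, F a k ω) μ := fun a s =>
    Integrable.of_bound (hPm a s).aestronglyMeasurable 1 (ae_of_all _ fun ω => by
      rw [Real.norm_of_nonneg (hP0 a s ω)]
      exact hP1 a s ω)
  have key : Tendsto (fun a : ℝ => ∫ ω, (∏ k ∈ Finset.range ⌊R * a⌋₊, F a k ω -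
      ∏ k ∈ Finset.Ico m ⌊R * a⌋₊, F a k ω) ∂μ) atTop (𝓝 (∫ _, 0 ∂μ)) := by
    refine tendsto_integral_filter_of_dominated_convergence (fun _ => (1 : ℝ)) ?_ ?_
      (integrable_const _) ?_
    · filter_upwards with a
      exact ((hPm a _).sub (hPm a _)).aestronglyMeasurable
    · filter_upwards with a
      filter_upwards with ω
      rw [Real.norm_eq_abs, abs_le]
      constructor <;> linarith [hP0 a (Finset.range ⌊R * a⌋₊) ω, hP1 a (Finset.range ⌊R * a⌋₊) ω,
        hP0 a (Finset.Ico m ⌊R * a⌋₊) ω, hP1 a (Finset.Ico m ⌊R * a⌋₊) ω]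
    · filter_upwards with ω
      refine tendsto_const_nhds.congr' ?_
      have h4 : Tendsto (fun a : ℝ => ⌊R * a⌋₊) atTop atTop :=
        tendsto_nat_floor_atTop.comp (tendsto_id.const_mul_atTop hR)
      have h5 : ∀ᶠ a : ℝ in atTop, ∀ k ∈ Finset.range m,
          binTest ρ g a k (θ k ω) (E k ω) = 0 :=
        (Filter.eventually_all_finset _).2 fun k _ =>
          hg.eventually_binTest_eq_zero hρ k (hθ0 k ω) (hpos k ω)
      filter_upwards [h4.eventually_ge_atTop m, h5] with a ha ha5
      rw [← Finset.prod_range_mul_prod_Ico _ ha, Finset.prod_eq_one (s := Finset.range m), one_mul,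
        sub_self]
      intro k hk
      simp [hF, ha5 k hk]
  rw [integral_zero] at key
  refine key.congr fun a => ?_
  exact integral_sub (hint a _) (hint a _)

/-- Replacing the factors by their conditional expectations, with the positions of the bins frozen
at time `m`. -/
theorem abs_integral_prod_sub_frozen_le (hg : IsTestFun g R) (hρ : 0 < ρ)
    (hE : ∀ i, Measurable (E i)) (hlaw : ∀ i, μ.map (E i) = expMeasure 1) (hindep : iIndepFun E μ)
    (hθ : ∀ k, Measurable[past E k] (θ k)) (hθ0 : ∀ k ω, 0 < θ k ω) {m : ℕ} {ε δ L η a : ℝ}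
    (hL : 0 < L) (hε : 0 ≤ ε) (hη : 0 ≤ η)
    (hδ : ∀ x y y', |y - y'| ≤ δ → |g x y - g x y'| ≤ ε) (ha : 0 < a)
    (h1 : ρ * (L * (R ^ (ρ + 1) / a)) * (R + 1) ^ 2 ≤ δ)
    (h2 : ρ * (L * (R ^ (ρ + 1) / a)) * (R + 1) ^ 2 ≤ 1)
    (h3 : L * (R ^ (ρ + 1) * R / a) ≤ 1)
    (h4 : ∀ k, m ≤ k → ∫ ω, |min (θ k ω) L - min (θ m ω) L| ∂μ ≤ η) (hm : m ≤ ⌊R * a⌋₊) :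
    |∫ ω, ∏ k ∈ Finset.Ico m ⌊R * a⌋₊, (1 - binTest ρ g a k (min (θ k ω) L) (E k ω)) ∂μ -
      ∫ ω, ∏ k ∈ Finset.Ico m ⌊R * a⌋₊, (1 - min (θ m ω) L * binWeight ρ g a k) ∂μ| ≤
      R * a * (L * (R ^ (ρ + 1) / a) * (R + 1) * (ε + L * (R ^ (ρ + 1) / a) * (R + 1)) +
        η * (R ^ (ρ + 1) * R / a)) := by
  have hR : 0 < R := zero_lt_one.trans_le hg.one_le
  set φ : ℕ → Ω → ℝ := fun k ω => min (θ k ω) L with hφ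
  have hφm : ∀ k, Measurable[past E k] (φ k) := fun k => (hθ k).min measurable_const
  have hφm' : ∀ k, Measurable (φ k) := fun k => (hφm k).mono (past_le hE k) le_rfl
  have hφ0 : ∀ k ω, 0 < φ k ω := fun k ω => lt_min (hθ0 k ω) hL
  have hφL : ∀ k ω, φ k ω ≤ L := fun k ω => min_le_right _ _
  have hw0 : ∀ k, 0 ≤ binWeight ρ g a k := fun k => hg.binWeight_nonneg ha k
  have hw1 : ∀ k, binWeight ρ g a k ≤ R ^ (ρ + 1) * R / a := fun k => hg.binWeight_le hρ ha k
  have : IsProbabilityMeasure (expMeasure 1) := isProbabilityMeasure_expMeasure zero_lt_one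
  -- `q k (φ k)` is the conditional mean of the test value given the past.
  set q : ℕ → ℝ → ℝ := fun k t => ∫ e, binTest ρ g a k t e ∂(expMeasure 1) with hq
  have hqm : ∀ k, Measurable (q k) := fun k =>
    (StronglyMeasurable.integral_prod_right (hg.measurable_binTest ρ a k).stronglyMeasurable).measurable
  have hq1 : ∀ k t, |q k t| ≤ 1 := fun k t => by
    rw [← Real.norm_eq_abs]
    refine (norm_integral_le_of_norm_le_const (C := 1) (ae_of_all _ fun e => ?_)).trans ?_
    · exact hg.abs_binTest_le_one a k t e
    · simp
  have key := abs_integral_mul_prod_sub_le (μ := μ) (past_mono E) (past_le hE) (m := m)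
    (X := fun k ω => binTest ρ g a k (φ k ω) (E k ω)) (r := fun k ω => q k (φ k ω))
    (p := fun k ω => φ m ω * binWeight ρ g a k)
    (fun k => (hg.measurable_binTest ρ a k).comp
      (Measurable.prodMk ((hφm k).mono (past_mono E k.le_succ) le_rfl)
        (measurable_past E k.lt_succ_self)))
    (fun k ω => hg.binTest_nonneg _ _ _ _) (fun k ω => hg.binTest_le_one _ _ _ _)
    (fun k => (hφm m).mul_const _) (fun k ω => mul_nonneg (hφ0 m ω).le (hw0 k))
    (fun k ω => (mul_le_mul (hφL m ω) (hw1 k) (hw0 k) hL.le).trans h3)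
    (fun k => (hqm k).comp (hφm' k)) (fun k ω => hq1 k _)
    (fun k A hA hA1 => by
      have := integral_mul_comp_past hE hindep hA hA1 (hφm k) (hg.measurable_binTest ρ a k)
        (hg.abs_binTest_le_one a k)
      rwa [hlaw] at this) hm (fun _ => 1) measurable_const (fun _ => zero_le_one) (fun _ => le_rfl)
  simp only [one_mul] at key
  refine key.trans ?_
  set β := L * (R ^ (ρ + 1) / a) * (R + 1) * (ε + L * (R ^ (ρ + 1) / a) * (R + 1)) with hβ
  have hβ0 : 0 ≤ β := by positivity
  have hterm : ∀ k ∈ Finset.Ico m ⌊R * a⌋₊,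
      ∫ ω, |q k (φ k ω) - φ m ω * binWeight ρ g a k| ∂μ ≤ β + η * (R ^ (ρ + 1) * R / a) := by
    intro k hk
    have hk' := Finset.mem_Ico.1 hk
    have hi : Integrable (fun ω => |φ k ω - φ m ω|) μ := by
      refine Integrable.of_bound ((hφm' k).sub (hφm' m)).abs.aestronglyMeasurable L
        (ae_of_all _ fun ω => ?_)
      rw [Real.norm_eq_abs, abs_abs, abs_le]
      constructor <;> linarith [hφ0 k ω, hφL k ω, hφ0 m ω, hφL m ω]
    calc ∫ ω, |q k (φ k ω) - φ m ω * binWeight ρ g a k| ∂μ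
        ≤ ∫ ω, (β + |φ k ω - φ m ω| * binWeight ρ g a k) ∂μ := by
          refine integral_mono_of_nonneg (ae_of_all _ fun ω => abs_nonneg _)
            ((integrable_const _).add (hi.mul_const _)) (ae_of_all _ fun ω => ?_)
          have e1 := hg.abs_integral_binTest_sub_le hρ hε hδ ha (hφ0 k ω) (hφL k ω) h1 h2 hk'.2
          -- Two errors: the linearization of the conditional mean, and the drift of the level since
          -- time `m`.
          have e2 : q k (φ k ω) - φ m ω * binWeight ρ g a k =
              (q k (φ k ω) - φ k ω * binWeight ρ g a k) +
                (φ k ω - φ m ω) * binWeight ρ g a k := by ring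
          simp only
          rw [e2]
          refine (abs_add_le _ _).trans (add_le_add e1 ?_)
          rw [abs_mul, abs_of_nonneg (hw0 k)]
      _ = β + (∫ ω, |φ k ω - φ m ω| ∂μ) * binWeight ρ g a k := by
          rw [integral_add (integrable_const β) (hi.mul_const _), integral_const,
            integral_mul_const, probReal_univ, one_smul]
      _ ≤ _ := by
          have := mul_le_mul (h4 k hk'.1) (hw1 k) (hw0 k) hη
          linarith
  refine (Finset.sum_le_card_nsmul _ _ _ hterm).trans ?_
  rw [nsmul_eq_mul]
  refine mul_le_mul_of_nonneg_right ?_ (by positivity)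
  -- There are at most `R a` factors, which offsets the `1 / a` in each individual error.
  have h5 : ((Finset.Ico m ⌊R * a⌋₊).card : ℝ) ≤ (⌊R * a⌋₊ : ℝ) := by
    rw [Nat.card_Ico]
    exact_mod_cast Nat.sub_le _ _
  exact h5.trans (Nat.floor_le (by positivity))

/-- The limit of the frozen products. -/
theorem tendsto_integral_prod_frozen (hg : IsTestFun g R) (hρ : 0 < ρ) {φ : Ω → ℝ} {L : ℝ}
    (hφ : Measurable φ) (hφ0 : ∀ ω, 0 < φ ω) (hφL : ∀ ω, φ ω ≤ L) (m : ℕ) :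
    Tendsto (fun a : ℝ =>
      ∫ ω, ∏ k ∈ Finset.Ico m ⌊R * a⌋₊, (1 - φ ω * binWeight ρ g a k) ∂μ) atTop
      (𝓝 (∫ ω, Real.exp (-(φ ω * ∫ x in Set.Ioi 0, vertDensity ρ g x)) ∂μ)) := by
  have hR : 0 < R := zero_lt_one.trans_le hg.one_le
  obtain ⟨ω0⟩ : Nonempty Ω := nonempty_of_isProbabilityMeasure μ
  have hL : 0 < L := (hφ0 ω0).trans_le (hφL ω0)
  set K := L * (R ^ (ρ + 1) * R)
  have hK : Tendsto (fun a : ℝ => K / a) atTop (𝓝 0) := tendsto_const_nhds.div_atTop tendsto_id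
  have hp0 : ∀ {a : ℝ}, 0 < a → ∀ k ω, 0 ≤ φ ω * binWeight ρ g a k := fun ha k ω =>
    mul_nonneg (hφ0 ω).le (hg.binWeight_nonneg ha k)
  have hpK : ∀ {a : ℝ}, 0 < a → ∀ k ω, φ ω * binWeight ρ g a k ≤ K / a := fun ha k ω =>
    (mul_le_mul (hφL ω) (hg.binWeight_le hρ ha k) (hg.binWeight_nonneg ha k) hL.le).trans_eq
      (by rw [mul_div_assoc'])
  refine tendsto_integral_filter_of_dominated_convergence (fun _ => (1 : ℝ)) ?_ ?_
    (integrable_const _) ?_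
  · filter_upwards with a
    exact (Finset.measurable_prod _ fun k _ =>
      measurable_const.sub (hφ.mul_const _)).aestronglyMeasurable
  · filter_upwards [hK.eventually_le_const zero_lt_one, eventually_gt_atTop 0] with a ha ha0
    filter_upwards with ω
    have h1 : ∀ k, 0 ≤ 1 - φ ω * binWeight ρ g a k := fun k => by linarith [hpK ha0 k ω]
    rw [Real.norm_of_nonneg (Finset.prod_nonneg fun k _ => h1 k)]
    exact Finset.prod_le_one (fun k _ => h1 k) fun k _ => by linarith [hp0 ha0 k ω]
  · filter_upwards with ω
    have h1 := (hg.tendsto_sum_binWeight hρ m).const_mul (φ ω)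
    have h2 := (Real.continuous_exp.tendsto _).comp h1.neg
    have h3 := hK.mul h1
    rw [zero_mul] at h3
    have h4 : Tendsto (fun a : ℝ => ∏ k ∈ Finset.Ico m ⌊R * a⌋₊, (1 - φ ω * binWeight ρ g a k) -
        Real.exp (-(φ ω * ∑ k ∈ Finset.Ico m ⌊R * a⌋₊, binWeight ρ g a k))) atTop (𝓝 0) := by
      refine squeeze_zero_norm' ?_ h3
      filter_upwards [hK.eventually_le_const zero_lt_one, eventually_gt_atTop 0] with a ha ha0
      rw [Finset.mul_sum]
      exact abs_prod_one_sub_sub_exp_le _ (fun k _ => hp0 ha0 k ω)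
        (fun k _ => (hpK ha0 k ω).trans ha) fun k _ => hpK ha0 k ω
    have h5 := h4.add h2
    rw [zero_add] at h5
    exact h5.congr fun a => by simp

theorem tendsto_integral_abs_min_sub (hθ : ∀ k, Measurable (θ k)) (hθ0 : ∀ k ω, 0 < θ k ω)
    (hlim : ∀ᵐ ω ∂μ, Tendsto (fun k => θ k ω) atTop (𝓝 (θlim ω))) {L : ℝ} (hL : 0 < L) :
    Tendsto (fun k => ∫ ω, |min (θ k ω) L - min (θlim ω) L| ∂μ) atTop (𝓝 0) := by
  have hθlim : AEMeasurable θlim μ :=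
    aemeasurable_of_tendsto_metrizable_ae atTop (fun k => (hθ k).aemeasurable) hlim
  have h : Tendsto (fun k => ∫ ω, |min (θ k ω) L - min (θlim ω) L| ∂μ) atTop
      (𝓝 (∫ _, 0 ∂μ)) := by
    refine tendsto_integral_of_dominated_convergence (fun _ => L) (fun k => ?_)
      (integrable_const _) (fun k => ?_) ?_
    · exact (((hθ k).min measurable_const).aemeasurable.sub
        (hθlim.min aemeasurable_const)).abs.aestronglyMeasurable
    · filter_upwards [hlim] with ω hω
      have h0 : 0 ≤ θlim ω := ge_of_tendsto' hω fun k => (hθ0 k ω).le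
      rw [Real.norm_eq_abs, abs_abs, abs_le]
      have e1 : 0 ≤ min (θlim ω) L := le_min h0 hL.le
      have e2 : 0 ≤ min (θ k ω) L := le_min (hθ0 k ω).le hL.le
      constructor <;> linarith [min_le_right (θlim ω) L, min_le_right (θ k ω) L]
    · filter_upwards [hlim] with ω hω
      have := ((hω.min (tendsto_const_nhds (x := L))).sub_const (min (θlim ω) L)).abs
      simpa using this
  simpa using h

theorem abs_integral_exp_neg_sub_le {φ ψ : Ω → ℝ} {I : ℝ} (hI : 0 ≤ I) (hφ : AEMeasurable φ μ)
    (hψ : AEMeasurable ψ μ) (hφ0 : ∀ᵐ ω ∂μ, 0 ≤ φ ω) (hψ0 : ∀ᵐ ω ∂μ, 0 ≤ ψ ω)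
    (hint : Integrable (fun ω => |φ ω - ψ ω|) μ) :
    |∫ ω, Real.exp (-(φ ω * I)) ∂μ - ∫ ω, Real.exp (-(ψ ω * I)) ∂μ| ≤
      (∫ ω, |φ ω - ψ ω| ∂μ) * I := by
  have int : ∀ {f : Ω → ℝ}, AEMeasurable f μ → (∀ᵐ ω ∂μ, 0 ≤ f ω) →
      Integrable (fun ω => Real.exp (-(f ω * I))) μ := fun hf h =>
    Integrable.of_bound (hf.mul_const I).neg.exp.aestronglyMeasurable 1 (by
      filter_upwards [h] with ω hω
      rw [Real.norm_of_nonneg (Real.exp_pos _).le, Real.exp_le_one_iff]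
      linarith [mul_nonneg hω hI])
  rw [← integral_sub (int hφ hφ0) (int hψ hψ0), ← Real.norm_eq_abs, ← integral_mul_const]
  refine norm_integral_le_of_norm_le (hint.mul_const I) ?_
  filter_upwards [hφ0, hψ0] with ω h1 h2
  have lip : ∀ {x y : ℝ}, 0 ≤ x → 0 ≤ y → Real.exp (-x) - Real.exp (-y) ≤ |x - y| := by
    intro x y hx hy
    rcases le_total x y with h | h
    · have e1 := one_sub_exp_neg_le (y - x)
      have e2 : Real.exp (-y) = Real.exp (-x) * Real.exp (-(y - x)) := by
        rw [← Real.exp_add]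
        congr 1
        ring
      have e3 : Real.exp (-x) ≤ 1 := Real.exp_le_one_iff.2 (by linarith)
      have e4 : 0 ≤ 1 - Real.exp (-(y - x)) := by
        have := Real.exp_le_one_iff.2 (show -(y - x) ≤ 0 by linarith)
        linarith
      rw [abs_sub_comm, abs_of_nonneg (by linarith : 0 ≤ y - x), e2]
      nlinarith [Real.exp_pos (-x)]
    · have : Real.exp (-x) ≤ Real.exp (-y) := Real.exp_le_exp.2 (by linarith)
      linarith [abs_nonneg (x - y)]
  have h3 := lip (mul_nonneg h1 hI) (mul_nonneg h2 hI)
  have h4 := lip (mul_nonneg h2 hI) (mul_nonneg h1 hI)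
  have h5 : |φ ω * I - ψ ω * I| = |φ ω - ψ ω| * I := by
    rw [← sub_mul, abs_mul, abs_of_nonneg hI]
  rw [abs_sub_comm, h5] at h4
  rw [h5] at h3
  rw [Real.norm_eq_abs, abs_le]
  constructor <;> linarith

/-- Convergence of the Laplace functionals, for test functions. -/
theorem tendsto_integral_prod_one_sub_binTest (hg : IsTestFun g R) (hρ : 0 < ρ)
    (hE : ∀ i, Measurable (E i)) (hpos : ∀ i ω, 0 < E i ω)
    (hlaw : ∀ i, μ.map (E i) = expMeasure 1) (hindep : iIndepFun E μ)
    (hθ : ∀ k, Measurable[past E k] (θ k)) (hθ0 : ∀ k ω, 0 < θ k ω)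
    (hlim : ∀ᵐ ω ∂μ, Tendsto (fun k => θ k ω) atTop (𝓝 (θlim ω))) :
    Tendsto (fun a : ℝ =>
      ∫ ω, ∏ k ∈ Finset.range ⌊R * a⌋₊, (1 - binTest ρ g a k (θ k ω) (E k ω)) ∂μ) atTop
      (𝓝 (∫ ω, Real.exp (-(θlim ω * ∫ x in Set.Ioi 0, vertDensity ρ g x)) ∂μ)) := by
  have hR : 0 < R := zero_lt_one.trans_le hg.one_le
  have hθ' : ∀ k, Measurable (θ k) := fun k => (hθ k).mono (past_le hE k) le_rfl
  have hθlim : AEMeasurable θlim μ :=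
    aemeasurable_of_tendsto_metrizable_ae atTop (fun k => (hθ' k).aemeasurable) hlim
  have hθlim0 : ∀ᵐ ω ∂μ, 0 ≤ θlim ω := by
    filter_upwards [hlim] with ω hω using ge_of_tendsto' hω fun k => (hθ0 k ω).le
  set I := ∫ x in Set.Ioi 0, vertDensity ρ g x with hI
  have hI0 : 0 ≤ I := setIntegral_nonneg measurableSet_Ioi fun x hx =>
    hg.vertDensity_nonneg (le_of_lt hx)
  -- The error budget in units of `η`: one each for the first `m` points, the truncation, the
  -- linearization, the limit of the frozen product and the removal of the truncation; `2 R (R ^ (ρ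
  -- + 1) R)` for the drift of the level; `I` for replacing `θ m` by its limit.
  set K := 4 + 2 * (R * (R ^ (ρ + 1) * R)) + I + 1 with hK
  have hK0 : 0 < K := by positivity
  suffices H : ∀ η : ℝ, 0 < η → ∀ᶠ a : ℝ in atTop,
      |∫ ω, ∏ k ∈ Finset.range ⌊R * a⌋₊, (1 - binTest ρ g a k (θ k ω) (E k ω)) ∂μ -
        ∫ ω, Real.exp (-(θlim ω * I)) ∂μ| < K * η by
    rw [Metric.tendsto_nhds]
    intro ε hε
    filter_upwards [H (ε / K) (by positivity)] with a ha
    rwa [mul_div_cancel₀ _ hK0.ne'] at ha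
  intro η hη
  -- The order of choices matters: `L` for the truncation, then `m` so that truncated levels are
  -- within `η` of their limit in L¹, then `ε` and `δ`, and `a` last.
  obtain ⟨L, hL1, hLη⟩ := exists_measureReal_exceed_le (μ := μ) hθ'
    (by filter_upwards [hlim] with ω hω using hω.bddAbove_range) hη
  have hL : 0 < L := zero_lt_one.trans_le hL1
  have hSm : MeasurableSet {ω | ∃ k, L < θ k ω} := by
    have : {ω | ∃ k, L < θ k ω} = ⋃ k, {ω | L < θ k ω} := by
      ext ω
      simp
    rw [this]
    exact MeasurableSet.iUnion fun k => measurableSet_lt measurable_const (hθ' k)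
  set S := {ω | ∃ k, L < θ k ω} with hS
  have hmin : ∀ ω, ω ∉ S → ∀ k, min (θ k ω) L = θ k ω := fun ω hω k =>
    min_eq_left (not_lt.1 fun h => hω ⟨k, h⟩)
  have hφm : ∀ k, Measurable fun ω => min (θ k ω) L := fun k => (hθ' k).min measurable_const
  have hφ0 : ∀ k ω, 0 < min (θ k ω) L := fun k ω => lt_min (hθ0 k ω) hL
  have hφlim0 : ∀ᵐ ω ∂μ, 0 ≤ min (θlim ω) L := by
    filter_upwards [hθlim0] with ω hω using le_min hω hL.le
  have hφlim : AEMeasurable (fun ω => min (θlim ω) L) μ := hθlim.min aemeasurable_const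
  have hdi : ∀ k, Integrable (fun ω => |min (θ k ω) L - min (θlim ω) L|) μ := fun k => by
    refine Integrable.of_bound ((hφm k).aemeasurable.sub hφlim).abs.aestronglyMeasurable L ?_
    filter_upwards [hφlim0] with ω hω
    rw [Real.norm_eq_abs, abs_abs, abs_le]
    constructor <;> linarith [min_le_right (θlim ω) L, min_le_right (θ k ω) L, hφ0 k ω]
  obtain ⟨m, hm⟩ := eventually_atTop.1
    ((tendsto_integral_abs_min_sub hθ' hθ0 hlim hL).eventually_le_const hη)
  have hm2 : ∀ k, m ≤ k → ∫ ω, |min (θ k ω) L - min (θ m ω) L| ∂μ ≤ 2 * η := fun k hk => by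
    calc ∫ ω, |min (θ k ω) L - min (θ m ω) L| ∂μ
        ≤ ∫ ω, (|min (θ k ω) L - min (θlim ω) L| + |min (θ m ω) L - min (θlim ω) L|) ∂μ := by
          refine integral_mono_of_nonneg (ae_of_all _ fun ω => abs_nonneg _)
            ((hdi k).add (hdi m)) (ae_of_all _ fun ω => ?_)
          have := abs_sub_le (min (θ k ω) L) (min (θlim ω) L) (min (θ m ω) L)
          rwa [abs_sub_comm (min (θlim ω) L)] at this
      _ ≤ 2 * η := by
          rw [integral_add (hdi k) (hdi m)]
          linarith [hm k hk, hm m le_rfl]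
  set C := L * R ^ (ρ + 1) * (R + 1) with hC
  have hC0 : 0 < C := by positivity
  -- Chosen so that `R * C * (ε + ε) = η`; the second `ε` bounds `C / a` for large `a`.
  set ε := η / (2 * R * C) with hε
  have hε0 : 0 < ε := by positivity
  obtain ⟨δ, hδ0, hδ⟩ := hg.equicontinuous ε hε0
  have hdiv : ∀ c : ℝ, Tendsto (fun a : ℝ => c / a) atTop (𝓝 0) := fun c =>
    tendsto_const_nhds.div_atTop tendsto_id
  have h4 : Tendsto (fun a : ℝ => ⌊R * a⌋₊) atTop atTop :=
    tendsto_nat_floor_atTop.comp (tendsto_id.const_mul_atTop hR)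
  have t1 := (tendsto_integral_prod_sub (μ := μ) hg hρ hE hpos hθ' hθ0 m).abs
  have t4 := ((tendsto_integral_prod_frozen (μ := μ) hg hρ (hφm m) (hφ0 m)
    (fun ω => min_le_right _ _) m).sub_const
      (∫ ω, Real.exp (-(min (θ m ω) L * I)) ∂μ)).abs
  rw [abs_zero] at t1
  rw [sub_self, abs_zero] at t4
  have t5 := abs_integral_exp_neg_sub_le (μ := μ) hI0 (hφm m).aemeasurable hφlim
    (ae_of_all _ fun ω => (hφ0 m ω).le) hφlim0 (hdi m)
  have t5' : (∫ ω, |min (θ m ω) L - min (θlim ω) L| ∂μ) * I ≤ η * I :=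
    mul_le_mul_of_nonneg_right (hm m le_rfl) hI0
  have t6 : |∫ ω, Real.exp (-(min (θlim ω) L * I)) ∂μ - ∫ ω, Real.exp (-(θlim ω * I)) ∂μ| ≤
      η := by
    have exp1 : ∀ {x : ℝ}, 0 ≤ x → Real.exp (-(x * I)) ≤ 1 := fun hx =>
      Real.exp_le_one_iff.2 (by linarith [mul_nonneg hx hI0])
    refine (abs_integral_sub_le_measureReal hSm
      (hφlim.mul_const I).neg.exp.aestronglyMeasurable
      (hθlim.mul_const I).neg.exp.aestronglyMeasurable
      (ae_of_all _ fun ω => (Real.exp_pos _).le) ?_ (ae_of_all _ fun ω => (Real.exp_pos _).le)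
      ?_ ?_).trans hLη
    · filter_upwards [hφlim0] with ω hω using exp1 hω
    · filter_upwards [hθlim0] with ω hω using exp1 hω
    · filter_upwards [hlim] with ω hω hs
      have := min_eq_left (le_of_tendsto' hω fun k => not_lt.1 fun h => hs ⟨k, h⟩)
      simp only [Pi.neg_apply, this]
  filter_upwards [t1.eventually_lt_const hη, t4.eventually_lt_const hη, eventually_gt_atTop 0,
    (hdiv (ρ * L * R ^ (ρ + 1) * (R + 1) ^ 2)).eventually_le_const hδ0,
    (hdiv (ρ * L * R ^ (ρ + 1) * (R + 1) ^ 2)).eventually_le_const zero_lt_one,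
    (hdiv (L * (R ^ (ρ + 1) * R))).eventually_le_const zero_lt_one,
    (hdiv C).eventually_le_const hε0, h4.eventually_ge_atTop m]
    with a a1 a4 ha0 b1 b2 b3 b4 b5
  have a2 : |∫ ω, ∏ k ∈ Finset.Ico m ⌊R * a⌋₊, (1 - binTest ρ g a k (θ k ω) (E k ω)) ∂μ -
      ∫ ω, ∏ k ∈ Finset.Ico m ⌊R * a⌋₊, (1 - binTest ρ g a k (min (θ k ω) L) (E k ω)) ∂μ| ≤
      η := by
    have nn : ∀ k t e, 0 ≤ 1 - binTest ρ g a k t e := fun k t e => by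
      linarith [hg.binTest_le_one (ρ := ρ) a k t e]
    have le1 : ∀ k t e, 1 - binTest ρ g a k t e ≤ 1 := fun k t e => by
      linarith [hg.binTest_nonneg (ρ := ρ) a k t e]
    refine (abs_integral_sub_le_measureReal hSm ?_ ?_ ?_ ?_ ?_ ?_ ?_).trans hLη
    · exact (Finset.measurable_prod _ fun k _ => measurable_const.sub
        (measurable_binTest_comp hg a k (hθ' k) (hE k))).aestronglyMeasurable
    · exact (Finset.measurable_prod _ fun k _ => measurable_const.sub
        (measurable_binTest_comp hg a k (hφm k) (hE k))).aestronglyMeasurable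
    · exact ae_of_all _ fun ω => Finset.prod_nonneg fun k _ => nn _ _ _
    · exact ae_of_all _ fun ω => Finset.prod_le_one (fun k _ => nn _ _ _) fun k _ => le1 _ _ _
    · exact ae_of_all _ fun ω => Finset.prod_nonneg fun k _ => nn _ _ _
    · exact ae_of_all _ fun ω => Finset.prod_le_one (fun k _ => nn _ _ _) fun k _ => le1 _ _ _
    · exact ae_of_all _ fun ω hω => by simp only [hmin ω hω]
  have a3 := abs_integral_prod_sub_frozen_le hg hρ hE hlaw hindep hθ hθ0 hL hε0.le
    (by positivity : 0 ≤ 2 * η) hδ ha0 (le_of_eq_of_le (by ring) b1) (le_of_eq_of_le (by ring) b2)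
    (le_of_eq_of_le (by ring) b3) hm2 b5
  have a3' : R * a * (L * (R ^ (ρ + 1) / a) * (R + 1) *
      (ε + L * (R ^ (ρ + 1) / a) * (R + 1)) + 2 * η * (R ^ (ρ + 1) * R / a)) ≤
      η + 2 * (R * (R ^ (ρ + 1) * R)) * η := by
    have e1 : R * a * (L * (R ^ (ρ + 1) / a) * (R + 1) *
      (ε + L * (R ^ (ρ + 1) / a) * (R + 1)) + 2 * η * (R ^ (ρ + 1) * R / a)) =
      R * C * (ε + C / a) + 2 * (R * (R ^ (ρ + 1) * R)) * η := by
      rw [hC]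
      field_simp
    have e2 : R * C * (ε + C / a) ≤ R * C * (ε + ε) := by gcongr
    have e3 : R * C * (ε + ε) = η := by
      rw [hε]
      field_simp
      ring
    rw [e1]
    linarith
  have e : K * η = η + η + (η + 2 * (R * (R ^ (ρ + 1) * R)) * η) + η * I + η + η := by
    rw [hK]
    ring
  rw [e]
  rw [abs_lt] at a1 a4 ⊢
  have a3'' := a3.trans a3'
  have t5'' := t5.trans t5'
  rw [abs_le] at a2 a3'' t5'' t6
  constructor <;> linarith [a1.1, a1.2, a2.1, a2.2, a3''.1, a3''.2, a4.1, a4.2, t5''.1, t5''.2,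
    t6.1, t6.2]

end Limit

end YuleBins

end

noncomputable section

namespace YuleBins

/-! ### Lebesgue measure on the quadrant -/

theorem isClosedEmbedding_coe_prod :
    IsClosedEmbedding fun p : ℝ≥0 × ℝ≥0 => ((p.1 : ℝ), (p.2 : ℝ)) :=
  NNReal.isClosedEmbedding_coe.prodMap NNReal.isClosedEmbedding_coe

theorem range_coe_prod :
    Set.range (fun p : ℝ≥0 × ℝ≥0 => ((p.1 : ℝ), (p.2 : ℝ))) = Set.Ici 0 ×ˢ Set.Ici 0 := by
  ext ⟨x, y⟩
  constructor
  · rintro ⟨p, hp⟩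
    rw [← hp]
    exact ⟨p.1.coe_nonneg, p.2.coe_nonneg⟩
  · rintro ⟨hx, hy⟩
    exact ⟨(⟨x, hx⟩, ⟨y, hy⟩), rfl⟩

theorem integral_quadrantVolume (G : ℝ × ℝ → ℝ) :
    ∫ p : ℝ≥0 × ℝ≥0, G ((p.1 : ℝ), (p.2 : ℝ)) ∂quadrantVolume =
      ∫ z in Set.Ici 0 ×ˢ Set.Ici 0, G z := by
  have h := isClosedEmbedding_coe_prod.measurableEmbedding
  rw [quadrantVolume, ← range_coe_prod, ← h.map_comap, h.integral_map]

instance : IsFiniteMeasureOnCompacts quadrantVolume :=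
  .comap' _ isClosedEmbedding_coe_prod.continuous isClosedEmbedding_coe_prod.measurableEmbedding

/-- The measure `x ^ (ρ + 1) dx dy` on the quadrant. -/
def weightedVolume (ρ : ℝ) : Measure (ℝ≥0 × ℝ≥0) :=
  quadrantVolume.withDensity fun p => ((p.1 ^ (ρ + 1) : ℝ≥0) : ℝ≥0∞)

theorem isLocallyFiniteMeasure_weightedVolume {ρ : ℝ} (hρ : 0 < ρ) :
    IsLocallyFiniteMeasure (weightedVolume ρ) :=
  .withDensity_coe ((NNReal.continuous_rpow_const (by linarith)).comp continuous_fst)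

/-- All limiting intensities are multiples of a single measure, so a kernel indexed by the scalar
factor is enough. -/
theorem limitIntensity_eq_smul {ρ w : ℝ} (hρ : 0 < ρ) (hw : 0 < w) :
    limitIntensity ρ w = (w ^ (-ρ) / ρ).toNNReal • weightedVolume ρ := by
  have hm : Measurable fun p : ℝ≥0 × ℝ≥0 => ((p.1 ^ (ρ + 1) : ℝ≥0) : ℝ≥0∞) := by fun_prop
  have hc : 0 ≤ w ^ (-ρ) / ρ := by positivity
  rw [limitIntensity, weightedVolume]
  rw [ENNReal.smul_def, ← withDensity_smul _ hm]
  congr 1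
  ext p
  rw [ENNReal.ofReal_mul hc, Pi.smul_apply, smul_eq_mul]
  congr 1
  rw [← NNReal.coe_rpow, ENNReal.ofReal_coe_nnreal]

/-! ### The test function attached to a compactly supported function -/

/-- The function `1 - exp (-f)`, extended to the plane. -/
def expTest (f : C_c(ℝ≥0 × ℝ≥0, ℝ≥0)) (x y : ℝ) : ℝ :=
  1 - Real.exp (-(f (x.toNNReal, y.toNNReal) : ℝ))

theorem expTest_coe (f : C_c(ℝ≥0 × ℝ≥0, ℝ≥0)) (p : ℝ≥0 × ℝ≥0) :
    expTest f p.1 p.2 = 1 - Real.exp (-(f p : ℝ)) := by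
  simp [expTest]

theorem exists_isTestFun_expTest (f : C_c(ℝ≥0 × ℝ≥0, ℝ≥0)) : ∃ R, IsTestFun (expTest f) R := by
  obtain ⟨C1, hC1⟩ := (f.hasCompactSupport.isCompact.image continuous_fst).bddAbove
  obtain ⟨C2, hC2⟩ := (f.hasCompactSupport.isCompact.image continuous_snd).bddAbove
  have hz1 : ∀ x y : ℝ, (C1 : ℝ) < x → f (x.toNNReal, y.toNNReal) = 0 := fun x y hx => by
    by_contra hne
    have h1 := hC1 ⟨_, subset_tsupport _ (Function.mem_support.2 hne), rfl⟩
    have h2 : C1 < x.toNNReal := Real.lt_toNNReal_iff_coe_lt.2 hx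
    exact absurd h1 (not_le.2 h2)
  have hz2 : ∀ x y : ℝ, (C2 : ℝ) < y → f (x.toNNReal, y.toNNReal) = 0 := fun x y hy => by
    by_contra hne
    have h1 := hC2 ⟨_, subset_tsupport _ (Function.mem_support.2 hne), rfl⟩
    have h2 : C2 < y.toNNReal := Real.lt_toNNReal_iff_coe_lt.2 hy
    exact absurd h1 (not_le.2 h2)
  set F : ℝ≥0 × ℝ≥0 → ℝ := fun p => 1 - Real.exp (-(f p : ℝ)) with hF
  have hFc : Continuous F := by
    have := map_continuous f
    fun_prop
  have hFs : HasCompactSupport F :=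
    f.hasCompactSupport.comp_left (g := fun r : ℝ≥0 => 1 - Real.exp (-(r : ℝ))) (by simp)
  have hFu := hFs.uniformContinuous_of_continuous hFc
  refine ⟨max 1 (max C1 C2), ?_, ?_, ?_, le_max_left _ _, ?_, ?_, ?_⟩
  · have h : Continuous fun p : ℝ × ℝ => (p.1.toNNReal, p.2.toNNReal) :=
      (continuous_real_toNNReal.comp continuous_fst).prodMk
        (continuous_real_toNNReal.comp continuous_snd)
    exact hFc.comp h
  · intro x y
    have : Real.exp (-(f (x.toNNReal, y.toNNReal) : ℝ)) ≤ 1 :=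
      Real.exp_le_one_iff.2 (neg_nonpos.2 (NNReal.coe_nonneg _))
    simp only [expTest]
    linarith
  · intro x y
    simp only [expTest]
    linarith [Real.exp_pos (-(f (x.toNNReal, y.toNNReal) : ℝ))]
  · intro x y hx
    simp [expTest, hz1 x y (((le_max_left _ _).trans (le_max_right _ _)).trans_lt hx)]
  · intro x y hy
    simp [expTest, hz2 x y (((le_max_right _ _).trans (le_max_right _ _)).trans_lt hy)]
  · intro ε hε
    obtain ⟨δ, hδ, h⟩ := Metric.uniformContinuous_iff.1 hFu ε hε
    -- Half of `δ` turns the weak inequality into the strict one; the map `Real.toNNReal` is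
    -- 1-Lipschitz.
    refine ⟨δ / 2, by positivity, fun x y y' hy => ?_⟩
    refine (h (a := (x.toNNReal, y.toNNReal)) (b := (x.toNNReal, y'.toNNReal)) ?_).le
    rw [Prod.dist_eq, dist_self, max_eq_right dist_nonneg]
    have := Real.lipschitzWith_toNNReal.dist_le_mul y y'
    rw [NNReal.coe_one, one_mul, Real.dist_eq] at this
    linarith

theorem IsTestFun.integral_quadrantVolume {g : ℝ → ℝ → ℝ} {R ρ : ℝ} (hg : IsTestFun g R)
    (hρ : 0 < ρ) :
    ∫ p : ℝ≥0 × ℝ≥0, g p.1 p.2 * (p.1 : ℝ) ^ (ρ + 1) ∂quadrantVolume =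
      ∫ x in Set.Ioi 0, vertDensity ρ g x := by
  have hR : 0 < R := zero_lt_one.trans_le hg.one_le
  have hc : Continuous fun z : ℝ × ℝ => g z.1 z.2 * z.1 ^ (ρ + 1) :=
    hg.continuous.mul (continuous_fst.rpow_const fun _ => Or.inr (by linarith))
  rw [YuleBins.integral_quadrantVolume fun z => g z.1 z.2 * z.1 ^ (ρ + 1), Measure.volume_eq_prod,
    setIntegral_prod, integral_Ici_eq_integral_Ioi]
  · refine setIntegral_congr_fun measurableSet_Ioi fun x _ => ?_
    simp only [vertDensity, vertInt]
    rw [integral_mul_const, integral_Ici_eq_integral_Ioi, mul_comm]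
  · rw [← Measure.volume_eq_prod]
    have hi : IntegrableOn (fun z : ℝ × ℝ => g z.1 z.2 * z.1 ^ (ρ + 1))
        (Set.Icc 0 R ×ˢ Set.Icc 0 R) :=
      hc.continuousOn.integrableOn_compact (isCompact_Icc.prod isCompact_Icc)
    refine hi.of_forall_sdiff_eq_zero (measurableSet_Ici.prod measurableSet_Ici) fun z hz => ?_
    obtain ⟨⟨h1, h2⟩, h3⟩ := hz
    by_cases hx : z.1 ≤ R
    · have hy : R < z.2 := not_le.1 fun hy => h3 ⟨⟨h1, hx⟩, ⟨h2, hy⟩⟩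
      rw [hg.eq_zero_right _ _ hy, zero_mul]
    · rw [hg.eq_zero_left _ _ (not_le.1 hx), zero_mul]

theorem toReal_lintegral_weightedVolume (ρ : ℝ) (f : C_c(ℝ≥0 × ℝ≥0, ℝ≥0)) :
    (∫⁻ p, (1 - expNeg (f p)) ∂(weightedVolume ρ)).toReal =
      ∫ p, (1 - Real.exp (-(f p : ℝ))) * (p.1 : ℝ) ^ (ρ + 1) ∂quadrantVolume := by
  have hf : Measurable f := (map_continuous f).measurable
  have hm : Measurable fun p : ℝ≥0 × ℝ≥0 => ((p.1 ^ (ρ + 1) : ℝ≥0) : ℝ≥0∞) := by fun_prop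
  have hm2 : Measurable fun p : ℝ≥0 × ℝ≥0 => 1 - expNeg (f p) :=
    measurable_const.sub (measurable_expNeg.comp (measurable_coe_nnreal_ennreal.comp hf))
  have h1 : ∀ p, 0 ≤ 1 - Real.exp (-(f p : ℝ)) := fun p => by
    have : Real.exp (-(f p : ℝ)) ≤ 1 :=
      Real.exp_le_one_iff.2 (neg_nonpos.2 (NNReal.coe_nonneg _))
    linarith
  rw [weightedVolume, lintegral_withDensity_eq_lintegral_mul _ hm hm2,
    integral_eq_lintegral_of_nonneg_ae (ae_of_all _ fun p => mul_nonneg (h1 p)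
      (Real.rpow_nonneg (NNReal.coe_nonneg _) _)) (by fun_prop)]
  congr 1
  refine lintegral_congr fun p => ?_
  rw [Pi.mul_apply, ENNReal.ofReal_mul (h1 p), ← NNReal.coe_rpow, ENNReal.ofReal_coe_nnreal,
    mul_comm, ← ENNReal.ofReal_coe_nnreal (p := f p), expNeg_ofReal (NNReal.coe_nonneg _),
    ENNReal.ofReal_sub _ (Real.exp_pos _).le, ENNReal.ofReal_one]

/-! ### The Laplace functional of the point process -/

section Points

variable {Ω : Type*}

/-- The normalized position of the bins. -/
def binLevel (ρ : ℝ) (E : ℕ → Ω → ℝ) (k : ℕ) (ω : Ω) : ℝ :=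
  Real.exp (ρ * (binEnd E k ω - Real.log ((k : ℝ) + 1))) / ρ

theorem binLevel_pos {ρ : ℝ} (hρ : 0 < ρ) (E : ℕ → Ω → ℝ) (k : ℕ) (ω : Ω) :
    0 < binLevel ρ E k ω := by
  unfold binLevel
  positivity

theorem binEnd_succ (E : ℕ → Ω → ℝ) (k : ℕ) (ω : Ω) :
    binEnd E (k + 1) ω = binEnd E k ω + E k ω / ((k : ℝ) + 1) :=
  Finset.sum_range_succ _ _

theorem coe_binPoint_fst (ρ : ℝ) (E : ℕ → Ω → ℝ) (n : ℕ+) (ω : Ω) (k : ℕ) :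
    ((binPoint ρ E n ω k).1 : ℝ) = ((k : ℝ) + 1) / ((n : ℕ) : ℝ) ^ (1 / (ρ + 2)) := by
  simp [binPoint]

/-- Since `n = a ^ (ρ + 2)`, the denominator of the ordinate collapses to `exp (ρ t_k) / n`, and
`P_{k+1}` is `exp (-ρ t_k)` times the numerator. -/
theorem coe_binPoint_snd {ρ : ℝ} (hρ : 0 < ρ) {E : ℕ → Ω → ℝ} {ω : Ω} (hpos : ∀ i, 0 < E i ω)
    (n : ℕ+) (k : ℕ) :
    ((binPoint ρ E n ω k).2 : ℝ) = ordinate (ρ / ((k : ℝ) + 1)) (binLevel ρ E k ω *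
      ((((k : ℝ) + 1) / ((n : ℕ) : ℝ) ^ (1 / (ρ + 2))) ^ (ρ + 1) /
        ((n : ℕ) : ℝ) ^ (1 / (ρ + 2)))) (E k ω) := by
  have hn : (0 : ℝ) < ((n : ℕ) : ℝ) := by exact_mod_cast n.pos
  have hk : (0 : ℝ) < (k : ℝ) + 1 := by positivity
  have h0 : 0 ≤ binEnd E k ω := Finset.sum_nonneg fun i _ => div_nonneg (hpos i).le (by positivity)
  have h1 : binEnd E k ω ≤ binEnd E (k + 1) ω := by
    rw [binEnd_succ]
    linarith [div_nonneg (hpos k).le hk.le]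
  set a := ((n : ℕ) : ℝ) ^ (1 / (ρ + 2)) with ha
  have ha0 : 0 < a := Real.rpow_pos_of_pos hn _
  have han : a ^ (ρ + 1) * a = (n : ℕ) := by
    rw [← Real.rpow_add_one ha0.ne', ha, ← Real.rpow_mul hn.le,
      show 1 / (ρ + 2) * (ρ + 1 + 1) = 1 by field_simp; ring, Real.rpow_one]
  have hden : ρ / ((k : ℝ) + 1) * (binLevel ρ E k ω * ((((k : ℝ) + 1) / a) ^ (ρ + 1) / a)) =
      Real.exp (ρ * binEnd E k ω) / (n : ℕ) := by
    rw [binLevel, Real.div_rpow hk.le ha0.le, Real.rpow_add_one hk.ne', div_div, han, mul_sub,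
      Real.exp_sub, mul_comm ρ (Real.log _), ← Real.rpow_def_of_pos hk]
    have := Real.rpow_pos_of_pos hk ρ
    field_simp
  have hexp : Real.exp (-(ρ * binEnd E (k + 1) ω)) =
      Real.exp (-(ρ * binEnd E k ω)) * Real.exp (-(ρ / ((k : ℝ) + 1) * E k ω)) := by
    rw [binEnd_succ, ← Real.exp_add]
    congr 1
    ring
  rw [ordinate, hden]
  simp only [binPoint, NNReal.coe_mul, NNReal.coe_natCast]
  rw [coe_binProb hρ E k ω h0 h1, hexp, Real.exp_neg (ρ * binEnd E k ω)]
  have := Real.exp_pos (ρ * binEnd E k ω)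
  field_simp

/-- Points with abscissa beyond `R` lie outside the support of `f`, so the product is finite, and
`exp (-f)` is one minus the test function. -/
theorem exp_neg_integral_binProcess {ρ R : ℝ} (hρ : 0 < ρ) {E : ℕ → Ω → ℝ} {ω : Ω}
    (hpos : ∀ i, 0 < E i ω) (f : C_c(ℝ≥0 × ℝ≥0, ℝ≥0)) (hR : IsTestFun (expTest f) R) (n : ℕ+) :
    Real.exp (-∫ p, (f p : ℝ) ∂(binProcess ρ E n ω).toMeasure) =
      ∏ k ∈ Finset.range ⌊R * ((n : ℕ) : ℝ) ^ (1 / (ρ + 2))⌋₊,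
        (1 - binTest ρ (expTest f) (((n : ℕ) : ℝ) ^ (1 / (ρ + 2))) k
          (binLevel ρ E k ω) (E k ω)) := by
  have hn : (0 : ℝ) < ((n : ℕ) : ℝ) := by exact_mod_cast n.pos
  set a := ((n : ℕ) : ℝ) ^ (1 / (ρ + 2)) with ha
  have ha0 : 0 < a := Real.rpow_pos_of_pos hn _
  have hval : ∀ k, binTest ρ (expTest f) a k (binLevel ρ E k ω) (E k ω) =
      1 - Real.exp (-(f (binPoint ρ E n ω k) : ℝ)) := fun k => by
    rw [← expTest_coe, coe_binPoint_fst, coe_binPoint_snd hρ hpos]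
    rfl
  have h0 : ∀ k ∉ Finset.range ⌊R * a⌋₊, (f (binPoint ρ E n ω k) : ℝ) = 0 := fun k hk => by
    have h1 := lt_of_floor_le ha0 (not_lt.1 fun h => hk (Finset.mem_range.2 h))
    have h2 := hR.eq_zero_left _ (binPoint ρ E n ω k).2 h1
    rw [ha, ← coe_binPoint_fst ρ E n ω k, expTest_coe, sub_eq_zero, eq_comm,
      Real.exp_eq_one_iff] at h2
    linarith
  have hint := RadonMeasure.integrable_coe (binProcess ρ E n ω) f
  have e : ∫ p, (f p : ℝ) ∂(binProcess ρ E n ω).toMeasure =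
      ∑ k ∈ Finset.range ⌊R * a⌋₊, (f (binPoint ρ E n ω k) : ℝ) := by
    rw [← tsum_eq_sum (L := .unconditional ℕ) h0]
    refine (integral_sum_measure hint).trans ?_
    simp only [integral_dirac]
  rw [e, ← Finset.sum_neg_distrib, Real.exp_sum]
  refine Finset.prod_congr rfl fun k _ => ?_
  rw [hval, sub_sub_cancel]

end Points

end YuleBins

end

/-! ### Assembly: the bin process and its limit -/

noncomputable section

namespace YuleBins

section Main

variable {Ω : Type*}

theorem measurable_past_binLevel (ρ : ℝ) (E : ℕ → Ω → ℝ) (k : ℕ) :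
    Measurable[past E k] (binLevel ρ E k) := by
  have h : Measurable[past E k] (binEnd E k) :=
    Finset.measurable_sum _ fun i hi =>
      (measurable_past E (Finset.mem_range.1 hi)).div_const _
  exact (Real.measurable_exp.comp ((h.sub_const _).const_mul ρ)).div_const ρ

theorem tendsto_binLevel {ρ : ℝ} {E : ℕ → Ω → ℝ} {ω : Ω}
    (h : Tendsto (fun n : ℕ => binEnd E n ω - Real.log n) atTop (𝓝 (limM E ω))) :
    Tendsto (fun k => binLevel ρ E k ω) atTop (𝓝 (limW E ω ^ (-ρ) / ρ)) := by
  have h1 : Tendsto (fun k : ℕ => binEnd E k ω - Real.log ((k : ℝ) + 1)) atTop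
      (𝓝 (limM E ω)) := by
    have h2 := h.sub Real.tendsto_log_nat_add_one_sub_log
    rw [sub_zero] at h2
    exact h2.congr fun k => by ring
  have h3 := ((Real.continuous_exp.tendsto _).comp (h1.const_mul ρ)).div_const ρ
  rw [limW, ← Real.exp_mul, neg_mul_neg, mul_comm]
  exact h3

variable [MeasurableSpace Ω] {μ : Measure Ω}

theorem measurable_binEnd {E : ℕ → Ω → ℝ} (hE : ∀ i, Measurable (E i)) (n : ℕ) :
    Measurable (binEnd E n) :=
  Finset.measurable_sum _ fun i _ => (hE i).div_const _

theorem tendsto_laplace_binProcess [IsProbabilityMeasure μ] {ρ : ℝ} (hρ : 0 < ρ) {E : ℕ → Ω → ℝ}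
    (hE : ∀ i, Measurable (E i)) (hpos : ∀ i ω, 0 < E i ω)
    (hlaw : ∀ i, HasLaw (E i) (expMeasure 1) μ) (hindep : iIndepFun E μ)
    (f : C_c(ℝ≥0 × ℝ≥0, ℝ≥0)) :
    Tendsto
      (fun n : ℕ+ => ∫ ω, Real.exp (-∫ p, (f p : ℝ) ∂(binProcess ρ E n ω).toMeasure) ∂μ)
      atTop
      (𝓝 (∫ ω, Real.exp (-(limW E ω ^ (-ρ) / ρ *
        ∫ p, (1 - Real.exp (-(f p : ℝ))) * (p.1 : ℝ) ^ (ρ + 1) ∂quadrantVolume)) ∂μ)) := by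
  obtain ⟨R, hR⟩ := exists_isTestFun_expTest f
  have hlim : ∀ᵐ ω ∂μ, Tendsto (fun k => binLevel ρ E k ω) atTop
      (𝓝 (limW E ω ^ (-ρ) / ρ)) := by
    filter_upwards [ae_tendsto_binEnd_sub_log hE hlaw hindep] with ω hω using tendsto_binLevel hω
  have h1 := tendsto_integral_prod_one_sub_binTest hR hρ hE hpos (fun i => (hlaw i).map_eq)
    hindep (measurable_past_binLevel ρ E) (binLevel_pos hρ E) hlim
  have hn : Tendsto (fun n : ℕ+ => ((n : ℕ) : ℝ) ^ (1 / (ρ + 2))) atTop atTop :=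
    (tendsto_rpow_atTop (by positivity)).comp
      (tendsto_natCast_atTop_atTop.comp tendsto_PNat_val_atTop_atTop)
  have h2 := h1.comp hn
  rw [← hR.integral_quadrantVolume hρ] at h2
  simp only [expTest_coe] at h2
  refine h2.congr fun n => ?_
  refine integral_congr_ae (ae_of_all _ fun ω => ?_)
  exact (exp_neg_integral_binProcess hρ (fun i => hpos i ω) f hR n).symm

/-- The integral of a test function is `-log` of a finite product of measurable factors. -/
theorem measurable_binProcess {ρ : ℝ} (hρ : 0 < ρ) {E : ℕ → Ω → ℝ}
    (hE : ∀ i, Measurable (E i)) (hpos : ∀ i ω, 0 < E i ω) (n : ℕ+) :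
    Measurable (binProcess ρ E n) := by
  refine RadonMeasure.measurable_of_integral fun f => ?_
  obtain ⟨R, hR⟩ := exists_isTestFun_expTest f
  have h : ∀ ω, ∫ p, (f p : ℝ) ∂(binProcess ρ E n ω).toMeasure = -Real.log
      (∏ k ∈ Finset.range ⌊R * ((n : ℕ) : ℝ) ^ (1 / (ρ + 2))⌋₊,
        (1 - binTest ρ (expTest f) (((n : ℕ) : ℝ) ^ (1 / (ρ + 2))) k
          (binLevel ρ E k ω) (E k ω))) := fun ω => by
    rw [← exp_neg_integral_binProcess hρ (fun i => hpos i ω) f hR n, Real.log_exp, neg_neg]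
  simp only [h]
  refine (Real.measurable_log.comp (Finset.measurable_prod _ fun k _ =>
    measurable_const.sub (measurable_binTest_comp hR _ k ?_ (hE k)))).neg
  exact (measurable_past_binLevel ρ E k).mono (past_le hE k) le_rfl

/-- Exponential variables agree almost surely with measurable positive ones. -/
theorem exists_measurable_pos_version {E : ℕ → Ω → ℝ}
    (hlaw : ∀ i, HasLaw (E i) (expMeasure 1) μ) :
    ∃ E' : ℕ → Ω → ℝ, (∀ i, Measurable (E' i)) ∧ (∀ i ω, 0 < E' i ω) ∧ ∀ i, E i =ᵐ[μ] E' i := by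
  refine ⟨fun i ω => if 0 < (hlaw i).aemeasurable.mk (E i) ω then
    (hlaw i).aemeasurable.mk (E i) ω else 1, fun i => ?_, fun i ω => ?_, fun i => ?_⟩
  · have hm := (hlaw i).aemeasurable.measurable_mk
    exact Measurable.ite (measurableSet_lt measurable_const hm) hm measurable_const
  · dsimp only
    split_ifs with h
    exacts [h, one_pos]
  · have h := ae_pos_expMeasure_one
    rw [← (hlaw i).map_eq] at h
    filter_upwards [(hlaw i).aemeasurable.ae_eq_mk, ae_of_ae_map (hlaw i).aemeasurable h]
      with ω h1 h2
    rw [← h1, if_pos h2]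

end Main

theorem binEnd_congr {Ω : Type*} {E E' : ℕ → Ω → ℝ} {ω : Ω} (h : ∀ i, E i ω = E' i ω) (n : ℕ) :
    binEnd E n ω = binEnd E' n ω := by
  simp only [binEnd, h]

theorem limM_congr {Ω : Type*} {E E' : ℕ → Ω → ℝ} {ω : Ω} (h : ∀ i, E i ω = E' i ω) :
    limM E ω = limM E' ω := by
  simp only [limM, binEnd_congr h]

theorem binProcess_congr {Ω : Type*} {E E' : ℕ → Ω → ℝ} {ω : Ω} (h : ∀ i, E i ω = E' i ω)
    (ρ : ℝ) (n : ℕ+) : binProcess ρ E n ω = binProcess ρ E' n ω := by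
  simp only [binProcess, binPoint, binProb, binEnd_congr h]

end YuleBins

end

theorem mainTheorem2 {Ω : Type*} [MeasurableSpace Ω] (μ : Measure Ω) [IsProbabilityMeasure μ]
    (ρ : ℝ) (hρ : 0 < ρ) (E : ℕ → Ω → ℝ)
    (hlaw : ∀ i, HasLaw (E i) (expMeasure 1) μ) (hindep : iIndepFun E μ) :
    -- `M_∞` is almost surely the limit of `t_n - log n`, and `W_∞ = exp (- M_∞)`
    (∀ᵐ ω ∂μ, Tendsto (fun n : ℕ => YuleBins.binEnd E n ω - Real.log n) atTop
      (𝓝 (YuleBins.limM E ω))) ∧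
    -- convergence in distribution to the second component of a pair whose first component has
    -- the law of `W_∞`, and whose second component is, given that the first is `w`, a Poisson
    -- process with intensity `(w^{-ρ} / ρ) x^{ρ+1} dx dy`
    (∃ (κ : Kernel ℝ (YuleBins.RadonMeasure (ℝ≥0 × ℝ≥0)))
        (π : ProbabilityMeasure (ℝ × YuleBins.RadonMeasure (ℝ≥0 × ℝ≥0))),
      IsMarkovKernel κ ∧
      (∀ w : ℝ, 0 < w → YuleBins.IsPoissonLaw (YuleBins.limitIntensity ρ w) (κ w)) ∧
      (π : Measure (ℝ × YuleBins.RadonMeasure (ℝ≥0 × ℝ≥0))) = (μ.map (YuleBins.limW E)) ⊗ₘ κ ∧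
      TendstoInDistribution (YuleBins.binProcess ρ E) atTop Prod.snd (fun _ : ℕ+ => μ)
        (π : Measure (ℝ × YuleBins.RadonMeasure (ℝ≥0 × ℝ≥0)))) ∧
    -- convergence of the Laplace functionals
    (∀ f : C_c(ℝ≥0 × ℝ≥0, ℝ≥0),
      Tendsto
        (fun n : ℕ+ => ∫ ω, Real.exp (-∫ p, (f p : ℝ) ∂(YuleBins.binProcess ρ E n ω).toMeasure) ∂μ)
        atTop
        (𝓝 (∫ ω, Real.exp (-((YuleBins.limW E ω) ^ (-ρ) / ρ *
          ∫ p, (1 - Real.exp (-(f p : ℝ))) * (p.1 : ℝ) ^ (ρ + 1)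
            ∂YuleBins.quadrantVolume)) ∂μ))) := by
  open YuleBins in
  -- The laws give measurability and positivity only almost surely. The work is done on a version
  -- where both hold everywhere, and a single null set carries the results back.
  obtain ⟨E', hE', hpos, heq⟩ := exists_measurable_pos_version hlaw
  have hae : ∀ᵐ ω ∂μ, ∀ i, E i ω = E' i ω := ae_all_iff.2 heq
  have hlaw' : ∀ i, HasLaw (E' i) (expMeasure 1) μ := fun i => (hlaw i).congr (heq i).symm
  have hindep' : iIndepFun E' μ := hindep.congr heq
  have hM : ∀ᵐ ω ∂μ, Tendsto (fun n : ℕ => binEnd E n ω - Real.log n) atTop (𝓝 (limM E ω)) := by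
    filter_upwards [hae, ae_tendsto_binEnd_sub_log hE' hlaw' hindep'] with ω h1 h2
    simp only [binEnd_congr h1, limM_congr h1]
    exact h2
  have hL : ∀ f : C_c(ℝ≥0 × ℝ≥0, ℝ≥0), Tendsto
      (fun n : ℕ+ => ∫ ω, Real.exp (-∫ p, (f p : ℝ) ∂(binProcess ρ E n ω).toMeasure) ∂μ) atTop
      (𝓝 (∫ ω, Real.exp (-((limW E ω) ^ (-ρ) / ρ *
        ∫ p, (1 - Real.exp (-(f p : ℝ))) * (p.1 : ℝ) ^ (ρ + 1) ∂quadrantVolume)) ∂μ)) := by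
    intro f
    have h := tendsto_laplace_binProcess hρ hE' hpos hlaw' hindep' f
    have e1 : ∀ n : ℕ+, ∫ ω, Real.exp (-∫ p, (f p : ℝ) ∂(binProcess ρ E' n ω).toMeasure) ∂μ =
        ∫ ω, Real.exp (-∫ p, (f p : ℝ) ∂(binProcess ρ E n ω).toMeasure) ∂μ := fun n =>
      integral_congr_ae (by filter_upwards [hae] with ω hω; rw [binProcess_congr hω])
    have e2 : ∫ ω, Real.exp (-((limW E' ω) ^ (-ρ) / ρ *
        ∫ p, (1 - Real.exp (-(f p : ℝ))) * (p.1 : ℝ) ^ (ρ + 1) ∂quadrantVolume)) ∂μ =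
        ∫ ω, Real.exp (-((limW E ω) ^ (-ρ) / ρ *
        ∫ p, (1 - Real.exp (-(f p : ℝ))) * (p.1 : ℝ) ^ (ρ + 1) ∂quadrantVolume)) ∂μ :=
      integral_congr_ae (by
        filter_upwards [hae] with ω hω
        rw [limW, limW, limM_congr hω])
    simp only [e1, e2] at h
    exact h
  have hX : ∀ n, AEMeasurable (binProcess ρ E n) μ := fun n =>
    ⟨binProcess ρ E' n, measurable_binProcess hρ hE' hpos n, by
      filter_upwards [hae] with ω hω using binProcess_congr hω ρ n⟩
  have hW : AEMeasurable (limW E) μ := by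
    have h1 : AEMeasurable (limM E) μ := by
      refine aemeasurable_of_tendsto_metrizable_ae atTop (fun n => ?_) hM
      refine AEMeasurable.sub_const ⟨binEnd E' n, measurable_binEnd hE' n, ?_⟩ _
      filter_upwards [hae] with ω hω using binEnd_congr hω n
    exact h1.neg.exp
  have : IsLocallyFiniteMeasure (weightedVolume ρ) := isLocallyFiniteMeasure_weightedVolume hρ
  obtain ⟨κ, hκ, hκP, hκL⟩ := RadonMeasure.exists_kernel_poisson (weightedVolume ρ)
  -- The Poisson kernel is reindexed by `w`. Truncation by `toNNReal` changes nothing for `w > 0`,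
  -- and `limW` is an exponential.
  have hc : Measurable fun w : ℝ => (w ^ (-ρ) / ρ).toNNReal := by fun_prop
  have : IsProbabilityMeasure (μ.map (limW E)) := Measure.isProbabilityMeasure_map hW
  let π : ProbabilityMeasure (ℝ × RadonMeasure (ℝ≥0 × ℝ≥0)) :=
    ⟨(μ.map (limW E)) ⊗ₘ (κ.comap _ hc), inferInstance⟩
  refine ⟨hM, ⟨κ.comap _ hc, π, inferInstance, fun w hw => ?_, rfl,
    ⟨hX, measurable_snd.aemeasurable, ?_⟩⟩, hL⟩
  · rw [limitIntensity_eq_smul hρ hw, Kernel.comap_apply]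
    exact hκP _
  refine RadonMeasure.tendsto_of_tendsto_laplace fun f => ?_
  have hF : Measurable fun ν : RadonMeasure (ℝ≥0 × ℝ≥0) =>
      Real.exp (-∫ x, (f x : ℝ) ∂ν.toMeasure) :=
    (Real.continuous_exp.comp (RadonMeasure.continuous_integral_coe f).neg).measurable
  have hF2 : Measurable fun z : ℝ × RadonMeasure (ℝ≥0 × ℝ≥0) =>
      Real.exp (-∫ x, (f x : ℝ) ∂z.2.toMeasure) := hF.comp measurable_snd
  have hF1 : ∀ ν : RadonMeasure (ℝ≥0 × ℝ≥0), ‖Real.exp (-∫ x, (f x : ℝ) ∂ν.toMeasure)‖ ≤ 1 :=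
    fun ν => by
      rw [Real.norm_of_nonneg (Real.exp_pos _).le, Real.exp_le_one_iff, neg_nonpos]
      exact integral_nonneg fun x => NNReal.coe_nonneg _
  simp only [ProbabilityMeasure.coe_mk, π]
  rw [integral_map measurable_snd.aemeasurable hF.aestronglyMeasurable,
    Measure.integral_compProd (Integrable.of_bound
      hF2.aestronglyMeasurable 1 (ae_of_all _ fun z => hF1 z.2))]
  -- Conditioning on the first component: the inner integral is the Poisson Laplace functional, so
  -- the limit is the one in `hL`.
  simp only [Kernel.comap_apply, hκL, toReal_lintegral_weightedVolume]
  rw [integral_map hW (by fun_prop)]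
  convert hL f using 1
  · ext n
    rw [integral_map (hX n) hF.aestronglyMeasurable]
  · congr 1
    refine integral_congr_ae (ae_of_all _ fun ω => ?_)
    have : 0 ≤ limW E ω ^ (-ρ) / ρ := div_nonneg (Real.rpow_nonneg (Real.exp_pos _).le _) hρ.le
    simp only [Real.coe_toNNReal _ this]
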